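/- Let $n>2$ be finite. Let $\mathsf K$ be any of the four types of algebras lying between $\mathsf{Sc}$ and $\mathsf{PEA}$: Pinter's substitution algebras $\mathsf{Sc}$ (operators $\mathsf c_i,\mathsf s_{[i/j]}$), cylindric algebras $\mathsf{CA}$ ($\mathsf c_i,\mathsf d_{ij}$), polyadic algebras $\mathsf{PA}$ ($\mathsf c_i,\mathsf s_\tau$) and polyadic equality algebras $\mathsf{PEA}$ ($\mathsf c_i,\mathsf s_\tau,\mathsf d_{ij}$), where $i,j<m$ and $\tau:m\to m$ in dimension $m$. For $m\ge n$ let $S\mathfrak{Nr}_n\mathsf K_m$ be the class of all algebras $\mathfrak A$ of the type of $\mathsf K_n$ for which there are $\mathfrak B\in\mathsf K_m$ and an injective homomorphism of $\mathfrak A$ into the neat reduct $\mathfrak{Nr}_n\mathfrak B$, the algebra of the elements $b$ of $\mathfrak B$ with $\mathsf c_ib=b$ for $n\le i<m$, with the operations of $\mathfrak B$ whose indices are below $n$. For an atomic algebra $\mathfrak A$ let $\mathfrak{Cm}\,\mathrm{At}\,\mathfrak A$ be the complex algebra of its atom structure. A class $V$ is atom-canonical if $\mathfrak{Cm}\,\mathrm{At}\,\mathfrak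 A\in V$ for every atomic $\mathfrak A\in V$. Then for every such $\mathsf K$ and every $k\ge 4$, the variety $S\mathfrak{Nr}_n\mathsf K_{n+k}$ is not atom-canonical. Moreover, there is a $\mathsf{PEA}_n$ atom structure $F$ (a relational structure with $\mathfrak{Cm}\,F\in\mathsf{PEA}_n$) such that the term algebra $\mathfrak{Tm}\,F$, the subalgebra of $\mathfrak{Cm}\,F$ generated by the singletons, is representable as a polyadic equality algebra (it embeds into a product of full set algebras $\wp({}^nU)$), while $\mathfrak{Cm}\,F$ has a finite subalgebra whose $\mathsf{Sc}$-reduct is not in $S\mathfrak{Nr}_n\mathsf{Sc}_{n+4}$. -/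

import Mathlib

namespace CylAlg

/-- The types of algebras considered: Pinter's substitution algebras, cylindric algebras,
polyadic algebras, and polyadic equality algebras. -/
inductive Kind
  | Sc
  | CA
  | PA
  | PEA

/-- The replacement `[i/j]`: it sends `i` to `j` and fixes everything else. -/
def repl {n : ℕ} (i j : Fin n) : Fin n → Fin n := Function.update id i j

/-- The maps `τ` for which the signature of kind `K` and dimension `n` has a substitution
operator `s_τ`. -/
def Kind.subs : Kind → (n : ℕ) → Set (Fin n → Fin n)
  | .Sc, _ => {τ | ∃ i j, τ = repl i j}
  | .CA, _ => ∅
  | .PA, _ => Set.univ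
  | .PEA, _ => Set.univ

/-- Whether the signature of kind `K` has diagonal constants. -/
def Kind.HasDiag : Kind → Prop
  | .Sc => False
  | .CA => True
  | .PA => False
  | .PEA => True

/-- The non-Boolean operations of an `n`-dimensional algebra of kind `K` on the set `A`. -/
structure Ops (K : Kind) (n : ℕ) (A : Type*) where
  cyl : Fin n → A → A
  sub : (τ : Fin n → Fin n) → τ ∈ K.subs n → A → A
  diag : K.HasDiag → Fin n → Fin n → A

/-! ### The equations -/

section Axioms

variable {n : ℕ} {A : Type*} [BooleanAlgebra A]

/-- The cylindrifiers are commuting quantifiers. -/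
structure CylAxioms (c : Fin n → A → A) : Prop where
  cyl_bot : ∀ i, c i ⊥ = ⊥
  le_cyl : ∀ i x, x ≤ c i x
  cyl_inf : ∀ i x y, c i (x ⊓ c i y) = c i x ⊓ c i y
  cyl_comm : ∀ i j x, c i (c j x) = c j (c i x)

/-- Boolean endomorphisms. -/
structure IsBoolEndo (s : A → A) : Prop where
  map_sup : ∀ x y, s (x ⊔ y) = s x ⊔ s y
  map_compl : ∀ x, s xᶜ = (s x)ᶜ

/-- Pinter's substitution algebras; `s i j` is the operator `s_[i/j]`. -/
structure ScAxioms (c : Fin n → A → A) (s : Fin n → Fin n → A → A) : Prop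
    extends CylAxioms c where
  sub_endo : ∀ i j, IsBoolEndo (s i j)
  sub_self : ∀ i x, s i i x = x
  sub_cyl_same : ∀ i j x, s i j (c i x) = c i x
  cyl_sub_same : ∀ i j x, i ≠ j → c i (s i j x) = s i j x
  sub_cyl : ∀ i j k x, k ≠ i → k ≠ j → s i j (c k x) = c k (s i j x)
  cyl_sub_swap : ∀ i j x, c i (s j i x) = c j (s i j x)
  sub_comm : ∀ i j k l x, [i, j, k, l].Nodup → s i j (s k l x) = s k l (s i j x)
  sub_sub : ∀ i j l x, s l i (s j l x) = s l i (s j i x)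

/-- Cylindric algebras. -/
structure CAAxioms (c : Fin n → A → A) (d : Fin n → Fin n → A) : Prop
    extends CylAxioms c where
  diag_self : ∀ i, d i i = ⊤
  diag_eq : ∀ i j k, k ≠ i → k ≠ j → d i j = c k (d i k ⊓ d k j)
  diag_disjoint : ∀ i j x, i ≠ j → c i (d i j ⊓ x) ⊓ c i (d i j ⊓ xᶜ) = ⊥

/-- Polyadic algebras of finite dimension. -/
structure PAAxioms (c : Fin n → A → A) (s : (Fin n → Fin n) → A → A) : Prop
    extends CylAxioms c where
  sub_endo : ∀ τ, IsBoolEndo (s τ)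
  sub_id : ∀ x, s id x = x
  sub_comp : ∀ σ τ x, s (σ ∘ τ) x = s σ (s τ x)
  sub_cyl : ∀ σ τ i x, (∀ j, j ≠ i → σ j = τ j) → s σ (c i x) = s τ (c i x)
  cyl_sub : ∀ τ i j x, (∀ k, τ k = i ↔ k = j) → c i (s τ x) = s τ (c j x)
  cyl_sub_of_notMem : ∀ τ i x, (∀ k, τ k ≠ i) → c i (s τ x) = s τ x

/-- Polyadic equality algebras of finite dimension. -/
structure PEAAxioms (c : Fin n → A → A) (s : (Fin n → Fin n) → A → A)
    (d : Fin n → Fin n → A) : Prop extends PAAxioms c s where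
  diag_self : ∀ i, d i i = ⊤
  inf_diag_le : ∀ i j x, x ⊓ d i j ≤ s (repl i j) x
  sub_diag : ∀ τ i j, s τ (d i j) = d (τ i) (τ j)

/-- The algebra with operations `o` belongs to the variety `K_n`. -/
def Ops.IsModel : {K : Kind} → Ops K n A → Prop
  | .Sc, o => ScAxioms o.cyl (fun i j => o.sub (repl i j) ⟨i, j, rfl⟩)
  | .CA, o => CAAxioms o.cyl (o.diag trivial)
  | .PA, o => PAAxioms o.cyl (fun τ => o.sub τ trivial)
  | .PEA, o => PEAAxioms o.cyl (fun τ => o.sub τ trivial) (o.diag trivial)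

end Axioms

/-! ### Homomorphisms, subalgebras, reducts -/

/-- A Boolean homomorphism that preserves all the non-Boolean operations. -/
structure Ops.IsHom {K : Kind} {n : ℕ} {A B : Type*} [BooleanAlgebra A] [BooleanAlgebra B]
    (o : Ops K n A) (p : Ops K n B) (f : BoundedLatticeHom A B) : Prop where
  map_cyl : ∀ i x, f (o.cyl i x) = p.cyl i (f x)
  map_sub : ∀ τ h x, f (o.sub τ h x) = p.sub τ h (f x)
  map_diag : ∀ h i j, f (o.diag h i j) = p.diag h i j

/-- A Boolean subalgebra that is closed under the non-Boolean operations. -/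
structure Ops.IsSubalgebra {K : Kind} {n : ℕ} {A : Type*} [BooleanAlgebra A]
    (o : Ops K n A) (L : BooleanSubalgebra A) : Prop where
  cyl_mem : ∀ i x, x ∈ L → o.cyl i x ∈ L
  sub_mem : ∀ τ h x, x ∈ L → o.sub τ h x ∈ L
  diag_mem : ∀ h i j, o.diag h i j ∈ L

/-- The operations induced on a subalgebra. -/
def Ops.restrict {K : Kind} {n : ℕ} {A : Type*} [BooleanAlgebra A] (o : Ops K n A)
    {L : BooleanSubalgebra A} (hL : o.IsSubalgebra L) : Ops K n L where
  cyl i x := ⟨o.cyl i x, hL.cyl_mem i x x.2⟩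
  sub τ h x := ⟨o.sub τ h x, hL.sub_mem τ h x x.2⟩
  diag h i j := ⟨o.diag h i j, hL.diag_mem h i j⟩

/-- The `Sc`-reduct of an algebra of the type of polyadic equality algebras. -/
def Ops.rdSc {n : ℕ} {A : Type*} (o : Ops .PEA n A) : Ops .Sc n A where
  cyl := o.cyl
  sub τ _ := o.sub τ trivial
  diag h := h.elim

/-- For `n ≤ m`, the extension of `τ : n → n` to `m` that is the identity outside `n`. -/
def liftMap {n m : ℕ} (h : n ≤ m) (τ : Fin n → Fin n) : Fin m → Fin m :=
  fun i => if hi : (i : ℕ) < n then Fin.castLE h (τ ⟨i, hi⟩) else i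

theorem liftMap_repl {n m : ℕ} (h : n ≤ m) (i j : Fin n) :
    liftMap h (repl i j) = repl (Fin.castLE h i) (Fin.castLE h j) := by
  funext k
  by_cases hk : (k : ℕ) < n
  · by_cases hki : k = Fin.castLE h i
    · subst hki
      simp [liftMap, repl]
    · have : (⟨k, hk⟩ : Fin n) ≠ i := by
        rintro rfl
        exact hki (Fin.ext rfl)
      simp only [liftMap, repl, hk, dif_pos, Function.update_of_ne hki,
        Function.update_of_ne this, id]
      exact Fin.ext rfl
  · have hki : k ≠ Fin.castLE h i := by
      rintro rfl
      exact hk i.2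
    simp [liftMap, repl, hk, Function.update_of_ne hki]

theorem liftMap_mem {K : Kind} {n m : ℕ} (h : n ≤ m) {τ : Fin n → Fin n}
    (hτ : τ ∈ K.subs n) : liftMap h τ ∈ K.subs m := by
  cases K with
  | Sc =>
    obtain ⟨i, j, rfl⟩ := hτ
    exact ⟨_, _, liftMap_repl h i j⟩
  | CA => exact hτ.elim
  | PA => trivial
  | PEA => trivial

/-- The reduct of an `m`-dimensional algebra to its first `n` dimensions. -/
def Ops.reduct {K : Kind} {n m : ℕ} (h : n ≤ m) {B : Type*} (o : Ops K m B) : Ops K n B where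
  cyl i := o.cyl (Fin.castLE h i)
  sub τ hτ := o.sub (liftMap h τ) (liftMap_mem h hτ)
  diag hK i j := o.diag hK (Fin.castLE h i) (Fin.castLE h j)

/-- A class of `n`-dimensional algebras of kind `K`. -/
abbrev AlgClass (K : Kind) (n : ℕ) : Type 1 :=
  ∀ (A : Type) [BooleanAlgebra A], Ops K n A → Prop

/-- The class `S Nr_n K_m`: there are an algebra `B` in `K_m` and an injective homomorphism from `A`
into the reduct of `B` to its first `n` dimensions, whose range consists of elements of
the neat reduct, that is, of elements `b` with `c_i b = b` for all `n ≤ i < m`. -/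
def SNr (K : Kind) {n m : ℕ} (h : n ≤ m) : AlgClass K n :=
  fun A _ o => ∃ (B : Type) (_ : BooleanAlgebra B) (p : Ops K m B), p.IsModel ∧
    ∃ f : BoundedLatticeHom A B, Function.Injective f ∧ o.IsHom (p.reduct h) f ∧
      ∀ (a : A) (i : Fin m), n ≤ (i : ℕ) → p.cyl i (f a) = f a

/-! ### Atom structures, complex algebras, term algebras -/

/-- Relational structures of the type of the atom structures of `n`-dimensional algebras of
kind `K`. -/
structure AtomStr (K : Kind) (n : ℕ) (X : Type*) where
  cylRel : Fin n → X → X → Prop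
  subRel : (τ : Fin n → Fin n) → τ ∈ K.subs n → X → X → Prop
  diagSet : K.HasDiag → Fin n → Fin n → Set X

/-- The complex algebra of an atom structure, on the Boolean algebra of all subsets. -/
def AtomStr.Cm {K : Kind} {n : ℕ} {X : Type*} (F : AtomStr K n X) : Ops K n (Set X) where
  cyl i Y := {a | ∃ b ∈ Y, F.cylRel i a b}
  sub τ h Y := {a | ∃ b ∈ Y, F.subRel τ h a b}
  diag h i j := F.diagSet h i j

/-- The atom structure of an algebra. -/
def Ops.At {K : Kind} {n : ℕ} {A : Type*} [BooleanAlgebra A] (o : Ops K n A) :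
    AtomStr K n {a : A // IsAtom a} where
  cylRel i a b := (a : A) ≤ o.cyl i b
  subRel τ h a b := (a : A) ≤ o.sub τ h b
  diagSet h i j := {a | (a : A) ≤ o.diag h i j}

/-- A class is atom-canonical if it contains the complex algebra of the atom structure of each
of its atomic members. -/
def AtomCanonical {K : Kind} {n : ℕ} (V : AlgClass K n) : Prop :=
  ∀ (A : Type) [BooleanAlgebra A] (o : Ops K n A),
    V A o → IsAtomic A → V (Set {a : A // IsAtom a}) o.At.Cm

/-- The universe of the term algebra: the subalgebra of the complex algebra generated by the
singletons. -/
def AtomStr.tm {K : Kind} {n : ℕ} {X : Type*} (F : AtomStr K n X) : BooleanSubalgebra (Set X) :=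
  sInf {L | F.Cm.IsSubalgebra L ∧ ∀ x, {x} ∈ L}

theorem AtomStr.isSubalgebra_tm {K : Kind} {n : ℕ} {X : Type*} (F : AtomStr K n X) :
    F.Cm.IsSubalgebra F.tm where
  cyl_mem i x hx := BooleanSubalgebra.mem_sInf.2 fun L hL =>
    hL.1.cyl_mem i x (BooleanSubalgebra.mem_sInf.1 hx L hL)
  sub_mem τ h x hx := BooleanSubalgebra.mem_sInf.2 fun L hL =>
    hL.1.sub_mem τ h x (BooleanSubalgebra.mem_sInf.1 hx L hL)
  diag_mem h i j := BooleanSubalgebra.mem_sInf.2 fun _ hL => hL.1.diag_mem h i j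

/-- The term algebra. -/
def AtomStr.Tm {K : Kind} {n : ℕ} {X : Type*} (F : AtomStr K n X) : Ops K n F.tm :=
  F.Cm.restrict F.isSubalgebra_tm

/-! ### Representability -/

/-- The full set algebra of dimension `n` and kind `K` with base `U`. -/
def fullSetAlg (K : Kind) (n : ℕ) (U : Type*) : Ops K n (Set (Fin n → U)) where
  cyl i Y := {s | ∃ u, Function.update s i u ∈ Y}
  sub τ _ Y := {s | s ∘ τ ∈ Y}
  diag _ i j := {s | s i = s j}

/-- Direct products of algebras. -/
def Ops.pi {K : Kind} {n : ℕ} {I : Type*} {A : I → Type*} (o : ∀ t, Ops K n (A t)) :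
    Ops K n (∀ t, A t) where
  cyl i x := fun t => (o t).cyl i (x t)
  sub τ h x := fun t => (o t).sub τ h (x t)
  diag h i j := fun t => (o t).diag h i j

/-- An algebra is representable if it embeds into a direct product of full set algebras. -/
def Representable {K : Kind} {n : ℕ} : AlgClass K n :=
  fun A _ o => ∃ (I : Type) (U : I → Type)
    (f : BoundedLatticeHom A (∀ t, Set (Fin n → U t))), Function.Injective f ∧
      o.IsHom (Ops.pi fun t => fullSetAlg K n (U t)) f

end CylAlg

/-! The algebra comes from a coloured graph on `ℕ` whose nodes are base nodes of two sorts and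
apexes of four sorts. A cone is an apex with green edges to both ends of an edge between base nodes
of different sorts. A common green neighbour of sort `b t` forbids the colour `wh t` between two
apexes, so two cones of different sorts over one base have apexes joined by a red edge. A red colour
has a level and a bit; in a red triangle the levels agree and the bits have a prescribed sum. On
apexes of sorts 0, 1, 2, 3 the prescribed sums are contradictory: every edge lies in two of the four
triangles, but the four sums add up to 1. Only the limit colour `none`, which has no bit, escapes,
and it lets four cones over a common base coexist in the graph.

Representable side. Truncated at level `N`, the colour `none` looks like any colour of level at
least `N`. The sets of tuples closed under such an equivalence, for some `N`, form a set algebra. By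
a back-and-forth argument (`Eqv.exists_update`) every tuple is equivalent, for each `N`, to one in
which no `none` is seen, and the latter tuples give the atoms. Hence the algebra is atomic, it
embeds in neat reducts of full set algebras of any larger dimension (`Blur.sNr_alg`), and the term
algebra of its atom structure embeds in it (`exists_tm_hom`).

Complex side. The atoms know nothing of `none`, so in the complex algebra an edge between two cones
of different sorts is covered by the two elements "red with bit `x`", each the union over all
levels. Forgetting levels leaves finitely many classes of atoms and a finite subalgebra
(`Blur.classAlg`). In a neat embedding with four spare dimensions the apexes of four cones over one
base can be placed in these dimensions simultaneously (`EdgeSystem.cones_ne_bot`), and the bits of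
their edges violate the parity (`EdgeSystem.false_of_cones`). Only cylindrifiers and replacements
are used, so the argument covers all four types.

The graph is built by adding nodes over faces of at most two nodes (`exists_rich`). The colour `st
S` of a base edge lists the sorts of cones allowed over it; this keeps the default colour `none`
consistent (`Built.redOk_of_lt`). Such a graph controls only triples of nodes. For `n = m + 3`, any
`m` entries of a tuple may therefore serve as parameters, and a generic function `P` sends the other
entries to nodes that depend on these parameters. -/

namespace CylAlg

/-! ### A coloured graph -/

/-- The sorts of nodes: the two sorts of base nodes and the four sorts of apexes. -/
inductive Srt
  | b (t : Bool)
  | a (i : Fin 4)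

/-- The colours of edges, where the red colours are indexed by `R`. -/
inductive Col (R : Type)
  | nil
  | wh (t : Bool)
  | gr
  | st (S : Set (Fin 4))
  | red (r : R)

/-- The indices of the red colours; `none` is the limit of the others. -/
abbrev Red := Option (ℕ × Bool)

/-- The consistent triangles of red colours of parity `e`. -/
def Red.Tri (e : Bool) : Red → Red → Red → Prop
  | none, none, none => True
  | some (l, x), some (l', y), some (l'', z) => l = l' ∧ l = l'' ∧ xor x (xor y z) = e
  | _, _, _ => False

/-- The colours allowed between nodes of given sorts. -/
def Col.Valid {R : Type} : Srt → Srt → Col R → Prop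
  | .b t, .b t', c => (t = t' → c = .nil) ∧ (t ≠ t' → ∃ S, c = .st S)
  | .a i, .a j, c => (i = j → c = .nil) ∧ (i ≠ j → (∃ t, c = .wh t) ∨ ∃ r, c = .red r)
  | .b _, .a _, c => c = .nil ∨ c = .gr
  | .a _, .b _, c => c = .nil ∨ c = .gr

/-- Singling out sort 0 gives odd parity to exactly one of the four triangles on apexes of sorts 0,
1, 2, 3. The value at base nodes is immaterial, since red edges join apexes only. -/
def Srt.nonzero : Srt → Bool
  | .a i => decide (i ≠ 0)
  | .b _ => true

/-- The parity of red triangles on nodes of given sorts. -/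
def Srt.parity (σ τ υ : Srt) : Bool := σ.nonzero && τ.nonzero && υ.nonzero

/-- The condition on a triangle that comes from two green edges at a node of sort `σ`. -/
def ApexOk {R : Type} (σ : Srt) (c c' c'' : Col R) : Prop :=
  c = .gr → c' = .gr →
    (∀ t, σ = .b t → c'' ≠ .wh t) ∧ ∀ i, σ = .a i → ∀ S, c'' = .st S → i ∈ S

/-- The condition on red triangles. -/
def RedOk (e : Bool) (c c' c'' : Col Red) : Prop :=
  ∀ r r' r'', c = .red r → c' = .red r' → c'' = .red r'' → Red.Tri e r r' r''

/-- Consistent triangles with nodes of sorts `σ`, `τ`, `υ`. -/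
structure TriOk (σ τ υ : Srt) (cστ cσυ cτυ : Col Red) : Prop where
  apex₁ : ApexOk σ cστ cσυ cτυ
  apex₂ : ApexOk τ cστ cτυ cσυ
  apex₃ : ApexOk υ cσυ cτυ cστ
  red : RedOk (Srt.parity σ τ υ) cστ cσυ cτυ

theorem Red.Tri.swap₁₂ {e : Bool} {r s t : Red} (h : Red.Tri e r s t) : Red.Tri e s r t := by
  match r, s, t, h with
  | none, none, none, _ => trivial
  | some (l, x), some (l', y), some (l'', z), h =>
    obtain ⟨rfl, rfl, h⟩ := h
    refine ⟨rfl, rfl, ?_⟩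
    rw [← h]; cases x <;> cases y <;> cases z <;> rfl

theorem Red.Tri.swap₂₃ {e : Bool} {r s t : Red} (h : Red.Tri e r s t) : Red.Tri e r t s := by
  match r, s, t, h with
  | none, none, none, _ => trivial
  | some (l, x), some (l', y), some (l'', z), h =>
    obtain ⟨rfl, rfl, h⟩ := h
    refine ⟨rfl, rfl, ?_⟩
    rw [← h]; cases x <;> cases y <;> cases z <;> rfl

theorem RedOk.swap₁₂ {e : Bool} {r s t : Col Red} (h : RedOk e r s t) : RedOk e s r t :=
  fun _ _ _ h₁ h₂ h₃ => (h _ _ _ h₂ h₁ h₃).swap₁₂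

theorem RedOk.swap₂₃ {e : Bool} {r s t : Col Red} (h : RedOk e r s t) : RedOk e r t s :=
  fun _ _ _ h₁ h₂ h₃ => (h _ _ _ h₁ h₃ h₂).swap₂₃

theorem TriOk.swap₂₃ {σ τ υ : Srt} {a b c : Col Red} (h : TriOk σ τ υ a b c) :
    TriOk σ υ τ b a c where
  apex₁ := fun h₁ h₂ => h.apex₁ h₂ h₁
  apex₂ := h.apex₃
  apex₃ := h.apex₂
  red := by
    have e : Srt.parity σ υ τ = Srt.parity σ τ υ := by
      simp only [Srt.parity]
      ac_rfl
    rw [e]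
    exact h.red.swap₁₂

theorem Col.Valid.sort_of_red {R : Type} {σ τ : Srt} {r : R} (h : Col.Valid σ τ (.red r)) :
    ∃ i j, i ≠ j ∧ σ = .a i ∧ τ = .a j := by
  match σ, τ, h with
  | .b t, .b t', h =>
    by_cases ht : t = t'
    · cases h.1 ht
    · obtain ⟨S, hS⟩ := h.2 ht
      cases hS
  | .b _, .a _, h => rcases h with h | h <;> cases h
  | .a _, .b _, h => rcases h with h | h <;> cases h
  | .a i, .a j, h => exact ⟨i, j, fun hij => (nomatch h.1 hij), rfl, rfl⟩

theorem Col.Valid.symm {R : Type} {σ τ : Srt} {c : Col R} (h : Col.Valid σ τ c) :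
    Col.Valid τ σ c := by
  match σ, τ, h with
  | .b t, .b t', h => exact ⟨fun e => h.1 e.symm, fun e => h.2 (Ne.symm e)⟩
  | .b _, .a _, h => exact h
  | .a _, .b _, h => exact h
  | .a i, .a j, h => exact ⟨fun e => h.1 e.symm, fun e => h.2 (Ne.symm e)⟩

/-- The colour of the edge from a new node to a node that is not in its face: here `d` gives the
colours of the edges from the new node to its face, and `c` the colours of the edges from the
face to the other node. -/
noncomputable def defaultCol (srt : ℕ → Srt) (d : ℕ → Option (Col Red)) (c : ℕ → Col Red) :
    Srt → Srt → Col Red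
  | .b t, .b t' => open Classical in if t = t' then .nil else
      -- The least set that the common green apexes in the face permit.
      .st {i | ∃ x, srt x = .a i ∧ d x = some .gr ∧ c x = .gr}
  | .a i, .a j => open Classical in if i = j then .nil else
      -- A common green neighbour of sort `b t` rules out `wh t`. When both white colours are ruled
      -- out, the red colour without a bit is taken.
      if ∃ x, srt x = .b false ∧ d x = some .gr ∧ c x = .gr then
        if ∃ x, srt x = .b true ∧ d x = some .gr ∧ c x = .gr then .red none else .wh true
      else .wh false
  | .b _, .a _ => .nil
  | .a _, .b _ => .nil

theorem valid_defaultCol (srt d c σ τ) : Col.Valid σ τ (defaultCol srt d c σ τ) := by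
  match σ, τ with
  | .b t, .b t' =>
    refine ⟨fun h => by simp [defaultCol, h], fun h => ?_⟩
    simp only [defaultCol, h, if_false]
    exact ⟨_, rfl⟩
  | .b _, .a _ => exact .inl rfl
  | .a _, .b _ => exact .inl rfl
  | .a i, .a j =>
    refine ⟨fun h => by simp [defaultCol, h], fun h => ?_⟩
    simp only [defaultCol, h, if_false]
    split_ifs
    exacts [.inr ⟨_, rfl⟩, .inl ⟨_, rfl⟩, .inl ⟨_, rfl⟩]

theorem defaultCol_ne_gr (srt d c σ τ) : defaultCol srt d c σ τ ≠ .gr := by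
  match σ, τ with
  | .b t, .b t' => simp only [defaultCol]; split_ifs <;> simp
  | .b _, .a _ => simp [defaultCol]
  | .a _, .b _ => simp [defaultCol]
  | .a i, .a j => simp only [defaultCol]; split_ifs <;> simp

theorem defaultCol_ne_wh {srt : ℕ → Srt} {d : ℕ → Option (Col Red)} {c : ℕ → Col Red}
    {σ τ : Srt} {x : ℕ} {t : Bool} (hx : srt x = .b t) (hd : d x = some .gr) (hc : c x = .gr) :
    defaultCol srt d c σ τ ≠ .wh t := by
  match σ, τ with
  | .b t, .b t' => simp only [defaultCol]; split_ifs <;> simp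
  | .b _, .a _ => simp [defaultCol]
  | .a _, .b _ => simp [defaultCol]
  | .a i, .a j =>
    simp only [defaultCol]
    intro h
    split_ifs at h with h₁ h₂ h₃
    · cases h
      exact h₃ ⟨x, hx, hd, hc⟩
    · cases h
      exact h₂ ⟨x, hx, hd, hc⟩

theorem defaultCol_st {srt : ℕ → Srt} {d : ℕ → Option (Col Red)} {c : ℕ → Col Red}
    {σ τ : Srt} {S : Set (Fin 4)} (h : defaultCol srt d c σ τ = .st S) (i : Fin 4) :
    i ∈ S ↔ ∃ x, srt x = .a i ∧ d x = some .gr ∧ c x = .gr := by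
  match σ, τ with
  | .b t, .b t' =>
    simp only [defaultCol] at h
    split_ifs at h
    cases h
    rfl
  | .b _, .a _ => simp [defaultCol] at h
  | .a _, .b _ => simp [defaultCol] at h
  | .a i, .a j => simp only [defaultCol] at h; split_ifs at h

theorem defaultCol_red {srt : ℕ → Srt} {d : ℕ → Option (Col Red)} {c : ℕ → Col Red}
    {σ τ : Srt} {r : Red} (h : defaultCol srt d c σ τ = .red r) :
    r = none ∧ ∀ t, ∃ x, srt x = .b t ∧ d x = some .gr ∧ c x = .gr := by
  match σ, τ with
  | .b t, .b t' => simp only [defaultCol] at h; split_ifs at h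
  | .b _, .a _ => simp [defaultCol] at h
  | .a _, .b _ => simp [defaultCol] at h
  | .a i, .a j =>
    simp only [defaultCol] at h
    split_ifs at h with h₁ h₂ h₃
    cases h
    exact ⟨rfl, fun t => by cases t <;> assumption⟩

theorem defaultCol_congr {srt : ℕ → Srt} {d : ℕ → Option (Col Red)} {c c' : ℕ → Col Red}
    (h : ∀ x, d x ≠ none → c x = c' x) (σ τ) :
    defaultCol srt d c σ τ = defaultCol srt d c' σ τ := by
  have key : ∀ x, (d x = some .gr ∧ c x = .gr) ↔ (d x = some .gr ∧ c' x = .gr) := fun x =>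
    and_congr_right fun hx => by rw [h x (by simp [hx])]
  match σ, τ with
  | .b t, .b t' => simp only [defaultCol, key]
  | .b _, .a _ => rfl
  | .a _, .b _ => rfl
  | .a i, .a j =>
    have e : ∀ t, (∃ x, srt x = Srt.b t ∧ d x = some .gr ∧ c x = .gr) =
        ∃ x, srt x = Srt.b t ∧ d x = some .gr ∧ c' x = .gr :=
      fun t => propext (exists_congr fun x => and_congr_right fun _ => key x)
    simp only [defaultCol]
    rw [e, e]

/-- A coloured graph on `ℕ` in which every node `t` is joined to a face of at most two earlier nodes
with the colours `d t`, and to the other earlier nodes with the default colours. -/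
structure Built (srt : ℕ → Srt) (d : ℕ → ℕ → Option (Col Red)) (c : ℕ → ℕ → Col Red) : Prop where
  symm : ∀ x y, c x y = c y x
  self : ∀ x, c x x = .nil
  eq_face : ∀ t v a, d t v = some a → c t v = a
  eq_default : ∀ t v, v < t → d t v = none →
    c t v = defaultCol srt (d t) (fun x => c x v) (srt t) (srt v)
  valid_face : ∀ t v a, d t v = some a → Col.Valid (srt t) (srt v) a
  tri_face : ∀ t x y a b, d t x = some a → d t y = some b → x ≠ y →
    TriOk (srt t) (srt x) (srt y) a b (c x y)
  face_card : ∀ t x y z, d t x ≠ none → d t y ≠ none → d t z ≠ none → x = y ∨ x = z ∨ y = z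

/-! ### Consistency of all triangles of a built graph -/

namespace Built

variable {srt : ℕ → Srt} {d : ℕ → ℕ → Option (Col Red)} {c : ℕ → ℕ → Col Red}

theorem valid_of_lt (h : Built srt d c) {x y : ℕ} (hxy : y < x) :
    Col.Valid (srt x) (srt y) (c x y) := by
  cases hd : d x y with
  | none => rw [h.eq_default _ _ hxy hd]; exact valid_defaultCol _ _ _ _ _
  | some a => rw [h.eq_face _ _ _ hd]; exact h.valid_face _ _ _ hd

theorem valid (h : Built srt d c) (x y : ℕ) : Col.Valid (srt x) (srt y) (c x y) := by
  rcases lt_trichotomy x y with hxy | rfl | hxy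
  · rw [h.symm]; exact (h.valid_of_lt hxy).symm
  · rw [h.self]
    cases srt x with
    | b t => exact ⟨fun _ => rfl, fun h => absurd rfl h⟩
    | a i => exact ⟨fun _ => rfl, fun h => absurd rfl h⟩
  · exact h.valid_of_lt hxy

theorem face_of_gr (h : Built srt d c) {x y : ℕ} (hxy : y < x) (hc : c x y = .gr) :
    d x y = some .gr := by
  cases hd : d x y with
  | none => exact absurd ((h.eq_default _ _ hxy hd).symm.trans hc) (defaultCol_ne_gr _ _ _ _ _)
  | some a => rw [← hc, h.eq_face _ _ _ hd]

theorem face_or_of_red (h : Built srt d c) {x y : ℕ} (hxy : y < x) {r : Red}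
    (hc : c x y = .red r) : d x y = some (.red r) ∨ d x y = none ∧ r = none ∧
      ∀ t, ∃ z, srt z = .b t ∧ d x z = some .gr ∧ c z y = .gr := by
  cases hd : d x y with
  | none =>
    rw [h.eq_default _ _ hxy hd] at hc
    exact .inr ⟨rfl, defaultCol_red hc⟩
  | some a => left; rw [← hc, h.eq_face _ _ _ hd]

/-- Default colours are never green, so `z` lies in the face of `x`. The colour of `x y` is then
either part of the consistent face or a default, whose definition takes `z` into account. -/
theorem apexOk_of_lt (h : Built srt d c) {x y z : ℕ} (hxy : y < x) (hzx : z < x)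
    (hyz : y ≠ z) : ApexOk (srt z) (c z x) (c z y) (c x y) := by
  intro h₁ h₂
  rw [h.symm] at h₁
  have hz := h.face_of_gr hzx h₁
  cases hd : d x y with
  | none =>
    rw [h.eq_default _ _ hxy hd]
    exact ⟨fun t ht => defaultCol_ne_wh ht hz h₂,
      fun i hi S hS => (defaultCol_st hS i).2 ⟨z, hi, hz, h₂⟩⟩
  | some a =>
    rw [h.eq_face _ _ _ hd]
    have := (h.tri_face x z y _ _ hz hd hyz.symm).apex₂
    exact this rfl h₂

theorem apexOk (h : Built srt d c) {x y z : ℕ} (hxy : x ≠ y) (hxz : x ≠ z) (hyz : y ≠ z) :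
    ApexOk (srt z) (c z x) (c z y) (c x y) := by
  rcases lt_or_gt_of_ne hxz with hxz' | hxz'
  · rcases lt_or_gt_of_ne hyz with hyz' | hyz'
    · intro h₁ h₂
      exact (h.tri_face z x y _ _ (h.face_of_gr hxz' h₁) (h.face_of_gr hyz' h₂) hxy).apex₁ rfl rfl
    · intro h₁ h₂
      have := h.apexOk_of_lt (hxz'.trans hyz') hyz' hxz h₂ h₁
      rwa [h.symm y x] at this
  · rcases lt_or_gt_of_ne hxy with hxy' | hxy'
    · intro h₁ h₂
      have := h.apexOk_of_lt hxy' (hxz'.trans hxy') hxz h₂ h₁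
      rwa [h.symm y x] at this
    · exact h.apexOk_of_lt hxy' hxz' hyz

/-- The case that the last of the four nodes is a base node: its face is `{u, v}`, so the other base
node gets a default colour, and that admits only the sorts of `u` and `v`. -/
theorem red_eq_none_or_of_lt (h : Built srt d c) {x y u v : ℕ} {t : Bool} {j k : Fin 4}
    {S : Set (Fin 4)} (hy : srt y = .b t) (hu : srt u = .a j)
    (hv : srt v = .a k) (hjk : j ≠ k) (hxu : c x u = .gr) (hxv : c x v = .gr) (hyu : c y u = .gr)
    (hyv : c y v = .gr) (hxy : c x y = .st S) (hyx : y < x) (hux : u < x) (hvx : v < x) :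
    S ⊆ {j, k} := by
  have huv : u ≠ v := fun e => hjk (by rw [e, hv] at hu; cases hu; rfl)
  have hyu' : y ≠ u := fun e => by rw [e, hu] at hy; cases hy
  have hyv' : y ≠ v := fun e => by rw [e, hv] at hy; cases hy
  have du := h.face_of_gr hux hxu
  have dv := h.face_of_gr hvx hxv
  have dy : d x y = none := by
    by_contra hd
    rcases h.face_card x y u v hd (by simp [du]) (by simp [dv]) with e | e | e <;> contradiction
  rw [h.eq_default _ _ hyx dy] at hxy
  intro i hi
  obtain ⟨z, hz, dz, -⟩ := (defaultCol_st hxy i).1 hi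
  rcases h.face_card x z u v (by simp [dz]) (by simp [du]) (by simp [dv]) with rfl | rfl | e
  · rw [hu] at hz; cases hz; exact .inl rfl
  · rw [hv] at hz; cases hz; exact .inr rfl
  · contradiction

/-- The case that the last node is an apex: its face is filled by the two base nodes, so its red
edge to the other apex is a default. -/
theorem red_eq_none_of_lt (h : Built srt d c) {x y u v : ℕ} {t : Bool} {k : Fin 4}
    (hx : srt x = .b t) (hy : srt y = .b (!t)) (hv : srt v = .a k)
    (hxu : c x u = .gr) (hyu : c y u = .gr) {r : Red} (hr : c u v = .red r)
    (hxu' : x < u) (hyu' : y < u) (hvu : v < u) : r = none := by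
  have hxy : x ≠ y := fun e => by rw [e, hy] at hx; cases t <;> cases hx
  have hxv : x ≠ v := fun e => by rw [e, hv] at hx; cases hx
  have hyv : y ≠ v := fun e => by rw [e, hv] at hy; cases hy
  rw [h.symm] at hxu hyu
  rcases h.face_or_of_red hvu hr with hd | ⟨-, hd, -⟩
  · rcases h.face_card u x y v (by simp [h.face_of_gr hxu' hxu])
      (by simp [h.face_of_gr hyu' hyu]) (by simp [hd]) with e | e | e <;> contradiction
  · exact hd

/-- The reason for the colours `st S`: a red edge with a bit between two cones over one base can
arise only if that base admits no third sort of cone. The proof distinguishes which of the four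
nodes came last. -/
theorem red_eq_none_or (h : Built srt d c) {x y u v : ℕ} {t : Bool} {j k : Fin 4}
    {S : Set (Fin 4)} (hx : srt x = .b t) (hy : srt y = .b (!t)) (hu : srt u = .a j)
    (hv : srt v = .a k) (hjk : j ≠ k) (hxu : c x u = .gr) (hxv : c x v = .gr) (hyu : c y u = .gr)
    (hyv : c y v = .gr) (hxy : c x y = .st S) {r : Red} (hr : c u v = .red r) :
    r = none ∨ S ⊆ {j, k} := by
  have h₁ : x ≠ y := fun e => by rw [e, hy] at hx; cases t <;> cases hx
  have h₂ : x ≠ v := fun e => by rw [e, hv] at hx; cases hx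
  have h₃ : y ≠ v := fun e => by rw [e, hv] at hy; cases hy
  have h₄ : x ≠ u := fun e => by rw [e, hu] at hx; cases hx
  have h₅ : y ≠ u := fun e => by rw [e, hu] at hy; cases hy
  have h₆ : u ≠ v := fun e => hjk (by rw [e, hv] at hu; cases hu; rfl)
  have : (x < u ∧ y < u ∧ v < u) ∨ (x < v ∧ y < v ∧ u < v) ∨ (y < x ∧ u < x ∧ v < x) ∨
      (x < y ∧ u < y ∧ v < y) := by omega
  rcases this with ⟨a, b, e⟩ | ⟨a, b, e⟩ | ⟨a, b, e⟩ | ⟨a, b, e⟩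
  · exact .inl (h.red_eq_none_of_lt hx hy hv hxu hyu hr a b e)
  · rw [h.symm] at hr
    exact .inl (h.red_eq_none_of_lt hx hy hu hxv hyv hr a b e)
  · exact .inr (h.red_eq_none_or_of_lt hy hu hv hjk hxu hxv hyu hyv hxy a b e)
  · rw [h.symm] at hxy
    exact .inr (h.red_eq_none_or_of_lt hx hu hv hjk hyu hyv hxu hxv hxy a b e)

theorem redOk_of_lt (h : Built srt d c) {x y z : ℕ} (hyx : y < x) (hzx : z < x)
    (hyz : y ≠ z) : RedOk (Srt.parity (srt x) (srt y) (srt z)) (c x y) (c x z) (c y z) := by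
  intro r r' r'' h₁ h₂ h₃
  have v₁ := h.valid x y
  have v₂ := h.valid x z
  have v₃ := h.valid y z
  rw [h₁] at v₁; rw [h₂] at v₂; rw [h₃] at v₃
  obtain ⟨i, j, hij, hi, hj⟩ := v₁.sort_of_red
  obtain ⟨i', k, hik, hi', hk⟩ := v₂.sort_of_red
  rw [hi] at hi'; cases hi'
  obtain ⟨j', k', hjk, hj', hk'⟩ := v₃.sort_of_red
  rw [hj] at hj'; cases hj'
  rw [hk] at hk'; cases hk'
  -- A default red edge at `x` needs two base nodes in the face of `x`, which leaves no room for an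
  -- apex.
  have two : ∀ {p q w l} {l' : Fin 4}, srt p = .b false → d x p = some .gr → srt q = .b true →
      d x q = some .gr → srt w = .a l' → d x w = some l → False := by
    intro p q w l l' hp dp hq dq hw dw
    rcases h.face_card x p q w (by simp [dp]) (by simp [dq]) (by simp [dw]) with e | e | e
    · rw [e, hq] at hp; cases hp
    · rw [e, hw] at hp; cases hp
    · rw [e, hw] at hq; cases hq
  rcases h.face_or_of_red hyx h₁ with d₁ | ⟨d₁, rfl, f₁⟩
  · rcases h.face_or_of_red hzx h₂ with d₂ | ⟨d₂, rfl, f₂⟩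
    · exact (h.tri_face x y z _ _ d₁ d₂ hyz).red _ _ _ rfl rfl h₃
    · obtain ⟨p, hp, dp, -⟩ := f₂ false
      obtain ⟨q, hq, dq, -⟩ := f₂ true
      exact (two hp dp hq dq hj d₁).elim
  · obtain ⟨p, hp, dp, hpy⟩ := f₁ false
    obtain ⟨q, hq, dq, hqy⟩ := f₁ true
    rcases h.face_or_of_red hzx h₂ with d₂ | ⟨d₂, rfl, f₂⟩
    · exact (two hp dp hq dq hk d₂).elim
    · have hpq : p ≠ q := fun e => by rw [e, hq] at hp; cases hp
      obtain ⟨p', hp', dp', hpz⟩ := f₂ false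
      obtain ⟨q', hq', dq', hqz⟩ := f₂ true
      have ep : p' = p := by
        rcases h.face_card x p' p q (by simp [dp']) (by simp [dp]) (by simp [dq]) with e | e | e
        · exact e
        · rw [e, hq] at hp'; cases hp'
        · contradiction
      have eq : q' = q := by
        rcases h.face_card x q' p q (by simp [dq']) (by simp [dp]) (by simp [dq]) with e | e | e
        · rw [e, hp] at hq'; cases hq'
        · exact e
        · contradiction
      subst ep eq
      obtain ⟨S, hS⟩ : ∃ S, c p' q' = .st S := by
        have := h.valid p' q'
        rw [hp, hq] at this
        exact this.2 (by simp)
      rcases h.red_eq_none_or hp hq hj hk hjk hpy hpz hqy hqz hS h₃ with rfl | hSjk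
      · trivial
      -- The new apex is itself a cone over `p' q'`, so its sort `i` belongs to `S`; this is
      -- impossible, since `i` differs from `j` and `k`.
      · have := (h.tri_face x p' q' _ _ dp dq hpq).apex₁ rfl rfl
        rcases hSjk (this.2 i hi S hS) with e | e
        · exact (hij e).elim
        · exact (hik e).elim

theorem redOk (h : Built srt d c) {x y z : ℕ} (hxy : x ≠ y) (hxz : x ≠ z) (hyz : y ≠ z) :
    RedOk (Srt.parity (srt x) (srt y) (srt z)) (c x y) (c x z) (c y z) := by
  have : (y < x ∧ z < x) ∨ (x < y ∧ z < y) ∨ (x < z ∧ y < z) := by omega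
  rcases this with ⟨a, b⟩ | ⟨a, b⟩ | ⟨a, b⟩
  · exact h.redOk_of_lt a b hyz
  · have := h.redOk_of_lt a b hxz
    rw [h.symm y x] at this
    have e : Srt.parity (srt x) (srt y) (srt z) = Srt.parity (srt y) (srt x) (srt z) := by
      simp only [Srt.parity]
      ac_rfl
    rw [e]
    exact this.swap₂₃
  · have := h.redOk_of_lt a b hxy
    rw [h.symm z x, h.symm z y] at this
    have e : Srt.parity (srt x) (srt y) (srt z) = Srt.parity (srt z) (srt x) (srt y) := by
      simp only [Srt.parity]
      ac_rfl
    rw [e]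
    exact this.swap₂₃.swap₁₂

theorem triOk (h : Built srt d c) {x y z : ℕ} (hxy : x ≠ y) (hxz : x ≠ z) (hyz : y ≠ z) :
    TriOk (srt x) (srt y) (srt z) (c x y) (c x z) (c y z) where
  apex₁ := h.apexOk hyz hxy.symm hxz.symm
  apex₂ := by
    have := h.apexOk hxz hxy hyz.symm
    rwa [h.symm y x] at this
  apex₃ := by
    have := h.apexOk hxy hxz hyz
    rwa [h.symm z x, h.symm z y] at this
  red := h.redOk hxy hxz hyz

end Built

/-! ### Construction of a rich graph by meeting demands -/

/-- A demand for a new node of given sort that is joined to two nodes with given colours. -/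
structure Demand where
  srt : Srt
  p : ℕ
  q : ℕ
  a : Col Red
  b : Col Red

instance : Countable Srt :=
  Function.Injective.countable (β := Bool ⊕ Fin 4)
    (f := fun | .b t => .inl t | .a i => .inr i) (by
      rintro (t | i) (t' | i') h <;> cases h <;> rfl)

/-- An encoding of the colours. -/
def Col.encode {R : Type} : Col R → Bool ⊕ Bool ⊕ Set (Fin 4) ⊕ R
  | .nil => .inl false
  | .gr => .inl true
  | .wh t => .inr (.inl t)
  | .st S => .inr (.inr (.inl S))
  | .red r => .inr (.inr (.inr r))

theorem Col.encode_injective {R : Type} : Function.Injective (Col.encode (R := R)) := by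
  rintro (_ | t | _ | S | r) (_ | t' | _ | S' | r') h <;> cases h <;> rfl

instance {R : Type} [Countable R] : Countable (Col R) := Col.encode_injective.countable

instance {R : Type} [Finite R] : Finite (Col R) := Finite.of_injective _ Col.encode_injective

instance : Finite Srt :=
  Finite.of_injective (β := Bool ⊕ Fin 4) (fun | .b t => .inl t | .a i => .inr i) (by
      rintro (t | i) (t' | i') h <;> cases h <;> rfl)

instance : Countable Demand :=
  Function.Injective.countable (f := fun D : Demand => (D.srt, D.p, D.q, D.a, D.b)) (by
    rintro ⟨⟩ ⟨⟩ h
    simpa using h)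

instance : Nonempty Demand := ⟨⟨.b true, 0, 0, .nil, .nil⟩⟩

/-- Every element of a nonempty countable type is the value of some function on `ℕ` at arbitrarily
large numbers. -/
theorem exists_frequently_eq (α : Type*) [Nonempty α] [Countable α] :
    ∃ f : ℕ → α, ∀ a N, ∃ t, N ≤ t ∧ f t = a := by
  obtain ⟨e, he⟩ := exists_surjective_nat (α × ℕ)
  refine ⟨fun t => (e t).1, fun a N => ?_⟩
  by_contra! h
  have : (Set.range fun k : ℕ => (a, k)) ⊆ e '' {t | t < N} := by
    rintro _ ⟨k, rfl⟩
    obtain ⟨t, ht⟩ := he (a, k)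
    refine ⟨t, ?_, ht⟩
    by_contra hN
    exact h t (not_lt.1 hN) (by simp [ht])
  exact Set.infinite_range_of_injective (fun _ _ h => by simpa using h)
    (((Set.finite_lt_nat N).image e).subset this)

/-- The function on pairs of distinct numbers that is given by `f` where the first number is the
larger one. -/
def symmetrize (f : ℕ → ℕ → Col Red) (x y : ℕ) : Col Red :=
  if y < x then f x y else if x < y then f y x else .nil

theorem symmetrize_comm (f : ℕ → ℕ → Col Red) (x y : ℕ) :
    symmetrize f x y = symmetrize f y x := by
  unfold symmetrize
  split_ifs <;> first | rfl | omega

theorem symmetrize_congr {f g : ℕ → ℕ → Col Red} {t : ℕ} (h : ∀ x < t, f x = g x) {x y : ℕ}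
    (hx : x < t) (hy : y < t) : symmetrize f x y = symmetrize g x y := by
  unfold symmetrize
  rw [h x hx, h y hy]

/-- The demand can be met by the node `t`. -/
structure Demand.Ok (srt : ℕ → Srt) (c : ℕ → ℕ → Col Red) (t : ℕ) (D : Demand) : Prop where
  lt_p : D.p < t
  lt_q : D.q < t
  valid_p : Col.Valid D.srt (srt D.p) D.a
  valid_q : Col.Valid D.srt (srt D.q) D.b
  eq : D.p = D.q → D.a = D.b
  tri : D.p ≠ D.q → TriOk D.srt (srt D.p) (srt D.q) D.a D.b (c D.p D.q)

theorem Demand.Ok.congr {srt : ℕ → Srt} {c c' : ℕ → ℕ → Col Red} {t : ℕ} {D : Demand}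
    (hc : ∀ x < t, ∀ y < t, c x y = c' x y) (h : D.Ok srt c t) : D.Ok srt c' t :=
  { h with tri := by rw [← hc _ h.lt_p _ h.lt_q]; exact h.tri }

open Classical in
/-- The colours of the edges to the face of a node with demand `D`. -/
noncomputable def Demand.face (D : Demand) (ok : Prop) (v : ℕ) : Option (Col Red) :=
  if ok ∧ v = D.p then some D.a else if ok ∧ v = D.q then some D.b else none

theorem Demand.face_eq_some {D : Demand} {ok : Prop} {v : ℕ} {a : Col Red}
    (h : D.face ok v = some a) : ok ∧ (v = D.p ∧ a = D.a ∨ v = D.q ∧ a = D.b) := by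
  unfold Demand.face at h
  split_ifs at h with h₁ h₂
  · cases h; exact ⟨h₁.1, .inl ⟨h₁.2, rfl⟩⟩
  · cases h; exact ⟨h₂.1, .inr ⟨h₂.2, rfl⟩⟩

/-- The colours of the edges from the node `t` to the smaller ones, if the node `t` is added
to meet the demand `D t`. -/
noncomputable def row (D : ℕ → Demand) (t : ℕ) (v : ℕ) : Col Red :=
  -- The guard makes the recursion well-founded. For `v < t` only edges between nodes below `t`
  -- matter, so the filler `nil` has no effect.
  let c := symmetrize fun x y => if _ : x < t then row D x y else .nil
  let d := (D t).face ((D t).Ok (fun x => (D x).srt) c t)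
  (d v).getD (defaultCol (fun x => (D x).srt) d (fun x => c x v) (D t).srt (D v).srt)
termination_by t

/-- The claim `key` replaces the partial graph in the recursion by the finished one: whether a
demand can be met, and the default colours, depend only on edges below `t`. A demand that cannot be
met gives an empty face. -/
theorem exists_built (D : ℕ → Demand) : ∃ c, Built (fun x => (D x).srt)
    (fun t => (D t).face ((D t).Ok (fun x => (D x).srt) c t)) c := by
  set srt : ℕ → Srt := fun x => (D x).srt with hsrt
  set c := symmetrize (row D) with hc
  have hself : ∀ x, c x x = .nil := fun x => by simp [hc, symmetrize]
  have key : ∀ t v, v < t → c t v = ((D t).face ((D t).Ok srt c t) v).getD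
      (defaultCol srt ((D t).face ((D t).Ok srt c t)) (fun x => c x v) (srt t) (srt v)) := by
    intro t v hv
    have h₁ : c t v = row D t v := by simp [hc, symmetrize, hv]
    set c' := symmetrize (fun x y => if _ : x < t then row D x y else .nil) with hc'
    have h₂ : ∀ x < t, ∀ y < t, c' x y = c x y := fun x hx y hy =>
      symmetrize_congr (t := t) (fun x hx => by simp [hx]) hx hy
    have h₃ : (D t).Ok srt c' t = (D t).Ok srt c t :=
      propext ⟨.congr h₂, .congr fun x hx y hy => (h₂ x hx y hy).symm⟩
    rw [h₁, row]
    simp only [← hc', ← hsrt]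
    change (((D t).face ((D t).Ok srt c' t)) v).getD (defaultCol srt
      ((D t).face ((D t).Ok srt c' t)) (fun x => c' x v) (srt t) (srt v)) = _
    rw [h₃]
    congr 1
    apply defaultCol_congr
    intro x hx
    obtain ⟨a, ha⟩ := Option.ne_none_iff_exists'.1 hx
    obtain ⟨hok, ⟨rfl, -⟩ | ⟨rfl, -⟩⟩ := Demand.face_eq_some ha
    · exact h₂ _ hok.lt_p _ hv
    · exact h₂ _ hok.lt_q _ hv
  have hlt : ∀ t v a, (D t).face ((D t).Ok srt c t) v = some a → v < t := by
    intro t v a ha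
    obtain ⟨hok, ⟨rfl, -⟩ | ⟨rfl, -⟩⟩ := Demand.face_eq_some ha
    exacts [hok.lt_p, hok.lt_q]
  refine ⟨c, ⟨symmetrize_comm _, hself, ?_, ?_, ?_, ?_, ?_⟩⟩
  · intro t v a ha
    rw [key t v (hlt t v a ha), ha]
    rfl
  · intro t v hv hd
    rw [key t v hv, hd]
    rfl
  · intro t v a ha
    obtain ⟨hok, ⟨rfl, rfl⟩ | ⟨rfl, rfl⟩⟩ := Demand.face_eq_some ha
    exacts [hok.valid_p, hok.valid_q]
  · intro t x y a b ha hb hxy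
    obtain ⟨hok, ⟨rfl, rfl⟩ | ⟨rfl, rfl⟩⟩ := Demand.face_eq_some ha
    · obtain ⟨-, ⟨rfl, rfl⟩ | ⟨rfl, rfl⟩⟩ := Demand.face_eq_some hb
      · exact absurd rfl hxy
      · exact hok.tri hxy
    · obtain ⟨-, ⟨rfl, rfl⟩ | ⟨rfl, rfl⟩⟩ := Demand.face_eq_some hb
      · have := hok.tri hxy.symm
        rw [hc, symmetrize_comm, ← hc]
        exact this.swap₂₃
      · exact absurd rfl hxy
  · intro t x y z hx hy hz
    obtain ⟨a, ha⟩ := Option.ne_none_iff_exists'.1 hx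
    obtain ⟨b, hb⟩ := Option.ne_none_iff_exists'.1 hy
    obtain ⟨e, he⟩ := Option.ne_none_iff_exists'.1 hz
    obtain ⟨-, ⟨rfl, -⟩ | ⟨rfl, -⟩⟩ := Demand.face_eq_some ha <;>
    obtain ⟨-, ⟨rfl, -⟩ | ⟨rfl, -⟩⟩ := Demand.face_eq_some hb <;>
    obtain ⟨-, ⟨rfl, -⟩ | ⟨rfl, -⟩⟩ := Demand.face_eq_some he <;> simp

/-- Coloured graphs on `ℕ` in which every consistent triangle over an edge is realized. -/
structure Rich (srt : ℕ → Srt) (c : ℕ → ℕ → Col Red) : Prop where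
  symm : ∀ x y, c x y = c y x
  self : ∀ x, c x x = .nil
  valid : ∀ x y, Col.Valid (srt x) (srt y) (c x y)
  triOk : ∀ x y z, x ≠ y → x ≠ z → y ≠ z →
    TriOk (srt x) (srt y) (srt z) (c x y) (c x z) (c y z)
  ext : ∀ p q σ a b, Col.Valid σ (srt p) a → Col.Valid σ (srt q) b → (p = q → a = b) →
    (p ≠ q → TriOk σ (srt p) (srt q) a b (c p q)) →
    ∃ z, z ≠ p ∧ z ≠ q ∧ srt z = σ ∧ c z p = a ∧ c z q = b

/-- Every demand is listed at arbitrarily large numbers, in particular after both of its nodes have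
been added. -/
theorem exists_rich : ∃ srt c, Rich srt c := by
  obtain ⟨D, hD⟩ := exists_frequently_eq Demand
  obtain ⟨c, hc⟩ := exists_built D
  refine ⟨_, c, hc.symm, hc.self, hc.valid, fun x y z => hc.triOk, ?_⟩
  intro p q σ a b hp hq he ht
  obtain ⟨t, htN, hDt⟩ := hD ⟨σ, p, q, a, b⟩ (max p q + 1)
  have hpt : p < t := by omega
  have hqt : q < t := by omega
  have hok : (D t).Ok (fun x => (D x).srt) c t := by
    rw [hDt]
    exact ⟨hpt, hqt, hp, hq, he, ht⟩
  refine ⟨t, hpt.ne', hqt.ne', by simp [hDt], hc.eq_face t p a ?_, hc.eq_face t q b ?_⟩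
  · rw [Demand.face, if_pos ⟨hok, by rw [hDt]⟩, hDt]
  · rw [Demand.face]
    by_cases hpq : p = q
    · rw [if_pos ⟨hok, by rw [hDt]; exact hpq.symm⟩, hDt]
      exact congrArg some (he hpq)
    · rw [if_neg (by rw [hDt]; exact fun h => hpq h.2.symm), if_pos ⟨hok, by rw [hDt]⟩, hDt]

/-! ### Three-point homogeneity -/

/-- The action of a map on the indices of red colours. -/
def Col.map {R S : Type} (f : R → S) : Col R → Col S
  | .nil => .nil
  | .gr => .gr
  | .wh t => .wh t
  | .st S => .st S
  | .red r => .red (f r)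

/-- The index of the colour satisfies `G`, if the colour is red. -/
def Col.All {R : Type} (G : R → Prop) (c : Col R) : Prop := ∀ r, c = .red r → G r

/-- Colours that are equal or both red. -/
def Col.Sim {R S : Type} (c : Col R) (c' : Col S) : Prop :=
  c.map (fun _ => ()) = c'.map fun _ => ()

theorem Col.Sim.of_map_eq {R S : Type} {f : R → S} {c c' : Col R} (h : c.map f = c'.map f) :
    c.Sim c' := by
  cases c <;> cases c' <;> simp_all [Col.map, Col.Sim]

theorem Col.Sim.eq_nil_iff {R S : Type} {c : Col R} {c' : Col S} (h : c.Sim c') :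
    c = .nil ↔ c' = .nil := by
  cases c <;> cases c' <;> simp_all [Col.map, Col.Sim]

theorem Col.Sim.eq_gr_iff {R S : Type} {c : Col R} {c' : Col S} (h : c.Sim c') :
    c = .gr ↔ c' = .gr := by
  cases c <;> cases c' <;> simp_all [Col.map, Col.Sim]

theorem Col.Sim.eq_wh_iff {R S : Type} {c : Col R} {c' : Col S} (h : c.Sim c') (t : Bool) :
    c = .wh t ↔ c' = .wh t := by
  cases c <;> cases c' <;> simp_all [Col.map, Col.Sim]

theorem Col.Sim.eq_st_iff {R S : Type} {c : Col R} {c' : Col S} (h : c.Sim c')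
    (A : Set (Fin 4)) : c = .st A ↔ c' = .st A := by
  cases c <;> cases c' <;> simp_all [Col.map, Col.Sim]

theorem Col.Sim.exists_red_iff {R S : Type} {c : Col R} {c' : Col S} (h : c.Sim c') :
    (∃ r, c = .red r) ↔ ∃ r, c' = .red r := by
  cases c <;> cases c' <;> simp_all [Col.map, Col.Sim]

theorem Col.Sim.symm {R S : Type} {c : Col R} {c' : Col S} (h : c.Sim c') : c'.Sim c := Eq.symm h

theorem Col.Valid.sim {R S : Type} {σ τ : Srt} {c : Col R} {c' : Col S} (hc : c.Sim c')
    (h : Col.Valid σ τ c) : Col.Valid σ τ c' := by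
  match σ, τ, h with
  | .b t, .b t', h =>
    exact ⟨fun e => hc.eq_nil_iff.1 (h.1 e), fun e => (h.2 e).imp fun S => (hc.eq_st_iff S).1⟩
  | .b _, .a _, h => exact h.imp hc.eq_nil_iff.1 hc.eq_gr_iff.1
  | .a _, .b _, h => exact h.imp hc.eq_nil_iff.1 hc.eq_gr_iff.1
  | .a i, .a j, h =>
    exact ⟨fun e => hc.eq_nil_iff.1 (h.1 e), fun e => (h.2 e).imp
      (Exists.imp fun t => (hc.eq_wh_iff t).1) hc.exists_red_iff.1⟩

theorem ApexOk.sim {R S : Type} {σ : Srt} {a b c : Col R} {a' b' c' : Col S} (ha : a.Sim a')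
    (hb : b.Sim b') (hc : c.Sim c') (h : ApexOk σ a b c) : ApexOk σ a' b' c' := by
  intro h₁ h₂
  obtain ⟨h₃, h₄⟩ := h (ha.eq_gr_iff.2 h₁) (hb.eq_gr_iff.2 h₂)
  exact ⟨fun t ht e => h₃ t ht ((hc.eq_wh_iff t).2 e),
    fun i hi S e => h₄ i hi S ((hc.eq_st_iff S).2 e)⟩

/-- Red triangles lift along `f` over a given edge, from indices in `G` to indices in `G'`. -/
structure Lifts {R : Type} (f : Red → R) (G G' : Red → Prop) : Prop where
  lift : ∀ r, G r → ∃ s, G' s ∧ f s = f r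
  lift_tri : ∀ e r r' r'' s'', Red.Tri e r r' r'' → G r → G r' → G r'' → G' s'' →
    f s'' = f r'' → ∃ s s', G' s ∧ G' s' ∧ f s = f r ∧ f s' = f r' ∧ Red.Tri e s s' s''

theorem Lifts.lift_col {R : Type} {f : Red → R} {G G' : Red → Prop} (h : Lifts f G G')
    {c : Col Red} (hc : c.All G) : ∃ c' : Col Red, c'.All G' ∧ c'.map f = c.map f := by
  match c, hc with
  | .nil, _ => exact ⟨.nil, fun _ h => (nomatch h), rfl⟩
  | .gr, _ => exact ⟨.gr, fun _ h => (nomatch h), rfl⟩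
  | .wh t, _ => exact ⟨.wh t, fun _ h => (nomatch h), rfl⟩
  | .st S, _ => exact ⟨.st S, fun _ h => (nomatch h), rfl⟩
  | .red r, hc =>
    obtain ⟨s, hs, hsr⟩ := h.lift r (hc r rfl)
    exact ⟨.red s, fun _ h => by cases h; exact hs, by simp [Col.map, hsr]⟩

/-- The label of a pair of nodes, modulo the map `f` on indices of red colours. -/
def lab {R : Type} (srt : ℕ → Srt) (c : ℕ → ℕ → Col Red) (f : Red → R) (p q : ℕ) :
    Srt × Srt × Prop × Col R := (srt p, srt q, p = q, (c p q).map f)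

namespace Rich

variable {R : Type} {srt : ℕ → Srt} {c : ℕ → ℕ → Col Red} {f : Red → R} {G G' : Red → Prop}

theorem lab_symm (h : Rich srt c) {p q p' q' : ℕ} (e : lab srt c f p q = lab srt c f p' q') :
    lab srt c f q p = lab srt c f q' p' := by
  simp only [lab, Prod.mk.injEq] at e ⊢
  rw [h.symm q p, h.symm q' p', eq_comm (a := q), eq_comm (a := q')]
  exact ⟨e.2.1, e.1, e.2.2⟩

theorem lab_self (h : Rich srt c) {p q p' q' : ℕ} (e : lab srt c f p q = lab srt c f p' q') :
    lab srt c f p p = lab srt c f p' p' := by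
  simp only [lab, Prod.mk.injEq] at e ⊢
  rw [h.self, h.self]
  simp [e.1]

/-- One step of the back-and-forth. Validity and the apex conditions depend on colours only up to
`Col.Sim`, so they transfer; only a triangle with three red edges needs new indices, which
`Lifts.lift_tri` provides. -/
theorem exists_lift (h : Rich srt c) (hf : Lifts f G G') {p q z p' q' : ℕ}
    (e : lab srt c f p q = lab srt c f p' q') (hpq : (c p q).All G) (hpz : (c p z).All G)
    (hqz : (c q z).All G) (hpq' : (c p' q').All G') :
    ∃ z', lab srt c f p z = lab srt c f p' z' ∧ lab srt c f q z = lab srt c f q' z' ∧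
      (c p' z').All G' ∧ (c q' z').All G' := by
  have hself : ∀ x, (c x x).All G' := fun x r hr => by rw [h.self] at hr; cases hr
  by_cases hzp : z = p
  · subst hzp
    exact ⟨p', h.lab_self e, h.lab_symm e, hself _, by rwa [h.symm]⟩
  by_cases hzq : z = q
  · subst hzq
    exact ⟨q', e, h.lab_self (h.lab_symm e), hpq', hself _⟩
  have e' := e
  simp only [lab, Prod.mk.injEq] at e'
  obtain ⟨e₁, e₂, e₃, e₄⟩ := e'
  rw [eq_iff_iff] at e₃
  have hsim := Col.Sim.of_map_eq e₄
  rw [h.symm p z] at hpz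
  rw [h.symm q z] at hqz
  suffices ∃ a b : Col Red, a.All G' ∧ b.All G' ∧ a.map f = (c z p).map f ∧
      b.map f = (c z q).map f ∧ (p = q → a = b) ∧
      (p ≠ q → RedOk (Srt.parity (srt z) (srt p) (srt q)) a b (c p' q')) by
    obtain ⟨a, b, ha, hb, ha', hb', hab, hr⟩ := this
    have sa := (Col.Sim.of_map_eq ha').symm
    have sb := (Col.Sim.of_map_eq hb').symm
    obtain ⟨z', h₁, h₂, h₃, h₄, h₅⟩ := h.ext p' q' (srt z) a b
      (by rw [← e₁]; exact (h.valid z p).sim sa) (by rw [← e₂]; exact (h.valid z q).sim sb)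
      (fun hpq => hab (e₃.2 hpq)) (fun hpq => by
        have hpq'' : p ≠ q := fun hh => hpq (e₃.1 hh)
        have ht := h.triOk z p q hzp hzq hpq''
        rw [← e₁, ← e₂]
        exact ⟨ht.apex₁.sim sa sb hsim, ht.apex₂.sim sa hsim sb, ht.apex₃.sim sb hsim sa,
          hr hpq''⟩)
    refine ⟨z', ?_, ?_, by rwa [h.symm, h₄], by rwa [h.symm, h₅]⟩
    · simp only [lab, Prod.mk.injEq]
      rw [h.symm p z, h.symm p' z', h₄, ha']
      exact ⟨e₁, h₃.symm, by simp [Ne.symm hzp, h₁.symm], rfl⟩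
    · simp only [lab, Prod.mk.injEq]
      rw [h.symm q z, h.symm q' z', h₅, hb']
      exact ⟨e₂, h₃.symm, by simp [Ne.symm hzq, h₂.symm], rfl⟩
  by_cases hred : p ≠ q ∧ (∃ r, c z p = .red r) ∧ (∃ r, c z q = .red r) ∧ ∃ r, c p q = .red r
  · obtain ⟨hne, ⟨r, hr⟩, ⟨r', hr'⟩, ⟨r'', hr''⟩⟩ := hred
    obtain ⟨s'', hs''⟩ := hsim.exists_red_iff.1 ⟨r'', hr''⟩
    rw [hr'', hs''] at e₄
    obtain ⟨s, s', g, g', t, t', ht⟩ := hf.lift_tri _ r r' r'' s''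
      ((h.triOk z p q hzp hzq hne).red _ _ _ hr hr' hr'') (hpz _ hr) (hqz _ hr') (hpq _ hr'')
      (hpq' _ hs'') (by simpa [Col.map] using e₄.symm)
    refine ⟨.red s, .red s', fun _ h => by cases h; exact g, fun _ h => by cases h; exact g',
      by rw [hr]; simp [Col.map, t], by rw [hr']; simp [Col.map, t'], fun h => absurd h hne, ?_⟩
    intro _ _ _ _ h₁ h₂ h₃
    cases h₁; cases h₂
    rw [hs''] at h₃
    cases h₃
    exact ht
  · obtain ⟨a, ha, ha'⟩ := hf.lift_col hpz
    by_cases hne : p = q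
    · subst hne
      exact ⟨a, a, ha, ha, ha', ha', fun _ => rfl, fun h => absurd rfl h⟩
    obtain ⟨b, hb, hb'⟩ := hf.lift_col hqz
    refine ⟨a, b, ha, hb, ha', hb', fun h => absurd h hne, ?_⟩
    intro _ r r' r'' h₁ h₂ h₃
    exact absurd ⟨hne, (Col.Sim.of_map_eq ha').exists_red_iff.1 ⟨_, h₁⟩,
      (Col.Sim.of_map_eq hb').exists_red_iff.1 ⟨_, h₂⟩, hsim.exists_red_iff.2 ⟨_, h₃⟩⟩ hred

/-- Three nodes can be replaced by nodes with the same labels and with indices in `G'`. -/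
theorem exists_lift₃ (h : Rich srt c) (hf : Lifts f G G') (A : Finset ℕ) (hA : A.card ≤ 3)
    (g : ℕ → ℕ) (hg : ∀ x ∈ A, ∀ y ∈ A, (c (g x) (g y)).All G) :
    ∃ g' : ℕ → ℕ, ∀ x ∈ A, ∀ y ∈ A,
      lab srt c f (g x) (g y) = lab srt c f (g' x) (g' y) ∧ (c (g' x) (g' y)).All G' := by
  have hself : ∀ x, ∀ G : Red → Prop, (c x x).All G := fun x G r hr => by
    rw [h.self] at hr; cases hr
  obtain ⟨x, y, z, rfl⟩ | rfl : (∃ x y z, A = {x, y, z}) ∨ A = ∅ := by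
    interval_cases hc : A.card
    · exact .inr (Finset.card_eq_zero.1 hc)
    · obtain ⟨x, rfl⟩ := Finset.card_eq_one.1 hc
      exact .inl ⟨x, x, x, by simp⟩
    · obtain ⟨x, y, -, rfl⟩ := Finset.card_eq_two.1 hc
      exact .inl ⟨x, x, y, by simp⟩
    · obtain ⟨x, y, z, -, -, -, rfl⟩ := Finset.card_eq_three.1 hc
      exact .inl ⟨x, y, z, rfl⟩
  · have hx : x ∈ ({x, y, z} : Finset ℕ) := by simp
    have hy : y ∈ ({x, y, z} : Finset ℕ) := by simp
    have hz : z ∈ ({x, y, z} : Finset ℕ) := by simp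
    obtain ⟨y', hy₁, -, hy₂, -⟩ := h.exists_lift hf (rfl : lab srt c f (g x) (g x) = _)
      (hself _ _) (hg x hx y hy) (hg x hx y hy) (hself _ _)
    obtain ⟨z', hz₁, hz₂, hz₃, hz₄⟩ := h.exists_lift hf hy₁ (hg x hx y hy) (hg x hx z hz)
      (hg y hy z hz) hy₂
    have exy : x = y → y' = g x := fun e => by
      subst e
      have := congrArg (fun t => t.2.2.1) hy₁
      simpa [lab, eq_comm] using this
    have exz : x = z → z' = g x := fun e => by
      subst e
      have := congrArg (fun t => t.2.2.1) hz₁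
      simpa [lab, eq_comm] using this
    have eyz : y = z → z' = y' := fun e => by
      subst e
      have := congrArg (fun t => t.2.2.1) hz₂
      simpa [lab, eq_comm] using this
    refine ⟨fun u => if u = x then g x else if u = y then y' else z', ?_⟩
    have vx : (fun u => if u = x then g x else if u = y then y' else z') x = g x := by simp
    have vy : (fun u => if u = x then g x else if u = y then y' else z') y = y' := by
      by_cases e : y = x
      · simp [e, exy e.symm]
      · simp [e]
    have vz : (fun u => if u = x then g x else if u = y then y' else z') z = z' := by
      by_cases e : z = x
      · simp [e, exz e.symm]
      · by_cases e' : z = y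
        · subst e'
          simp [e, eyz rfl]
        · simp [e, e']
    generalize (fun u => if u = x then g x else if u = y then y' else z') = g' at vx vy vz
    intro u hu v hv
    simp only [Finset.mem_insert, Finset.mem_singleton] at hu hv
    rcases hu with rfl | rfl | rfl <;> rcases hv with rfl | rfl | rfl <;>
      simp only [vx, vy, vz]
    · exact ⟨trivial, hself _ _⟩
    · exact ⟨hy₁, hy₂⟩
    · exact ⟨hz₁, hz₃⟩
    · exact ⟨h.lab_symm hy₁, by rwa [h.symm]⟩
    · exact ⟨h.lab_self (h.lab_symm hy₁), hself _ _⟩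
    · exact ⟨hz₂, hz₄⟩
    · exact ⟨h.lab_symm hz₁, by rwa [h.symm]⟩
    · exact ⟨h.lab_symm hz₂, by rwa [h.symm]⟩
    · exact ⟨h.lab_self (h.lab_symm hz₁), hself _ _⟩
  · exact ⟨g, fun x hx => by simp at hx⟩

end Rich

/-- Truncation of the indices of red colours at `N`. -/
def Red.trunc (N : ℕ) (r : Red) : Red := r.bind fun x => if x.1 < N then some x else none

/-- Truncation does not distinguish `none` from levels `N` and above. A triangle of that kind is
copied over an edge of any level `l` with `N ≤ l`, where one free bit solves the parity equation,
and over an edge `none` by limit colours. Below `N` the triangle is kept. -/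
theorem lifts_trunc (N : ℕ) (G : Red → Prop) {G' : Red → Prop} (hG' : ∀ x, G' (some x)) :
    Lifts (Red.trunc N) G G' where
  lift r _ := by
    cases r with
    | none => exact ⟨some (N, false), hG' _, by simp [Red.trunc]⟩
    | some x => exact ⟨some x, hG' _, rfl⟩
  lift_tri e r r' r'' s'' ht _ _ _ hs'' hf := by
    by_cases hN : Red.trunc N r'' = none
    · have hr : Red.trunc N r = none ∧ Red.trunc N r' = none := by
        match r, r', r'', ht with
        | none, none, none, _ => exact ⟨rfl, rfl⟩
        | some (l, x), some (l', y), some (l'', z), h =>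
          obtain ⟨rfl, rfl, -⟩ := h
          simpa [Red.trunc] using hN
      rw [hr.1, hr.2]
      rw [hN] at hf
      match s'' with
      | none => exact ⟨none, none, hs'', hs'', rfl, rfl, trivial⟩
      | some (l, x) =>
        have : ¬ l < N := by simpa [Red.trunc] using hf
        refine ⟨some (l, false), some (l, xor x e), hG' _, hG' _, by simp [Red.trunc, this],
          by simp [Red.trunc, this], rfl, rfl, ?_⟩
        cases x <;> cases e <;> rfl
    · match r, r', r'', ht with
      | none, none, none, _ => exact absurd rfl hN
      | some (l, x), some (l', y), some (l'', z), h =>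
        obtain ⟨rfl, rfl, h⟩ := h
        have hl : l < N := by
          by_contra hl
          exact hN (by simp [Red.trunc, hl])
        match s'' with
        | none => simp [Red.trunc, hl] at hf
        | some (l', x') =>
          have : l' < N := by
            by_contra hl'
            simp [Red.trunc, hl, hl'] at hf
          simp only [Red.trunc, Option.bind_some, this, hl, if_true, Option.some.injEq,
            Prod.mk.injEq] at hf
          obtain ⟨rfl, rfl⟩ := hf
          exact ⟨_, _, hG' _, hG' _, rfl, rfl, rfl, rfl, h⟩

/-- The given edge dictates the level of the copy and the bits stay the same. This fails if `none`
is allowed, hence the restriction on both sides. -/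
theorem lifts_class : Lifts (Option.map Prod.snd) (fun r : Red => r ≠ none)
    fun r : Red => r ≠ none where
  lift r hr := ⟨r, hr, rfl⟩
  lift_tri e r r' r'' s'' ht hr hr' hr'' hs'' hf := by
    match r, r', r'', s'', hr, hr', hr'', hs'', ht, hf with
    | some (l, x), some (l', y), some (l'', z), some (m, w), _, _, _, _, h, hf =>
      obtain ⟨-, -, h⟩ := h
      obtain rfl : w = z := by simpa using hf
      exact ⟨some (m, x), some (m, y), by simp, by simp, rfl, rfl, rfl, rfl, h⟩

/-! ### Coloured graphs with parameters -/

/-- The number `x`, where `none` stands for `v`. -/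
def mask (v x : ℕ) : Option ℕ := if x = v then none else some x

/-- Functions that take arbitrary values on the tuples that contain a suitable new element. -/
def Generic {m : ℕ} (P : ℕ → (Fin m → ℕ) → ℕ) : Prop :=
  ∀ (A : Finset ℕ) (φ : Option ℕ → (Fin m → Option ℕ) → ℕ), ∃ v, (∀ x ∈ A, x < v) ∧
    ∀ x k, (x ∈ A ∨ x = v) → (∀ l, k l ∈ A ∨ k l = v) → (x = v ∨ ∃ l, k l = v) →
      P x k = φ (mask v x) fun l => mask v (k l)

/-- The values of `P` at arguments with maximum `v` are read off from a finitely supported function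
attached to `v`. There are countably many such functions, and each is attached to arbitrarily large
`v`. -/
theorem exists_generic (m : ℕ) : ∃ P : ℕ → (Fin m → ℕ) → ℕ, Generic P := by
  obtain ⟨D, hD⟩ := exists_frequently_eq ((Option ℕ × (Fin m → Option ℕ)) →₀ ℕ)
  refine ⟨fun x k => D (max x (Finset.univ.sup k)) (mask (max x (Finset.univ.sup k)) x,
    fun l => mask (max x (Finset.univ.sup k)) (k l)), fun A φ => ?_⟩
  classical
  set B : Finset (Option ℕ × (Fin m → Option ℕ)) :=
    A.insertNone ×ˢ Fintype.piFinset fun _ => A.insertNone with hB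
  obtain ⟨v, hv, hDv⟩ := hD (Finsupp.onFinset B (fun t => if t ∈ B then φ t.1 t.2 else 0)
    (fun t ht => by by_contra h; simp [h] at ht)) (A.sup id + 1)
  have hlt : ∀ x ∈ A, x < v := fun x hx => by
    have : x ≤ A.sup id := Finset.le_sup (f := id) hx
    omega
  refine ⟨v, hlt, fun x k hx hk hxk => ?_⟩
  have hx' : x ≤ v := hx.elim (fun h => (hlt x h).le) fun h => h.le
  have hk' : ∀ l, k l ≤ v := fun l => (hk l).elim (fun h => (hlt _ h).le) fun h => h.le
  have hmax : max x (Finset.univ.sup k) = v := by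
    apply le_antisymm (max_le hx' (Finset.sup_le fun l _ => hk' l))
    rcases hxk with rfl | ⟨l, rfl⟩
    · exact le_max_left _ _
    · exact le_max_of_le_right (Finset.le_sup (f := k) (Finset.mem_univ l))
  have hmask : ∀ y, (y ∈ A ∨ y = v) → mask v y ∈ A.insertNone := by
    intro y hy
    unfold mask
    split_ifs with h
    · simp
    · simpa using hy.resolve_right h
  have hmem : (mask v x, fun l => mask v (k l)) ∈ B := by
    rw [hB, Finset.mem_product, Fintype.mem_piFinset]
    exact ⟨hmask x hx, fun l => hmask _ (hk l)⟩
  simp only [hmax, hDv, Finsupp.onFinset_apply, if_pos hmem]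

/-! ### Tuples seen through parameters, and back-and-forth between them -/

section

variable {R : Type} {n m : ℕ} (srt : ℕ → Srt) (c : ℕ → ℕ → Col Red) (P : ℕ → (Fin m → ℕ) → ℕ)
  (f : Red → R)

/-- The entry `i` of the tuple `s` is seen with the parameters `s ∘ κ`. -/
def Vis (s : Fin n → ℕ) (κ : Fin m → Fin n) (i : Fin n) : Prop :=
  Function.Injective (s ∘ κ) ∧ ∀ l, s (κ l) ≠ s i

/-- The node that represents the entry `i` of the tuple `s` if the parameters are `s ∘ κ`. -/
def node (s : Fin n → ℕ) (κ : Fin m → Fin n) (i : Fin n) : ℕ := P (s i) (s ∘ κ)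

/-- Tuples with the same equalities and the same visible labels. -/
structure Eqv (s s' : Fin n → ℕ) : Prop where
  eq_iff : ∀ i j, s i = s j ↔ s' i = s' j
  lab_eq : ∀ κ i j, Vis s κ i → Vis s κ j →
    lab srt c f (node P s κ i) (node P s κ j) = lab srt c f (node P s' κ i) (node P s' κ j)

/-- The indices of the visible red edges of the tuple are in `G`. -/
def VisAll (G : Red → Prop) (s : Fin n → ℕ) : Prop :=
  ∀ κ i j, Vis s κ i → Vis s κ j → (c (node P s κ i) (node P s κ j)).All G

variable {srt c P f}

theorem Vis.congr {s s' : Fin n → ℕ} (h : ∀ i j, s i = s j ↔ s' i = s' j) {κ : Fin m → Fin n}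
    {i : Fin n} (hv : Vis s κ i) : Vis s' κ i :=
  ⟨fun _ _ e => hv.1 ((h _ _).2 e), fun _ e => hv.2 _ ((h _ _).2 e)⟩

theorem Eqv.refl (s : Fin n → ℕ) : Eqv srt c P f s s := ⟨fun _ _ => Iff.rfl, fun _ _ _ _ _ => rfl⟩

theorem Eqv.symm {s s' : Fin n → ℕ} (h : Eqv srt c P f s s') : Eqv srt c P f s' s :=
  ⟨fun i j => (h.eq_iff i j).symm, fun κ i j hi hj => (h.lab_eq κ i j
    (hi.congr fun i j => (h.eq_iff i j).symm) (hj.congr fun i j => (h.eq_iff i j).symm)).symm⟩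

theorem Eqv.trans {s s' s'' : Fin n → ℕ} (h : Eqv srt c P f s s') (h' : Eqv srt c P f s' s'') :
    Eqv srt c P f s s'' :=
  ⟨fun i j => (h.eq_iff i j).trans (h'.eq_iff i j), fun κ i j hi hj =>
    (h.lab_eq κ i j hi hj).trans (h'.lab_eq κ i j (hi.congr h.eq_iff) (hj.congr h.eq_iff))⟩

/-- Letting `κ` range over all choices of parameter positions is what makes the equivalence
invariant under every `τ`. -/
theorem Eqv.comp {s s' : Fin n → ℕ} (h : Eqv srt c P f s s') (τ : Fin n → Fin n) :
    Eqv srt c P f (s ∘ τ) (s' ∘ τ) :=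
  ⟨fun i j => h.eq_iff (τ i) (τ j), fun κ i j hi hj => h.lab_eq (τ ∘ κ) (τ i) (τ j) hi hj⟩

theorem VisAll.comp {G : Red → Prop} {s : Fin n → ℕ} (h : VisAll c P G s) (τ : Fin n → Fin n) :
    VisAll c P G (s ∘ τ) := fun κ i j hi hj => h (τ ∘ κ) (τ i) (τ j) hi hj

theorem update_eq_comp_repl {U : Type*} (s : Fin n → U) (i j : Fin n) :
    Function.update s i (s j) = s ∘ repl i j := by
  funext k
  by_cases hk : k = i
  · subst hk
    simp [repl]
  · simp [repl, hk]

/-- The parameters occupy `m` of the `m + 3` positions, and visible positions avoid them. So only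
triangles are ever seen, and at most an edge besides a further position `i`; this matches what the
graph can copy. -/
theorem card_filter_vis_le (hm : m + 3 = n) {s : Fin n → ℕ} {κ : Fin m → Fin n}
    (hκ : Function.Injective (s ∘ κ)) (A : Finset (Fin n)) (hA : ∀ j ∈ A, Vis s κ j) :
    A.card ≤ 3 ∧ ∀ i ∉ A, (∀ l, κ l ≠ i) → A.card ≤ 2 := by
  classical
  have hκ' : Function.Injective κ := hκ.of_comp
  have hc : (Finset.univ.image κ).card = m := by
    rw [Finset.card_image_of_injective _ hκ', Finset.card_univ, Fintype.card_fin]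
  have hd : Disjoint A (Finset.univ.image κ) := by
    rw [Finset.disjoint_right]
    intro j hj hjA
    obtain ⟨l, -, rfl⟩ := Finset.mem_image.1 hj
    exact (hA _ hjA).2 l rfl
  have hle := Finset.card_le_univ (A ∪ Finset.univ.image κ)
  rw [Finset.card_union_of_disjoint hd, hc, Fintype.card_fin] at hle
  refine ⟨by omega, fun i hi hκi => ?_⟩
  have hi' : i ∉ A ∪ Finset.univ.image κ := by
    simp only [Finset.mem_union, Finset.mem_image, Finset.mem_univ, true_and, not_or, not_exists]
    exact ⟨hi, hκi⟩
  have hle' := Finset.card_le_univ (insert i (A ∪ Finset.univ.image κ))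
  rw [Finset.card_insert_of_notMem hi', Finset.card_union_of_disjoint hd, hc,
    Fintype.card_fin] at hle'
  omega

variable {G G' : Red → Prop}

/-- When position `i` is not a parameter, at most two other entries are visible and the extension
property over an edge supplies the node. Since `P` sees only the values of the parameters, one node
must serve all `κ` with the same values `k`. -/
theorem exists_node_of_notMem (h : Rich srt c) (hf : Lifts f G G') (hm : m + 3 = n)
    {s s' : Fin n → ℕ} (e : Eqv srt c P f s s') (i : Fin n) (u : ℕ)
    (hG : VisAll c P G (Function.update s i u)) (hG' : VisAll c P G' s')
    (hu : ∀ j, j ≠ i → s j ≠ u) (k : Fin m → ℕ) :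
    ∃ z', ∀ κ : Fin m → Fin n, (∀ l, κ l ≠ i) → s' ∘ κ = k → Function.Injective k →
      lab srt c f (P u (s ∘ κ)) (P u (s ∘ κ)) = lab srt c f z' z' ∧
      ∀ j, j ≠ i → Vis s κ j →
        lab srt c f (node P s κ j) (P u (s ∘ κ)) = lab srt c f (node P s' κ j) z' ∧
        (c (node P s' κ j) z').All G' := by
  classical
  by_cases hex : ∃ κ : Fin m → Fin n, (∀ l, κ l ≠ i) ∧ s' ∘ κ = k ∧ Function.Injective k
  swap
  · exact ⟨0, fun κ h₁ h₂ h₃ => absurd ⟨κ, h₁, h₂, h₃⟩ hex⟩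
  obtain ⟨κ, hκ, hκk, hk⟩ := hex
  suffices ∃ z', lab srt c f (P u (s ∘ κ)) (P u (s ∘ κ)) = lab srt c f z' z' ∧
      ∀ j, j ≠ i → Vis s κ j →
        lab srt c f (node P s κ j) (P u (s ∘ κ)) = lab srt c f (node P s' κ j) z' ∧
        (c (node P s' κ j) z').All G' by
    obtain ⟨z', h₁, h₂⟩ := this
    refine ⟨z', fun κ' _ hκ' _ => ?_⟩
    have e₁ : s' ∘ κ' = s' ∘ κ := hκ'.trans hκk.symm
    have e₂ : s ∘ κ' = s ∘ κ := funext fun l => (e.eq_iff _ _).2 (congrFun e₁ l)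
    simp only [Vis, node, e₁, e₂] at h₂ ⊢
    refine ⟨h₁, fun j hj hv => h₂ j hj ⟨hv.1, fun l => ?_⟩⟩
    rw [← show s (κ' l) = s (κ l) from congrFun e₂ l]
    exact hv.2 l
  have hinj : Function.Injective (s ∘ κ) := fun l l' hl =>
    hk (by rw [← hκk]; exact (e.eq_iff _ _).1 hl)
  have hupd : Function.update s i u ∘ κ = s ∘ κ := by
    funext l
    simp [hκ l]
  have hvis : ∀ j, j ≠ i → Vis s κ j → Vis (Function.update s i u) κ j := by
    intro j hj hv
    refine ⟨by rwa [hupd], fun l => ?_⟩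
    simpa [hκ l, hj] using hv.2 l
  have hvisi : Vis (Function.update s i u) κ i := by
    refine ⟨by rwa [hupd], fun l => ?_⟩
    simpa [hκ l] using hu _ (hκ l)
  have hnode : ∀ j, j ≠ i → node P (Function.update s i u) κ j = node P s κ j := by
    intro j hj
    simp [node, hupd, hj]
  have hnodei : node P (Function.update s i u) κ i = P u (s ∘ κ) := by
    simp [node, hupd]
  obtain hA | ⟨j₁, j₂, h₁, h₂, h₁', h₂', hA⟩ : (∀ j, j ≠ i → ¬ Vis s κ j) ∨
      ∃ j₁ j₂, j₁ ≠ i ∧ j₂ ≠ i ∧ Vis s κ j₁ ∧ Vis s κ j₂ ∧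
        ∀ j, j ≠ i → Vis s κ j → j = j₁ ∨ j = j₂ := by
    set A := Finset.univ.filter fun j => j ≠ i ∧ Vis s κ j with hAdef
    have hmem : ∀ j, j ∈ A ↔ j ≠ i ∧ Vis s κ j := fun j => by simp [hAdef]
    have hc := (card_filter_vis_le hm hinj A fun j hj => ((hmem j).1 hj).2).2 i
      (fun hi => ((hmem i).1 hi).1 rfl) hκ
    interval_cases hcard : A.card
    · left
      intro j hj hv
      rw [Finset.card_eq_zero] at hcard
      have := (hmem j).2 ⟨hj, hv⟩
      simp [hcard] at this
    · right
      obtain ⟨j₁, hj₁⟩ := Finset.card_eq_one.1 hcard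
      have := (hmem j₁).1 (by simp [hj₁])
      exact ⟨j₁, j₁, this.1, this.1, this.2, this.2, fun j hj hv => by
        simpa [hj₁] using (hmem j).2 ⟨hj, hv⟩⟩
    · right
      obtain ⟨j₁, j₂, -, hj⟩ := Finset.card_eq_two.1 hcard
      have h₁ := (hmem j₁).1 (by simp [hj])
      have h₂ := (hmem j₂).1 (by simp [hj])
      exact ⟨j₁, j₂, h₁.1, h₂.1, h₁.2, h₂.2, fun j hj' hv => by
        simpa [hj] using (hmem j).2 ⟨hj', hv⟩⟩
  · exact ⟨_, rfl, fun j hj hv => absurd hv (hA j hj)⟩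
  · have g₁ := hG κ j₁ j₂ (hvis _ h₁ h₁') (hvis _ h₂ h₂')
    have g₂ := hG κ j₁ i (hvis _ h₁ h₁') hvisi
    have g₃ := hG κ j₂ i (hvis _ h₂ h₂') hvisi
    rw [hnode _ h₁, hnode _ h₂] at g₁
    rw [hnode _ h₁, hnodei] at g₂
    rw [hnode _ h₂, hnodei] at g₃
    obtain ⟨z', a, b, a', b'⟩ := h.exists_lift hf (e.lab_eq κ j₁ j₂ h₁' h₂') g₁ g₂ g₃
      (hG' κ j₁ j₂ (h₁'.congr e.eq_iff) (h₂'.congr e.eq_iff))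
    refine ⟨z', h.lab_self (h.lab_symm a), fun j hj hv => ?_⟩
    rcases hA j hj hv with rfl | rfl
    exacts [⟨a, a'⟩, ⟨b, b'⟩]

/-- When the new entry is itself a parameter, all values of `P` in question are still free, so up to
three nodes are copied afresh. In `k` the new entry, not yet chosen, is represented by `none`. -/
theorem exists_nodes_of_mem (h : Rich srt c) (hf : Lifts f G G') (hm : m + 3 = n)
    {s s' : Fin n → ℕ} (e : ∀ i j, s i = s j ↔ s' i = s' j) (i : Fin n) (u : ℕ)
    (hG : VisAll c P G (Function.update s i u)) (k : Fin m → Option ℕ) :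
    ∃ g : ℕ → ℕ, ∀ κ : Fin m → Fin n,
      (fun l => if κ l = i then none else some (s' (κ l))) = k → (∃ l, κ l = i) →
      ∀ j j', Vis (Function.update s i u) κ j → Vis (Function.update s i u) κ j' →
        lab srt c f (node P (Function.update s i u) κ j) (node P (Function.update s i u) κ j') =
          lab srt c f (g (s' j)) (g (s' j')) ∧ (c (g (s' j)) (g (s' j'))).All G' := by
  classical
  set a := Function.update s i u with ha
  by_cases hex : ∃ κ : Fin m → Fin n, (fun l => if κ l = i then none else some (s' (κ l))) = k ∧
    (∃ l, κ l = i) ∧ ∃ j, Vis a κ j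
  swap
  · exact ⟨id, fun κ h₁ h₂ j _ h₃ => absurd ⟨κ, h₁, h₂, j, h₃⟩ hex⟩
  obtain ⟨κ, hκk, ⟨l₀, hl₀⟩, j₀, hj₀⟩ := hex
  have hne : ∀ j, Vis a κ j → j ≠ i := fun j hj hji => hj.2 l₀ (by rw [hl₀, hji])
  set A := Finset.univ.filter fun j => Vis a κ j with hA
  have hmem : ∀ j, j ∈ A ↔ Vis a κ j := fun j => by simp [hA]
  have hcard := (card_filter_vis_le hm hj₀.1 A fun j hj => (hmem j).1 hj).1
  have hval : ∀ j, Vis a κ j → a j = s j := fun j hj => by simp [ha, hne j hj]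
  set g₀ : ℕ → ℕ := fun y => if hy : ∃ j, Vis a κ j ∧ s' j = y then node P a κ hy.choose else 0
    with hg₀
  have hg₀' : ∀ j, Vis a κ j → g₀ (s' j) = node P a κ j := by
    intro j hj
    have hy : ∃ j', Vis a κ j' ∧ s' j' = s' j := ⟨j, hj, rfl⟩
    simp only [hg₀, dif_pos hy, node]
    rw [hval _ hy.choose_spec.1, hval _ hj, (e _ _).2 hy.choose_spec.2]
  obtain ⟨g, hg⟩ := h.exists_lift₃ hf (A.image s') (Finset.card_image_le.trans hcard) g₀ (by
    intro x hx y hy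
    obtain ⟨j, hj, rfl⟩ := Finset.mem_image.1 hx
    obtain ⟨j', hj', rfl⟩ := Finset.mem_image.1 hy
    rw [hmem] at hj hj'
    rw [hg₀' _ hj, hg₀' _ hj']
    exact hG κ j j' hj hj')
  refine ⟨g, fun κ' hκ' _ j j' hj hj' => ?_⟩
  have e₁ : a ∘ κ' = a ∘ κ := by
    funext l
    have := congrFun (hκ'.trans hκk.symm) l
    by_cases h₁ : κ' l = i
    · by_cases h₂ : κ l = i
      · simp [h₁, h₂]
      · simp [h₁, h₂] at this
    · by_cases h₂ : κ l = i
      · simp [h₁, h₂] at this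
      · simp only [h₁, h₂, if_false, Option.some.injEq] at this
        simpa [ha, h₁, h₂] using (e _ _).2 this
  have hv : ∀ j, Vis a κ' j → Vis a κ j := fun j hj => by
    refine ⟨by rw [← e₁]; exact hj.1, fun l => ?_⟩
    rw [← show a (κ' l) = a (κ l) from congrFun e₁ l]
    exact hj.2 l
  have := hg (s' j) (Finset.mem_image_of_mem _ ((hmem j).2 (hv j hj))) (s' j')
    (Finset.mem_image_of_mem _ ((hmem j').2 (hv j' hj')))
  rw [hg₀' _ (hv j hj), hg₀' _ (hv j' hj')] at this
  simp only [node, e₁] at this ⊢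
  exact this

/-- The back-and-forth property. An old value of `u` is answered by the corresponding entry of `s'`,
a new one by a generic element at which `P` takes the values found in the two preceding lemmas. -/
theorem Eqv.exists_update (h : Rich srt c) (hf : Lifts f G G') (hP : Generic P) (hm : m + 3 = n)
    {s s' : Fin n → ℕ} (e : Eqv srt c P f s s') (i : Fin n) (u : ℕ)
    (hG : VisAll c P G (Function.update s i u)) (hG' : VisAll c P G' s') :
    ∃ u', Eqv srt c P f (Function.update s i u) (Function.update s' i u') ∧
      VisAll c P G' (Function.update s' i u') := by
  classical
  by_cases hu : ∃ j, j ≠ i ∧ s j = u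
  · obtain ⟨j, -, rfl⟩ := hu
    refine ⟨s' j, ?_⟩
    rw [update_eq_comp_repl, update_eq_comp_repl]
    exact ⟨e.comp _, hG'.comp _⟩
  push Not at hu
  choose z hz using exists_node_of_notMem h hf hm e i u hG hG' hu
  choose g hg using exists_nodes_of_mem (G' := G') h hf hm e.eq_iff i u hG
  -- The value `0` from `getD` stands for a parameter equal to `v`. It plays no role: the entry `v`
  -- is not visible if `v` is also a parameter.
  obtain ⟨v, hv, hPv⟩ := hP (Finset.univ.image s') fun x k => match x with
    | none => z fun l => (k l).getD 0
    | some x => g k x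
  have hv' : ∀ j, s' j ≠ v := fun j => (hv _ (Finset.mem_image_of_mem _ (Finset.mem_univ j))).ne
  refine ⟨v, ?_⟩
  set a := Function.update s i u with ha
  set a' := Function.update s' i v with ha'
  have ai : a i = u := by simp [ha]
  have ai' : a' i = v := by simp [ha']
  have aj : ∀ j, j ≠ i → a j = s j := fun j hj => by simp [ha, hj]
  have aj' : ∀ j, j ≠ i → a' j = s' j := fun j hj => by simp [ha', hj]
  have heq : ∀ j j', a j = a j' ↔ a' j = a' j' := by
    intro j j'
    by_cases hj : j = i
    · by_cases hj' : j' = i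
      · rw [hj, hj']; simp
      · rw [hj, ai, ai', aj _ hj', aj' _ hj']
        exact iff_of_false (hu _ hj').symm (hv' _).symm
    · by_cases hj' : j' = i
      · rw [hj', ai, ai', aj _ hj, aj' _ hj]
        exact iff_of_false (hu _ hj) (hv' _)
      · rw [aj _ hj, aj' _ hj, aj _ hj', aj' _ hj']
        exact e.eq_iff j j'
  have hor : ∀ j, a' j ∈ Finset.univ.image s' ∨ a' j = v := by
    intro j
    by_cases hj : j = i
    · exact .inr (by rw [hj, ai'])
    · exact .inl (by rw [aj' _ hj]; exact Finset.mem_image_of_mem _ (Finset.mem_univ j))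
  have hmask : ∀ j, mask v (a' j) = if j = i then none else some (s' j) := by
    intro j
    by_cases hj : j = i
    · simp [hj, mask, ai']
    · simp [hj, mask, aj' _ hj, hv' j]
  have key : ∀ κ j j', Vis a κ j → Vis a κ j' →
      lab srt c f (node P a κ j) (node P a κ j') = lab srt c f (node P a' κ j) (node P a' κ j') ∧
      (c (node P a' κ j) (node P a' κ j')).All G' := by
    intro κ j j' hj hj'
    by_cases hκ : ∃ l, κ l = i
    · have hnode : ∀ j, Vis a κ j → node P a' κ j =
          g (fun l => if κ l = i then none else some (s' (κ l))) (s' j) := by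
        intro j hj
        obtain ⟨l, hl⟩ := hκ
        have hji : j ≠ i := fun hji => hj.2 l (by rw [hl, hji])
        rw [node, hPv (a' j) (a' ∘ κ) (hor j) (fun l => hor _)
          (.inr ⟨l, by rw [Function.comp_apply, hl, ai']⟩), hmask, if_neg hji]
        simp only [Function.comp, hmask]
      rw [hnode j hj, hnode j' hj']
      exact hg _ κ rfl hκ j j' hj hj'
    · push Not at hκ
      have e₁ : a ∘ κ = s ∘ κ := funext fun l => aj _ (hκ l)
      have e₂ : a' ∘ κ = s' ∘ κ := funext fun l => aj' _ (hκ l)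
      have hnode : ∀ j, j ≠ i → node P a κ j = node P s κ j := fun j hj => by
        rw [node, node, e₁, aj _ hj]
      have hnode' : ∀ j, j ≠ i → node P a' κ j = node P s' κ j := fun j hj => by
        rw [node, node, e₂, aj' _ hj]
      have hnodei : node P a κ i = P u (s ∘ κ) := by rw [node, e₁, ai]
      have hnodei' : node P a' κ i = z (s' ∘ κ) := by
        rw [node, hPv (a' i) (a' ∘ κ) (hor i) (fun l => hor _) (.inl ai'), hmask, if_pos rfl]
        refine congrArg z (funext fun l => ?_)
        simp [hmask, hκ l]
      have hvis : ∀ j, j ≠ i → Vis a κ j → Vis s κ j := fun j hji hj => by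
        refine ⟨by rw [← e₁]; exact hj.1, fun l => ?_⟩
        rw [← aj _ (hκ l), ← aj _ hji]
        exact hj.2 l
      have hinj : Function.Injective (s' ∘ κ) := by
        intro l l' hl
        rw [← e₂] at hl
        exact hj.1 ((heq _ _).2 hl)
      have hz' := hz (s' ∘ κ) κ hκ rfl hinj
      by_cases h₁ : j = i
      · by_cases h₂ : j' = i
        · subst h₁
          rw [h₂, hnodei, hnodei']
          exact ⟨hz'.1, fun r hr => by rw [h.self] at hr; cases hr⟩
        · subst h₁
          rw [hnodei, hnodei', hnode _ h₂, hnode' _ h₂]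
          obtain ⟨a₁, a₂⟩ := hz'.2 j' h₂ (hvis _ h₂ hj')
          exact ⟨h.lab_symm a₁, by rwa [h.symm]⟩
      · by_cases h₂ : j' = i
        · subst h₂
          rw [hnodei, hnodei', hnode _ h₁, hnode' _ h₁]
          exact hz'.2 j h₁ (hvis _ h₁ hj)
        · rw [hnode _ h₁, hnode _ h₂, hnode' _ h₁, hnode' _ h₂]
          have v₁ := hvis _ h₁ hj
          have v₂ := hvis _ h₂ hj'
          exact ⟨e.lab_eq κ j j' v₁ v₂, hG' κ j j' (v₁.congr e.eq_iff) (v₂.congr e.eq_iff)⟩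
  refine ⟨⟨heq, fun κ j j' hj hj' => (key κ j j' hj hj').1⟩, fun κ j j' hj hj' => ?_⟩
  have hs : ∀ i j, a' i = a' j ↔ a i = a j := fun i j => (heq i j).symm
  exact (key κ j j' (hj.congr hs) (hj'.congr hs)).2

end

/-! ### Consequences of the axioms -/

namespace CylAxioms

variable {n : ℕ} {A : Type*} [BooleanAlgebra A] {c : Fin n → A → A}

theorem cyl_top (h : CylAxioms c) (i : Fin n) : c i ⊤ = ⊤ := top_le_iff.1 (h.le_cyl i ⊤)

theorem cyl_cyl (h : CylAxioms c) (i : Fin n) (x : A) : c i (c i x) = c i x := by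
  have := h.cyl_inf i ⊤ x
  rwa [top_inf_eq, h.cyl_top, top_inf_eq] at this

theorem cyl_mono (h : CylAxioms c) (i : Fin n) : Monotone (c i) := by
  intro x y hxy
  have := h.cyl_inf i x y
  rw [inf_eq_left.2 (hxy.trans (h.le_cyl i y))] at this
  exact inf_eq_left.1 this.symm

theorem cyl_compl_cyl (h : CylAxioms c) (i : Fin n) (x : A) : c i (c i x)ᶜ = (c i x)ᶜ := by
  refine le_antisymm ?_ (h.le_cyl _ _)
  have := h.cyl_inf i (c i x)ᶜ x
  rw [compl_inf_eq_bot, h.cyl_bot] at this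
  exact le_compl_iff_disjoint_right.2 (disjoint_iff.2 this.symm)

theorem cyl_inf_of_eq (h : CylAxioms c) {i : Fin n} {x y : A} (hy : c i y = y) :
    c i (x ⊓ y) = c i x ⊓ y := by
  conv_lhs => rw [← hy]
  rw [h.cyl_inf, hy]

theorem cyl_sup (h : CylAxioms c) (i : Fin n) (x y : A) : c i (x ⊔ y) = c i x ⊔ c i y := by
  refine le_antisymm ?_ (sup_le (h.cyl_mono i le_sup_left) (h.cyl_mono i le_sup_right))
  have h₁ : c i ((c i x)ᶜ ⊓ (c i y)ᶜ) = (c i x)ᶜ ⊓ (c i y)ᶜ := by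
    rw [h.cyl_inf_of_eq (h.cyl_compl_cyl i y), h.cyl_compl_cyl]
  have h₂ := h.cyl_compl_cyl i ((c i x)ᶜ ⊓ (c i y)ᶜ)
  rw [h₁, compl_inf, compl_compl, compl_compl] at h₂
  rw [← h₂]
  exact h.cyl_mono i (sup_le_sup (h.le_cyl i x) (h.le_cyl i y))

end CylAxioms

namespace IsBoolEndo

variable {A : Type*} [BooleanAlgebra A] {s : A → A}

theorem map_inf (h : IsBoolEndo s) (x y : A) : s (x ⊓ y) = s x ⊓ s y := by
  have := h.map_compl (xᶜ ⊔ yᶜ)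
  rwa [h.map_sup, h.map_compl x, h.map_compl y, compl_sup, compl_sup, compl_compl, compl_compl,
    compl_compl, compl_compl] at this

theorem map_bot (h : IsBoolEndo s) : s ⊥ = ⊥ := by
  have := h.map_inf ⊥ ⊥ᶜ
  rwa [h.map_compl, inf_compl_self, inf_compl_self] at this

theorem mono (h : IsBoolEndo s) : Monotone s := fun x y hxy => by
  rw [← inf_eq_left, ← h.map_inf, inf_eq_left.2 hxy]

end IsBoolEndo

/-! ### Substitution reducts of polyadic and cylindric algebras -/

section Reducts

variable {n : ℕ} {A : Type*} [BooleanAlgebra A] {c : Fin n → A → A}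

theorem repl_self (i j : Fin n) : repl i j i = j := by simp [repl]

theorem repl_of_ne {i j k : Fin n} (h : k ≠ i) : repl i j k = k := by simp [repl, h]

/-- The substitution reduct of a polyadic algebra. -/
theorem PAAxioms.scAxioms {s : (Fin n → Fin n) → A → A} (h : PAAxioms c s) :
    ScAxioms c fun i j => s (repl i j) where
  toCylAxioms := h.toCylAxioms
  sub_endo i j := h.sub_endo _
  sub_self i x := by rw [show repl i i = id from Function.update_eq_self i id, h.sub_id]
  sub_cyl_same i j x := by
    rw [h.sub_cyl (repl i j) id i x fun k hk => repl_of_ne hk, h.sub_id]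
  cyl_sub_same i j x hij := by
    apply h.cyl_sub_of_notMem
    intro k
    by_cases hk : k = i
    · rw [hk, repl_self]; exact hij.symm
    · rwa [repl_of_ne hk]
  sub_cyl i j k x hki hkj := by
    refine (h.cyl_sub _ _ _ _ fun l => ?_).symm
    by_cases hl : l = i
    · subst hl
      rw [repl_self]
      exact iff_of_false hkj.symm hki.symm
    · rw [repl_of_ne hl]
  cyl_sub_swap i j x := by
    by_cases hij : i = j
    · subst hij; rfl
    have hne : ∀ k, repl j i k ≠ j := by
      intro k
      by_cases hk : k = j
      · rw [hk, repl_self]; exact hij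
      · rwa [repl_of_ne hk]
    -- Exchanging `i` and `j` turns one side into the other. The element `c i (s (repl j i) x)`
    -- depends on neither coordinate, so the exchange leaves it fixed.
    have hcomp : repl i j = Equiv.swap i j ∘ repl j i := by
      funext k
      by_cases hk : k = j
      · subst hk
        rw [Function.comp_apply, repl_self, repl_of_ne (Ne.symm hij), Equiv.swap_apply_left]
      · by_cases hk' : k = i
        · subst hk'
          rw [Function.comp_apply, repl_self, repl_of_ne hij, Equiv.swap_apply_left]
        · rw [Function.comp_apply, repl_of_ne hk, repl_of_ne hk',
            Equiv.swap_apply_of_ne_of_ne hk' hk]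
    have h₁ : c j (s (repl i j) x) = s (Equiv.swap i j) (c i (s (repl j i) x)) := by
      rw [hcomp, h.sub_comp, h.cyl_sub]
      intro k
      rw [Equiv.swap_apply_eq_iff, Equiv.swap_apply_right]
    have h₂ : c j (c i (s (repl j i) x)) = c i (s (repl j i) x) := by
      rw [h.cyl_comm, h.cyl_sub_of_notMem _ _ _ hne]
    rw [h₁, h.sub_cyl _ (repl j i) i, ← h₂, h.sub_cyl (repl j i) id j, h.sub_id]
    · exact fun k hk => repl_of_ne hk
    · intro k hk
      by_cases hk' : k = j
      · rw [hk', repl_self, Equiv.swap_apply_right]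
      · rw [repl_of_ne hk', Equiv.swap_apply_of_ne_of_ne hk hk']
  sub_comm i j k l x hd := by
    simp only [List.nodup_cons, List.mem_cons, List.not_mem_nil, or_false, not_or,
      not_false_eq_true, List.nodup_nil, and_true] at hd
    obtain ⟨⟨hij, hik, hil⟩, ⟨hjk, hjl⟩, hkl⟩ := hd
    rw [← h.sub_comp, ← h.sub_comp]
    congr 1
    funext t
    by_cases h₁ : t = i
    · subst h₁
      rw [Function.comp_apply, Function.comp_apply, repl_of_ne hik, repl_self, repl_of_ne hjk]
    · by_cases h₂ : t = k
      · subst h₂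
        rw [Function.comp_apply, Function.comp_apply, repl_of_ne h₁, repl_self,
          repl_of_ne (Ne.symm hil)]
      · simp only [Function.comp_apply, repl_of_ne h₁, repl_of_ne h₂]
  sub_sub i j l x := by
    rw [← h.sub_comp, ← h.sub_comp]
    congr 1
    funext t
    by_cases h₁ : t = j
    · subst h₁
      simp only [Function.comp_apply, repl_self]
      by_cases h₂ : i = l
      · rw [h₂, repl_self]
      · rw [repl_of_ne h₂]
    · simp only [Function.comp_apply, repl_of_ne h₁]

open Classical in
/-- The substitutions of a cylindric algebra. -/
noncomputable def caSub (c : Fin n → A → A) (d : Fin n → Fin n → A) (i j : Fin n) (x : A) : A :=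
  if i = j then x else c i (d i j ⊓ x)

theorem caSub_self (d : Fin n → Fin n → A) (i : Fin n) (x : A) : caSub c d i i x = x := if_pos rfl

theorem caSub_of_ne (d : Fin n → Fin n → A) {i j : Fin n} (h : i ≠ j) (x : A) :
    caSub c d i j x = c i (d i j ⊓ x) := if_neg h

namespace CAAxioms

variable {d : Fin n → Fin n → A}

theorem cyl_inf_diag (h : CAAxioms c d) {i j : Fin n} (hij : i ≠ j) :
    c i (d i j ⊓ d j i) = ⊤ := by
  rw [inf_comm, ← h.diag_eq j j i hij hij, h.diag_self]

theorem diag_le_symm (h : CAAxioms c d) {i j : Fin n} (hij : i ≠ j) : d i j ≤ d j i := by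
  have h₁ := h.diag_disjoint i j (d j i) hij
  rw [h.cyl_inf_diag hij, top_inf_eq] at h₁
  have h₂ : d i j ⊓ (d j i)ᶜ = ⊥ := le_bot_iff.1 (h₁ ▸ h.le_cyl i _)
  simpa using disjoint_compl_right_iff.1 (disjoint_iff.2 h₂)

theorem diag_symm (h : CAAxioms c d) (i j : Fin n) : d i j = d j i := by
  by_cases hij : i = j
  · rw [hij]
  · exact le_antisymm (h.diag_le_symm hij) (h.diag_le_symm (Ne.symm hij))

theorem cyl_diag (h : CAAxioms c d) {i j : Fin n} (hij : i ≠ j) : c i (d i j) = ⊤ :=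
  top_le_iff.1 ((h.cyl_inf_diag hij).ge.trans (h.cyl_mono i inf_le_left))

theorem cyl_diag_of_ne (h : CAAxioms c d) {i j k : Fin n} (hi : k ≠ i) (hj : k ≠ j) :
    c k (d i j) = d i j := by
  rw [h.diag_eq i j k hi hj, h.cyl_cyl]

theorem diag_inf_le (h : CAAxioms c d) {i j k : Fin n} (hi : k ≠ i) (hj : k ≠ j) :
    d i k ⊓ d k j ≤ d i j := by
  rw [h.diag_eq i j k hi hj]
  exact h.le_cyl _ _

theorem diag_inf_cyl (h : CAAxioms c d) {i j : Fin n} (hij : i ≠ j) (x : A) :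
    d i j ⊓ c i (d i j ⊓ x) = d i j ⊓ x := by
  refine le_antisymm (le_inf inf_le_left ?_) (le_inf inf_le_left (h.le_cyl _ _))
  rw [← disjoint_compl_right_iff, disjoint_iff, ← le_bot_iff, ← h.diag_disjoint i j x hij]
  refine le_inf (inf_le_left.trans inf_le_right) ((le_inf ?_ inf_le_right).trans (h.le_cyl _ _))
  exact inf_le_left.trans inf_le_left

theorem cyl_inf_diag_of_ne (h : CAAxioms c d) {i j k : Fin n} (hi : k ≠ i) (hj : k ≠ j) (x : A) :
    c k (d i j ⊓ x) = d i j ⊓ c k x := by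
  rw [inf_comm, h.cyl_inf_of_eq (h.cyl_diag_of_ne hi hj), inf_comm]

/-- The substitution reduct of a cylindric algebra. -/
theorem scAxioms (h : CAAxioms c d) : ScAxioms c (caSub c d) where
  toCylAxioms := h.toCylAxioms
  sub_endo i j := by
    by_cases hij : i = j
    · subst hij
      exact ⟨fun x y => by simp only [caSub_self], fun x => by simp only [caSub_self]⟩
    refine ⟨fun x y => ?_, fun x => ?_⟩
    · simp only [caSub_of_ne d hij, inf_sup_left, h.cyl_sup]
    · simp only [caSub_of_ne d hij]
      refine (IsCompl.compl_eq ⟨disjoint_iff.2 (h.diag_disjoint i j x hij), ?_⟩).symm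
      rw [codisjoint_iff, ← h.cyl_sup, ← inf_sup_left, sup_compl_eq_top, inf_top_eq,
        h.cyl_diag hij]
  sub_self i x := caSub_self d i x
  sub_cyl_same i j x := by
    by_cases hij : i = j
    · subst hij
      exact caSub_self d i _
    · rw [caSub_of_ne d hij, h.cyl_inf, h.cyl_diag hij, top_inf_eq]
  cyl_sub_same i j x hij := by rw [caSub_of_ne d hij, h.cyl_cyl]
  sub_cyl i j k x hki hkj := by
    by_cases hij : i = j
    · subst hij
      simp only [caSub_self]
    · rw [caSub_of_ne d hij, caSub_of_ne d hij, h.cyl_comm k i, h.cyl_inf_diag_of_ne hki hkj]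
  cyl_sub_swap i j x := by
    by_cases hij : i = j
    · subst hij; rfl
    · rw [caSub_of_ne d hij, caSub_of_ne d (Ne.symm hij), h.cyl_comm, h.diag_symm]
  sub_comm i j k l x hd := by
    simp only [List.nodup_cons, List.mem_cons, List.not_mem_nil, or_false, not_or,
      not_false_eq_true, List.nodup_nil, and_true] at hd
    obtain ⟨⟨hij, hik, hil⟩, ⟨hjk, hjl⟩, hkl⟩ := hd
    simp only [caSub_of_ne d hij, caSub_of_ne d hkl]
    rw [← h.cyl_inf_diag_of_ne (Ne.symm hik) (Ne.symm hjk), ← h.cyl_inf_diag_of_ne hik hil,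
      h.cyl_comm, inf_left_comm]
  sub_sub i j l x := by
    by_cases hli : l = i
    · subst hli; rfl
    by_cases hjl : j = l
    · subst hjl
      rw [caSub_self, caSub_of_ne d hli, caSub_of_ne d hli, h.cyl_inf, h.cyl_diag hli, top_inf_eq]
    by_cases hji : j = i
    · subst hji
      rw [caSub_self, caSub_of_ne d hli, caSub_of_ne d hjl, caSub_of_ne d hli, h.diag_symm l j,
        h.diag_inf_cyl hjl]
    · simp only [caSub_of_ne d hli, caSub_of_ne d hjl, caSub_of_ne d hji]
      rw [← h.cyl_inf_diag_of_ne hjl hji, ← h.cyl_inf_diag_of_ne hjl hji, ← inf_assoc, ← inf_assoc]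
      congr 3
      refine le_antisymm (le_inf inf_le_left ?_) (le_inf inf_le_left ?_)
      · rw [inf_comm]
        exact h.diag_inf_le (Ne.symm hjl) hli
      · rw [inf_comm, h.diag_symm l i]
        exact h.diag_inf_le (Ne.symm hji) (Ne.symm hli)

end CAAxioms

end Reducts

/-! ### Full set algebras -/

section SetAlgebras

variable {n : ℕ} (U : Type*)

theorem update_comp_eq {τ : Fin n → Fin n} {i j : Fin n} (h : ∀ k, τ k = i ↔ k = j)
    (s : Fin n → U) (u : U) :
    Function.update s i u ∘ τ = Function.update (s ∘ τ) j u := by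
  funext k
  by_cases hk : k = j
  · subst hk
    simp [(h k).2 rfl]
  · simp [hk, mt (h k).1 hk]

theorem peaAxioms_fullSetAlg : PEAAxioms (fullSetAlg .PEA n U).cyl
    (fun τ => (fullSetAlg .PEA n U).sub τ trivial) ((fullSetAlg .PEA n U).diag trivial) where
  cyl_bot i := by ext s; simp [fullSetAlg]
  le_cyl i x s hs := ⟨s i, by rwa [Function.update_eq_self]⟩
  cyl_inf i x y := by
    ext s
    simp [fullSetAlg]
  cyl_comm i j x := by
    by_cases hij : i = j
    · subst hij; rfl
    ext s
    simp only [fullSetAlg, Set.mem_ofPred_eq]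
    rw [exists_comm]
    simp only [Function.update_comm hij]
  sub_endo τ := ⟨fun x y => rfl, fun x => rfl⟩
  sub_id x := rfl
  sub_comp σ τ x := rfl
  sub_cyl σ τ i x h := by
    ext s
    simp only [fullSetAlg, Set.mem_ofPred_eq]
    refine exists_congr fun u => ?_
    have : Function.update (s ∘ σ) i u = Function.update (s ∘ τ) i u := by
      funext k
      by_cases hk : k = i
      · subst hk; simp
      · simp [hk, h k hk]
    rw [this]
  cyl_sub τ i j x h := by
    ext s
    simp only [fullSetAlg, Set.mem_ofPred_eq]
    simp only [update_comp_eq U h]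
  cyl_sub_of_notMem τ i x h := by
    ext s
    simp only [fullSetAlg, Set.mem_ofPred_eq]
    have : ∀ u, Function.update s i u ∘ τ = s ∘ τ := fun u => by
      funext k
      simp [h k]
    simp only [this]
    exact ⟨fun ⟨_, h⟩ => h, fun h => ⟨s i, h⟩⟩
  diag_self i := by ext s; simp [fullSetAlg]
  inf_diag_le i j x := by
    rintro s ⟨hs, he : s i = s j⟩
    change s ∘ repl i j ∈ x
    rwa [← update_eq_comp_repl, ← he, Function.update_eq_self]
  sub_diag τ i j := rfl

theorem caAxioms_fullSetAlg :
    CAAxioms (fullSetAlg .CA n U).cyl ((fullSetAlg .CA n U).diag trivial) where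
  toCylAxioms := (peaAxioms_fullSetAlg U).toCylAxioms
  diag_self i := by ext s; simp [fullSetAlg]
  diag_eq i j k hi hj := by
    ext s
    simp [fullSetAlg, Function.update_of_ne hi.symm, Function.update_of_ne hj.symm]
  diag_disjoint i j x hij := by
    refine Set.eq_empty_of_forall_notMem fun s hs => ?_
    obtain ⟨⟨u, h₁ : Function.update s i u i = Function.update s i u j, h₂⟩,
      ⟨v, h₃ : Function.update s i v i = Function.update s i v j, h₄⟩⟩ := hs
    rw [Function.update_self, Function.update_of_ne hij.symm] at h₁ h₃
    subst h₁ h₃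
    exact h₄ h₂

theorem isModel_fullSetAlg (K : Kind) : (fullSetAlg K n U).IsModel :=
  match K with
  | .Sc => (peaAxioms_fullSetAlg U).toPAAxioms.scAxioms
  | .CA => caAxioms_fullSetAlg U
  | .PA => (peaAxioms_fullSetAlg U).toPAAxioms
  | .PEA => peaAxioms_fullSetAlg U

end SetAlgebras

/-! ### Atomic algebras and their atom structures -/

section

variable {n : ℕ} {A : Type*} [BooleanAlgebra A]

/-- The reducts of an algebra of the type of polyadic equality algebras. -/
def Ops.rd (K : Kind) (o : Ops .PEA n A) : Ops K n A where
  cyl := o.cyl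
  sub τ _ := o.sub τ trivial
  diag _ := o.diag trivial

theorem mem_subs_pea (τ : Fin n → Fin n) : τ ∈ Kind.PEA.subs n := trivial

theorem hasDiag_pea : Kind.PEA.HasDiag := trivial

/-- The operations are determined by their values on atoms. -/
structure Ops.AtomAdditive (o : Ops .PEA n A) : Prop where
  cyl : ∀ i a x, IsAtom a → a ≤ o.cyl i x → ∃ b, IsAtom b ∧ b ≤ x ∧ a ≤ o.cyl i b
  sub : ∀ τ a x, IsAtom a → a ≤ o.sub τ (mem_subs_pea τ) x →
    ∃ b, IsAtom b ∧ b ≤ x ∧ a ≤ o.sub τ (mem_subs_pea τ) b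

theorem IsAtom.le_or_le_compl {a : A} (ha : IsAtom a) (x : A) : a ≤ x ∨ a ≤ xᶜ := by
  rcases ha.le_iff.1 (inf_le_left : a ⊓ x ≤ a) with h | h
  · exact .inr (le_compl_iff_disjoint_right.2 (disjoint_iff.2 h))
  · exact .inl (inf_eq_left.1 h)

theorem IsAtom.le_compl_iff {a : A} (ha : IsAtom a) (x : A) : a ≤ xᶜ ↔ ¬ a ≤ x := by
  refine ⟨fun h h' => ha.1 (le_bot_iff.1 ?_), (IsAtom.le_or_le_compl ha x).resolve_left⟩
  rw [← inf_compl_self x]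
  exact le_inf h' h

/-- The homomorphism that sends an element to the set of atoms below it. -/
def atomsBelow (A : Type*) [BooleanAlgebra A] : BoundedLatticeHom A (Set {a : A // IsAtom a}) where
  toFun x := {a | (a : A) ≤ x}
  map_sup' x y := by
    ext ⟨a, ha⟩
    refine ⟨fun h => ?_, fun h => h.elim (fun h => le_trans h le_sup_left)
      fun h => le_trans h le_sup_right⟩
    by_contra hxy
    have h₁ := (IsAtom.le_compl_iff ha x).2 fun h => hxy (.inl h)
    have h₂ := (IsAtom.le_compl_iff ha y).2 fun h => hxy (.inr h)
    have h₃ := le_inf h₁ h₂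
    rw [← compl_sup] at h₃
    exact (IsAtom.le_compl_iff ha _).1 h₃ h
  map_inf' x y := by
    ext a
    exact le_inf_iff
  map_top' := by
    ext a
    exact ⟨fun _ => trivial, fun _ => le_top (a := (a : A))⟩
  map_bot' := by
    ext a
    exact ⟨fun h => a.2.1 (le_bot_iff.1 h), fun h => h.elim⟩

theorem mem_atomsBelow {x : A} {a : {a : A // IsAtom a}} :
    a ∈ atomsBelow A x ↔ (a : A) ≤ x := Iff.rfl

theorem atomsBelow_atom (a : {a : A // IsAtom a}) : atomsBelow A a = {a} := by
  ext b
  rw [mem_atomsBelow, Set.mem_singleton_iff]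
  refine ⟨fun h => ?_, fun h => by rw [h]⟩
  exact Subtype.ext ((a.2.le_iff.1 h).resolve_left b.2.1)

theorem atomsBelow_injective [IsAtomic A] : Function.Injective (atomsBelow A) := by
  have key : ∀ x y : A, atomsBelow A x = atomsBelow A y → x ≤ y := by
    intro x y h
    by_contra hxy
    have hne : x ⊓ yᶜ ≠ ⊥ := fun hb => hxy (by
      rw [← disjoint_compl_right_iff]; exact disjoint_iff.2 hb)
    obtain ⟨a, ha, hle⟩ := (eq_bot_or_exists_atom_le (x ⊓ yᶜ)).resolve_left hne
    have h₁ : (⟨a, ha⟩ : {a : A // IsAtom a}) ∈ atomsBelow A x := hle.trans inf_le_left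
    rw [h] at h₁
    exact (IsAtom.le_compl_iff ha y).1 (hle.trans inf_le_right) h₁
  exact fun x y h => le_antisymm (key x y h) (key y x h.symm)

variable {o : Ops .PEA n A}

theorem isHom_atomsBelow (h : o.AtomAdditive)
    (hc : ∀ i, Monotone (o.cyl i)) (hs : ∀ τ, Monotone (o.sub τ (mem_subs_pea τ))) :
    o.IsHom o.At.Cm (atomsBelow A) where
  map_cyl i x := by
    ext a
    constructor
    · intro ha
      obtain ⟨b, hb, hbx, hab⟩ := h.cyl i a x a.2 ha
      exact ⟨⟨b, hb⟩, hbx, hab⟩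
    · rintro ⟨b, hbx, hab⟩
      exact le_trans (show (a : A) ≤ o.cyl i b from hab) (hc i hbx)
  map_sub τ _ x := by
    ext a
    constructor
    · intro ha
      obtain ⟨b, hb, hbx, hab⟩ := h.sub τ a x a.2 ha
      exact ⟨⟨b, hb⟩, hbx, hab⟩
    · rintro ⟨b, hbx, hab⟩
      exact le_trans (show (a : A) ≤ o.sub τ (mem_subs_pea τ) b from hab) (hs τ hbx)
  map_diag _ i j := rfl

/-- An equation between completely additive operations holds if it holds on singletons. -/
theorem additive_ext {X : Type*} {F G : Set X → Set X}
    (hF : ∀ Y a, a ∈ F Y ↔ ∃ b ∈ Y, a ∈ F {b}) (hG : ∀ Y a, a ∈ G Y ↔ ∃ b ∈ Y, a ∈ G {b})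
    (h : ∀ b, F {b} = G {b}) (Y : Set X) : F Y = G Y := by
  ext a
  rw [hF, hG]
  simp only [h]

/-- Most axioms equate completely additive operations, so they may be checked on singletons, where
`atomsBelow` transfers them. The exceptions `cyl_inf` and the preservation of complements hold
because the relation of a cylindrifier on atoms is an equivalence (`symm`, `trans`) and that of a
substitution is a function (`uniq`, `tot`). -/
theorem isModel_cm_at (ho : o.IsModel) (h : o.AtomAdditive) : o.At.Cm.IsModel := by
  have ho' : PEAAxioms o.cyl (fun τ => o.sub τ (mem_subs_pea τ)) (o.diag hasDiag_pea) := ho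
  have hom := isHom_atomsBelow h ho'.cyl_mono fun τ => (ho'.sub_endo τ).mono
  have hc : ∀ i b, o.At.Cm.cyl i {b} = atomsBelow A (o.cyl i b) := fun i b => by
    rw [hom.map_cyl, atomsBelow_atom]
  have hs : ∀ τ b, o.At.Cm.sub τ (mem_subs_pea τ) {b} = atomsBelow A (o.sub τ (mem_subs_pea τ) b) :=
      fun τ b => by
    rw [hom.map_sub, atomsBelow_atom]
  have addc : ∀ i Y a, a ∈ o.At.Cm.cyl i Y ↔ ∃ b ∈ Y, a ∈ o.At.Cm.cyl i {b} := fun i Y a =>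
    exists_congr fun b => and_congr_right fun _ =>
      (exists_eq_left (p := fun d => o.At.cylRel i a d)).symm
  have adds : ∀ τ Y a, a ∈ o.At.Cm.sub τ (mem_subs_pea τ) Y ↔
      ∃ b ∈ Y, a ∈ o.At.Cm.sub τ (mem_subs_pea τ) {b} :=
    fun τ Y a => exists_congr fun b => and_congr_right fun _ =>
      (exists_eq_left (p := fun d => o.At.subRel τ (mem_subs_pea τ) a d)).symm
  have comp : ∀ {X : Type _} {F G : Set X → Set X}, (∀ Y a, a ∈ F Y ↔ ∃ b ∈ Y, a ∈ F {b}) →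
      (∀ Y a, a ∈ G Y ↔ ∃ b ∈ Y, a ∈ G {b}) →
      ∀ Y a, a ∈ F (G Y) ↔ ∃ b ∈ Y, a ∈ F (G {b}) := by
    intro X F G hF hG Y a
    constructor
    · intro ha
      obtain ⟨b, hb, hab⟩ := (hF _ _).1 ha
      obtain ⟨d, hd, hbd⟩ := (hG _ _).1 hb
      exact ⟨d, hd, (hF _ _).2 ⟨b, hbd, hab⟩⟩
    · rintro ⟨d, hd, ha⟩
      obtain ⟨b, hb, hab⟩ := (hF _ _).1 ha
      exact (hF _ _).2 ⟨b, (hG _ _).2 ⟨d, hd, hb⟩, hab⟩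
  have symm : ∀ i (a b : {a : A // IsAtom a}), (a : A) ≤ o.cyl i b → (b : A) ≤ o.cyl i a := by
    intro i a b hab
    by_contra hba
    have h₁ := (IsAtom.le_compl_iff b.2 _).2 hba
    have h₂ := ho'.cyl_mono i h₁
    rw [ho'.cyl_compl_cyl] at h₂
    exact (IsAtom.le_compl_iff a.2 _).1 (hab.trans h₂) (ho'.le_cyl i a)
  have trans : ∀ i (a b d : {a : A // IsAtom a}), (a : A) ≤ o.cyl i b → (b : A) ≤ o.cyl i d →
      (a : A) ≤ o.cyl i d := by
    intro i a b d hab hbd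
    have := ho'.cyl_mono i hbd
    rw [ho'.cyl_cyl] at this
    exact hab.trans this
  have uniq : ∀ τ (a b d : {a : A // IsAtom a}), (a : A) ≤ o.sub τ (mem_subs_pea τ) b →
      (a : A) ≤ o.sub τ (mem_subs_pea τ) d → b = d := by
    intro τ a b d hab had
    by_contra hbd
    have h₁ : (b : A) ⊓ d = ⊥ := by
      rcases b.2.le_iff.1 (inf_le_left : (b : A) ⊓ d ≤ b) with h | h
      · exact h
      · exact absurd (Subtype.ext ((d.2.le_iff.1 (inf_eq_left.1 h)).resolve_left b.2.1)) hbd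
    have h₂ := le_inf hab had
    rw [← (ho'.sub_endo τ).map_inf, h₁, (ho'.sub_endo τ).map_bot] at h₂
    exact a.2.1 (le_bot_iff.1 h₂)
  have tot : ∀ τ (a : {a : A // IsAtom a}), ∃ b : {a : A // IsAtom a},
      (a : A) ≤ o.sub τ (mem_subs_pea τ) b := by
    intro τ a
    have h₁ : o.sub τ (mem_subs_pea τ) (⊤ : A) = ⊤ := by
      have := (ho'.sub_endo τ).map_compl ⊥
      rwa [(ho'.sub_endo τ).map_bot, compl_bot] at this
    obtain ⟨b, hb, -, hab⟩ := h.sub τ a ⊤ a.2 (by rw [h₁]; exact le_top)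
    exact ⟨⟨b, hb⟩, hab⟩
  change PEAAxioms o.At.Cm.cyl (fun τ => o.At.Cm.sub τ (mem_subs_pea τ)) (o.At.Cm.diag hasDiag_pea)
  refine
    { cyl_bot := fun i => ?_, le_cyl := fun i x a ha => ⟨a, ha, ho'.le_cyl i a⟩
      cyl_inf := fun i x y => ?_, cyl_comm := fun i j => ?_
      sub_endo := fun τ => ⟨fun x y => ?_, fun x => ?_⟩
      sub_id := ?_, sub_comp := fun σ τ => ?_, sub_cyl := fun σ τ i x hστ => ?_
      cyl_sub := fun τ i j x hij => ?_, cyl_sub_of_notMem := fun τ i x hi => ?_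
      diag_self := fun i => ?_, inf_diag_le := fun i j x => ?_
      sub_diag := fun τ i j => ?_ }
  · ext a
    simp [AtomStr.Cm]
  · ext a
    constructor
    · rintro ⟨b, ⟨hb, d, hd, hbd⟩, hab⟩
      exact ⟨⟨b, hb, hab⟩, ⟨d, hd, trans i a b d hab hbd⟩⟩
    · rintro ⟨⟨b, hb, hab⟩, ⟨d, hd, had⟩⟩
      exact ⟨b, ⟨hb, d, hd, trans i b a d (symm i a b hab) had⟩, hab⟩
  · refine additive_ext (comp (addc i) (addc j)) (comp (addc j) (addc i)) fun b => ?_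
    rw [hc, hc, ← hom.map_cyl, ← hom.map_cyl, ho'.cyl_comm]
  · ext a
    simp [AtomStr.Cm, or_and_right, exists_or]
  · ext a
    obtain ⟨b, hab⟩ := tot τ a
    constructor
    · rintro ⟨d, hd, had⟩ ⟨e, he, hae⟩
      rw [uniq τ a d e had hae] at hd
      exact hd he
    · intro ha
      exact ⟨b, fun hb => ha ⟨b, hb, hab⟩, hab⟩
  · refine additive_ext (adds id) (fun Y a => by simp) fun b => ?_
    rw [hs, ho'.sub_id, atomsBelow_atom]
  · refine additive_ext (adds _) (comp (adds σ) (adds τ)) fun b => ?_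
    rw [hs, hs, ← hom.map_sub, ho'.sub_comp]
  · revert x
    refine additive_ext (comp (adds σ) (addc i)) (comp (adds τ) (addc i)) fun b => ?_
    rw [hc, ← hom.map_sub, ← hom.map_sub, ho'.sub_cyl σ τ i _ hστ]
  · revert x
    refine additive_ext (comp (addc i) (adds τ)) (comp (adds τ) (addc j)) fun b => ?_
    rw [hc, hs, ← hom.map_sub, ← hom.map_cyl, ho'.cyl_sub τ i j _ hij]
  · revert x
    refine additive_ext (comp (addc i) (adds τ)) (adds τ) fun b => ?_
    rw [hs, ← hom.map_cyl, ho'.cyl_sub_of_notMem τ i _ hi]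
  · rw [← hom.map_diag hasDiag_pea, ho'.diag_self, map_top]
  · rintro a ⟨ha, hd : (a : A) ≤ o.diag hasDiag_pea i j⟩
    exact ⟨a, ha, (le_inf le_rfl hd).trans (ho'.inf_diag_le i j _)⟩
  · rw [← hom.map_diag hasDiag_pea, ← hom.map_sub, ← hom.map_diag hasDiag_pea, ho'.sub_diag]

/-- The term algebra of the atom structure of an atomic algebra embeds in the algebra. -/
theorem exists_tm_hom [IsAtomic A] (hom : o.IsHom o.At.Cm (atomsBelow A)) :
    ∃ f : BoundedLatticeHom o.At.tm A, Function.Injective f ∧ o.At.Tm.IsHom o f := by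
  -- The image of the algebra is a subalgebra of the complex algebra that contains the singletons,
  -- so it contains the term algebra.
  have hle : ∀ Y ∈ o.At.tm, ∃ x, atomsBelow A x = Y := by
    let L : BooleanSubalgebra (Set {a : A // IsAtom a}) :=
      { carrier := Set.range (atomsBelow A)
        supClosed' := by
          rintro _ ⟨x, rfl⟩ _ ⟨y, rfl⟩
          exact ⟨x ⊔ y, map_sup _ _ _⟩
        infClosed' := by
          rintro _ ⟨x, rfl⟩ _ ⟨y, rfl⟩
          exact ⟨x ⊓ y, map_inf _ _ _⟩
        compl_mem' := by
          rintro _ ⟨x, rfl⟩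
          exact ⟨xᶜ, map_compl' _ _⟩
        bot_mem' := ⟨⊥, map_bot _⟩ }
    have hL : o.At.Cm.IsSubalgebra L :=
      { cyl_mem := by
          rintro i _ ⟨x, rfl⟩
          exact ⟨_, hom.map_cyl i x⟩
        sub_mem := by
          rintro τ hτ _ ⟨x, rfl⟩
          exact ⟨_, hom.map_sub τ hτ x⟩
        diag_mem := fun h i j => ⟨_, hom.map_diag h i j⟩ }
    intro Y hY
    exact BooleanSubalgebra.mem_sInf.1 hY L ⟨hL, fun a => ⟨a, atomsBelow_atom a⟩⟩
  choose g hg using hle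
  have inj := atomsBelow_injective (A := A)
  refine ⟨⟨⟨⟨fun Y => g Y.1 Y.2, fun Y Z => inj ?_⟩, fun Y Z => inj ?_⟩, inj ?_, inj ?_⟩,
    fun Y Z h => ?_, fun i Y => inj ?_, fun τ h Y => inj ?_, fun h i j => inj ?_⟩
  · rw [map_sup, hg, hg, hg]; rfl
  · change atomsBelow A (g _ _) = atomsBelow A (g _ _ ⊓ g _ _)
    rw [map_inf, hg, hg, hg]; rfl
  · change atomsBelow A (g _ _) = _
    rw [map_top, hg]; rfl
  · change atomsBelow A (g _ _) = _
    rw [map_bot, hg]; rfl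
  · have h' := congrArg (atomsBelow A) (show g Y.1 Y.2 = g Z.1 Z.2 from h)
    rw [hg, hg] at h'
    exact Subtype.ext h'
  · change atomsBelow A (g _ _) = atomsBelow A (o.cyl i (g _ _))
    rw [hom.map_cyl, hg, hg]; rfl
  · change atomsBelow A (g _ _) = atomsBelow A (o.sub τ h (g _ _))
    rw [hom.map_sub, hg, hg]; rfl
  · change atomsBelow A (g _ _) = atomsBelow A (o.diag h i j)
    rw [hom.map_diag, hg]; rfl

end

/-! ### The algebra of a sequence of equivalences of tuples -/

/-- A sequence of finer and finer equivalences of tuples, with a dense set of tuples that are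
isolated, and an equivalence with finitely many classes that is coarser on these tuples. -/
structure Blur (n : ℕ) (V : Type) where
  E : ℕ → (Fin n → V) → (Fin n → V) → Prop
  W : Set (Fin n → V)
  C : (Fin n → V) → (Fin n → V) → Prop
  refl : ∀ N s, E N s s
  symm : ∀ {N s s'}, E N s s' → E N s' s
  trans : ∀ {N s s' s''}, E N s s' → E N s' s'' → E N s s''
  mono : ∀ {N N' s s'}, N ≤ N' → E N' s s' → E N s s'
  eq_iff : ∀ {N s s'}, E N s s' → ∀ i j, s i = s j ↔ s' i = s' j
  comp : ∀ {N s s'}, E N s s' → ∀ τ : Fin n → Fin n, E N (s ∘ τ) (s' ∘ τ)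
  update : ∀ {N s s'}, E N s s' → ∀ i u, ∃ u', E N (Function.update s i u) (Function.update s' i u')
  update_mem : ∀ {N s s'}, E N s s' → s' ∈ W → ∀ i u, ∃ u',
    E N (Function.update s i u) (Function.update s' i u') ∧ Function.update s' i u' ∈ W
  const_mem : ∀ u, (fun _ => u) ∈ W
  comp_mem : ∀ {s}, s ∈ W → ∀ τ : Fin n → Fin n, s ∘ τ ∈ W
  isolated : ∀ {s}, s ∈ W → ∃ N, ∀ s', E N s s' → s' ∈ W ∧ C s s' ∧ ∀ N', E N' s s'
  class_symm : ∀ {s s'}, C s s' → C s' s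
  class_eq_iff : ∀ {s s'}, C s s' → ∀ i j, s i = s j ↔ s' i = s' j
  class_comp : ∀ {s s'}, C s s' → ∀ τ : Fin n → Fin n, C (s ∘ τ) (s' ∘ τ)
  class_update : ∀ {s s'}, C s s' → s' ∈ W → ∀ i u, Function.update s i u ∈ W → ∃ u',
    C (Function.update s i u) (Function.update s' i u') ∧ Function.update s' i u' ∈ W
  finite_class : ∃ (Θ : Type) (_ : Finite Θ) (t : (Fin n → V) → Θ), ∀ s s', t s = t s' → C s s'

namespace Blur

variable {n : ℕ} {V : Type} (B : Blur n V)

/-- The algebra of the sets of tuples that are closed under one of the equivalences. -/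
def alg : BooleanSubalgebra (Set (Fin n → V)) where
  carrier := {Z | ∃ N, ∀ s s', B.E N s s' → s ∈ Z → s' ∈ Z}
  supClosed' := by
    rintro Z ⟨N, hZ⟩ Z' ⟨N', hZ'⟩
    exact ⟨max N N', fun s s' h => Or.imp (hZ s s' (B.mono (le_max_left _ _) h))
      (hZ' s s' (B.mono (le_max_right _ _) h))⟩
  infClosed' := by
    rintro Z ⟨N, hZ⟩ Z' ⟨N', hZ'⟩
    exact ⟨max N N', fun s s' h => And.imp (hZ s s' (B.mono (le_max_left _ _) h))
      (hZ' s s' (B.mono (le_max_right _ _) h))⟩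
  compl_mem' := by
    rintro Z ⟨N, hZ⟩
    exact ⟨N, fun s s' h hs hs' => hs (hZ s' s (B.symm h) hs')⟩
  bot_mem' := ⟨0, fun _ _ _ h => h⟩

theorem isSubalgebra_alg : (fullSetAlg .PEA n V).IsSubalgebra B.alg where
  cyl_mem i Z := by
    rintro ⟨N, hZ⟩
    refine ⟨N, fun s s' h => ?_⟩
    rintro ⟨u, hu⟩
    obtain ⟨u', hu'⟩ := B.update h i u
    exact ⟨u', hZ _ _ hu' hu⟩
  sub_mem τ _ Z := by
    rintro ⟨N, hZ⟩
    exact ⟨N, fun s s' h hs => hZ _ _ (B.comp h τ) hs⟩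
  diag_mem _ i j := ⟨0, fun s s' h hs => (B.eq_iff h i j).1 hs⟩

/-- The operations of the algebra. -/
def ops : Ops .PEA n B.alg := (fullSetAlg .PEA n V).restrict B.isSubalgebra_alg

theorem isModel_ops : B.ops.IsModel := by
  have h := peaAxioms_fullSetAlg (n := n) V
  change PEAAxioms B.ops.cyl (fun τ => B.ops.sub τ trivial) (B.ops.diag trivial)
  exact
    { cyl_bot := fun i => Subtype.ext (h.cyl_bot i)
      le_cyl := fun i x => h.le_cyl i x.1
      cyl_inf := fun i x y => Subtype.ext (h.cyl_inf i x.1 y.1)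
      cyl_comm := fun i j x => Subtype.ext (h.cyl_comm i j x.1)
      sub_endo := fun τ => ⟨fun x y => Subtype.ext ((h.sub_endo τ).map_sup x.1 y.1),
        fun x => Subtype.ext ((h.sub_endo τ).map_compl x.1)⟩
      sub_id := fun x => Subtype.ext (h.sub_id x.1)
      sub_comp := fun σ τ x => Subtype.ext (h.sub_comp σ τ x.1)
      sub_cyl := fun σ τ i x hi => Subtype.ext (h.sub_cyl σ τ i x.1 hi)
      cyl_sub := fun τ i j x hi => Subtype.ext (h.cyl_sub τ i j x.1 hi)
      cyl_sub_of_notMem := fun τ i x hi => Subtype.ext (h.cyl_sub_of_notMem τ i x.1 hi)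
      diag_self := fun i => Subtype.ext (h.diag_self i)
      inf_diag_le := fun i j x => h.inf_diag_le i j x.1
      sub_diag := fun τ i j => Subtype.ext (h.sub_diag τ i j) }

/-- The set of tuples that are equivalent to `s`. -/
def cell (s : B.W) : B.alg :=
  ⟨{s' | ∀ N, B.E N s s'}, by
    obtain ⟨N, hN⟩ := B.isolated s.2
    exact ⟨N, fun s₁ s₂ h h₁ => (hN s₂ (B.trans (h₁ N) h)).2.2⟩⟩

theorem cell_le_iff (s : B.W) (Z : B.alg) : B.cell s ≤ Z ↔ (s : Fin n → V) ∈ (Z : Set _) := by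
  constructor
  · intro h
    exact h fun N => B.refl N _
  · intro hs s' hs'
    obtain ⟨N, hN⟩ := Z.2
    exact hN _ _ (hs' N) hs

theorem isAtom_cell (s : B.W) : IsAtom (B.cell s) := by
  refine ⟨fun h => ?_, fun Z hZ => ?_⟩
  · have : (s : Fin n → V) ∈ (B.cell s : Set (Fin n → V)) := fun N => B.refl N _
    rw [h] at this
    exact this
  · by_contra hne
    obtain ⟨s', hs'⟩ : (Z : Set (Fin n → V)).Nonempty := by
      rw [Set.nonempty_iff_ne_empty]
      exact fun h => hne (Subtype.ext h)
    have h₁ : s' ∈ (B.cell s : Set (Fin n → V)) := hZ.le hs'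
    refine hZ.not_ge ((B.cell_le_iff s Z).2 ?_)
    obtain ⟨N, hN⟩ := Z.2
    exact hN _ _ (B.symm (h₁ N)) hs'

/-- The atom of the tuple `s`. -/
def atom (s : B.W) : {a : B.alg // IsAtom a} := ⟨B.cell s, B.isAtom_cell s⟩

/-- Density of `W`: starting from a constant tuple, the entries of `s` are introduced one at a time,
each step being answered inside `W`. -/
theorem exists_mem_equiv (hn : 0 < n) (N : ℕ) (s : Fin n → V) : ∃ s' ∈ B.W, B.E N s s' := by
  classical
  have key : ∀ A : Finset (Fin n), ∃ s' ∈ B.W,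
      B.E N (fun i => if i ∈ A then s i else s ⟨0, hn⟩) s' := by
    intro A
    induction A using Finset.induction_on with
    | empty => exact ⟨_, B.const_mem (s ⟨0, hn⟩), by simpa using B.refl N _⟩
    | insert i A hi ih =>
      obtain ⟨s', hs', h⟩ := ih
      obtain ⟨u, hu, hu'⟩ := B.update_mem h hs' i (s i)
      refine ⟨_, hu', ?_⟩
      convert hu using 1
      funext j
      by_cases hj : j = i
      · subst hj; simp
      · simp [hj]
  simpa using key Finset.univ

theorem exists_atom_le (hn : 0 < n) {Z : B.alg} {s : Fin n → V} (hs : s ∈ (Z : Set (Fin n → V))) :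
    ∃ s' : B.W, B.cell s' ≤ Z := by
  obtain ⟨N, hN⟩ := Z.2
  obtain ⟨s', hs', h⟩ := B.exists_mem_equiv hn N s
  exact ⟨⟨s', hs'⟩, (B.cell_le_iff _ _).2 (hN _ _ h hs)⟩

theorem exists_mem_of_ne_bot {Z : B.alg} (hZ : Z ≠ ⊥) : ∃ s, s ∈ (Z : Set (Fin n → V)) := by
  by_contra! h
  exact hZ (Subtype.ext (Set.eq_empty_of_forall_notMem h))

theorem isAtomic (hn : 0 < n) : IsAtomic B.alg where
  eq_bot_or_exists_atom_le Z := by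
    by_cases hZ : Z = ⊥
    · exact .inl hZ
    · obtain ⟨s, hs⟩ := B.exists_mem_of_ne_bot hZ
      obtain ⟨s', h⟩ := B.exists_atom_le hn hs
      exact .inr ⟨_, B.isAtom_cell s', h⟩

theorem exists_eq_atom (hn : 0 < n) (a : {a : B.alg // IsAtom a}) : ∃ s, a = B.atom s := by
  obtain ⟨s, hs⟩ := B.exists_mem_of_ne_bot a.2.1
  obtain ⟨s', h⟩ := B.exists_atom_le hn hs
  exact ⟨s', Subtype.ext ((a.2.le_iff.1 h).resolve_left (B.isAtom_cell s').1).symm⟩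

theorem atom_eq_of_mem {s : B.W} {s' : Fin n → V} (h : s' ∈ (B.cell s : Set (Fin n → V))) :
    ∃ hs' : s' ∈ B.W, B.atom ⟨s', hs'⟩ = B.atom s := by
  obtain ⟨N, hN⟩ := B.isolated s.2
  refine ⟨(hN s' (h N)).1, Subtype.ext ?_⟩
  have := ((B.isAtom_cell s).le_iff.1 ((B.cell_le_iff ⟨s', (hN s' (h N)).1⟩ _).2 h))
  exact this.resolve_left (B.isAtom_cell _).1

theorem class_of_atom_eq {s s' : B.W} (h : B.atom s = B.atom s') : B.C s s' := by
  have h₁ : (s' : Fin n → V) ∈ (B.cell s : Set (Fin n → V)) :=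
    (B.cell_le_iff s' _).1 (congrArg Subtype.val h).ge
  obtain ⟨N, hN⟩ := B.isolated s.2
  exact (hN _ (h₁ N)).2.1

/-- Tuples outside `W` may lie in no atom, yet additivity survives: a witness of a cylindrification
at a tuple of `W` can be replaced by an equivalent one in `W`, with equivalence fine enough not to
leave `Z`. -/
theorem atomAdditive_ops (hn : 0 < n) : B.ops.AtomAdditive where
  cyl i a Z ha h := by
    obtain ⟨s, hs⟩ := B.exists_eq_atom hn ⟨a, ha⟩
    obtain rfl : a = B.cell s := congrArg Subtype.val hs
    obtain ⟨u, hu⟩ := (B.cell_le_iff s _).1 h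
    obtain ⟨N, hN⟩ := Z.2
    obtain ⟨u', hu', hW⟩ := B.update_mem (B.refl N (s : Fin n → V)) s.2 i u
    refine ⟨B.cell ⟨_, hW⟩, B.isAtom_cell _, (B.cell_le_iff _ _).2 (hN _ _ hu' hu),
      (B.cell_le_iff s _).2 ⟨u', fun N => B.refl N _⟩⟩
  sub τ a Z ha h := by
    obtain ⟨s, hs⟩ := B.exists_eq_atom hn ⟨a, ha⟩
    obtain rfl : a = B.cell s := congrArg Subtype.val hs
    have h₁ : (s : Fin n → V) ∘ τ ∈ (Z : Set (Fin n → V)) := (B.cell_le_iff s _).1 h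
    exact ⟨B.cell ⟨_, B.comp_mem s.2 τ⟩, B.isAtom_cell _, (B.cell_le_iff _ _).2 h₁,
      (B.cell_le_iff s _).2 fun N => B.refl N _⟩

theorem atom_mem_cyl (hn : 0 < n) {s : B.W} {i : Fin n} {Y : Set {a : B.alg // IsAtom a}} :
    B.atom s ∈ B.ops.At.Cm.cyl i Y ↔
      ∃ u, ∃ hu : Function.update (s : Fin n → V) i u ∈ B.W, B.atom ⟨_, hu⟩ ∈ Y := by
  constructor
  · rintro ⟨b, hb, hle⟩
    obtain ⟨s', rfl⟩ := B.exists_eq_atom hn b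
    obtain ⟨u, hu⟩ := (B.cell_le_iff s _).1 hle
    obtain ⟨hW, h⟩ := B.atom_eq_of_mem hu
    exact ⟨u, hW, by rwa [h]⟩
  · rintro ⟨u, hu, h⟩
    exact ⟨_, h, (B.cell_le_iff s _).2 ⟨u, fun N => B.refl N _⟩⟩

theorem atom_mem_sub (hn : 0 < n) {s : B.W} {τ : Fin n → Fin n} (hτ : τ ∈ Kind.PEA.subs n)
    {Y : Set {a : B.alg // IsAtom a}} :
    B.atom s ∈ B.ops.At.Cm.sub τ hτ Y ↔ B.atom ⟨_, B.comp_mem s.2 τ⟩ ∈ Y := by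
  constructor
  · rintro ⟨b, hb, hle⟩
    obtain ⟨s', rfl⟩ := B.exists_eq_atom hn b
    have h₁ : (s : Fin n → V) ∘ τ ∈ (B.cell s' : Set (Fin n → V)) :=
      (B.cell_le_iff s (B.ops.sub τ hτ (B.cell s'))).1 hle
    obtain ⟨hW, h⟩ := B.atom_eq_of_mem h₁
    rwa [← h] at hb
  · intro h
    exact ⟨_, h, (B.cell_le_iff s _).2 fun N => B.refl N _⟩

theorem atom_mem_diag {s : B.W} {i j : Fin n} (h : Kind.PEA.HasDiag) :
    B.atom s ∈ B.ops.At.Cm.diag h i j ↔ (s : Fin n → V) i = (s : Fin n → V) j :=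
  B.cell_le_iff s _

/-! ### The finite subalgebra of the complex algebra -/

/-- The algebra of the sets of atoms that are closed under the coarser equivalence. -/
def classAlg : BooleanSubalgebra (Set {a : B.alg // IsAtom a}) where
  carrier := {Y | ∀ s s' : B.W, B.C s s' → B.atom s ∈ Y → B.atom s' ∈ Y}
  supClosed' := fun _ hY _ hY' s s' h => Or.imp (hY s s' h) (hY' s s' h)
  infClosed' := fun _ hY _ hY' s s' h => And.imp (hY s s' h) (hY' s s' h)
  compl_mem' := fun hY s s' h hs hs' => hs (hY s' s (B.class_symm h) hs')
  bot_mem' := fun _ _ _ h => h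

theorem isSubalgebra_classAlg (hn : 0 < n) : B.ops.At.Cm.IsSubalgebra B.classAlg where
  cyl_mem i Y hY s s' h hs := by
    obtain ⟨u, hu, hY'⟩ := (B.atom_mem_cyl hn).1 hs
    obtain ⟨u', h', hu'⟩ := B.class_update h s'.2 i u hu
    exact (B.atom_mem_cyl hn).2 ⟨u', hu', hY ⟨_, hu⟩ ⟨_, hu'⟩ h' hY'⟩
  sub_mem τ hτ Y hY s s' h hs := by
    rw [B.atom_mem_sub hn hτ] at hs ⊢
    exact hY _ _ (B.class_comp h τ) hs
  diag_mem hd i j s s' h hs := by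
    rw [B.atom_mem_diag] at hs ⊢
    exact (B.class_eq_iff h i j).1 hs

theorem finite_classAlg (hn : 0 < n) : Finite B.classAlg := by
  obtain ⟨Θ, _, t, ht⟩ := B.finite_class
  refine Finite.of_injective
    (fun Y : B.classAlg => {θ : Θ | ∃ s : B.W, t s = θ ∧ B.atom s ∈ (Y : Set _)}) ?_
  have key : ∀ Y Y' : B.classAlg, {θ : Θ | ∃ s : B.W, t s = θ ∧ B.atom s ∈ (Y : Set _)} =
      {θ : Θ | ∃ s : B.W, t s = θ ∧ B.atom s ∈ (Y' : Set _)} → Y ≤ Y' := by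
    intro Y Y' h a ha
    obtain ⟨s, rfl⟩ := B.exists_eq_atom hn a
    have : t s ∈ {θ : Θ | ∃ s : B.W, t s = θ ∧ B.atom s ∈ (Y : Set _)} := ⟨s, rfl, ha⟩
    rw [h] at this
    obtain ⟨s', hs', h'⟩ := this
    exact Y'.2 s' s (ht _ _ hs') h'
  exact fun Y Y' h => le_antisymm (key Y Y' h) (key Y' Y h.symm)

/-! ### Neat embeddings and representability -/

/-- The algebra embeds in the neat reduct of a full set algebra. -/
theorem sNr_alg (hn : 0 < n) (K : Kind) {m : ℕ} (h : n ≤ m) : SNr K h B.alg (B.ops.rd K) := by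
  refine ⟨Set (Fin m → V), inferInstance, fullSetAlg K m V, isModel_fullSetAlg V K,
    ⟨⟨⟨fun Z => {s | s ∘ Fin.castLE h ∈ (Z : Set (Fin n → V))}, fun _ _ => rfl⟩,
      fun _ _ => rfl⟩, rfl, rfl⟩, ?_, ⟨?_, ?_, ?_⟩, ?_⟩
  · have key : ∀ s : Fin n → V, ∃ s' : Fin m → V, s' ∘ Fin.castLE h = s := fun s =>
      ⟨fun i => if hi : (i : ℕ) < n then s ⟨i, hi⟩ else s ⟨0, hn⟩, by funext i; simp⟩
    intro Z Z' hZ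
    refine Subtype.ext (Set.ext fun s => ?_)
    obtain ⟨s', rfl⟩ := key s
    exact Set.ext_iff.1 hZ s'
  · intro i Z
    ext s
    refine exists_congr fun u => ?_
    change _ ↔ Function.update s (Fin.castLE h i) u ∘ Fin.castLE h ∈ (Z : Set (Fin n → V))
    rw [Function.update_comp_eq_of_injective _ (Fin.castLE_injective h)]
  · intro τ hτ Z
    ext s
    change (s ∘ Fin.castLE h) ∘ τ ∈ (Z : Set (Fin n → V)) ↔
      (s ∘ liftMap h τ) ∘ Fin.castLE h ∈ (Z : Set (Fin n → V))
    have : (s ∘ liftMap h τ) ∘ Fin.castLE h = (s ∘ Fin.castLE h) ∘ τ := by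
      funext i
      simp [liftMap]
    rw [this]
  · intro hd i j
    rfl
  · intro Z i hi
    ext s
    have : ∀ u, Function.update s i u ∘ Fin.castLE h = s ∘ Fin.castLE h := fun u => by
      funext j
      have : Fin.castLE h j ≠ i := by
        rintro rfl
        exact absurd j.2 (not_lt.2 hi)
      simp [this]
    change (∃ u, Function.update s i u ∘ Fin.castLE h ∈ (Z : Set (Fin n → V))) ↔
      s ∘ Fin.castLE h ∈ (Z : Set (Fin n → V))
    simp only [this]
    exact ⟨fun ⟨_, h⟩ => h, fun hs => ⟨s i, hs⟩⟩

/-- The inclusion of the algebra in a power of the full set algebra with one factor. -/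
def inclusion : BoundedLatticeHom B.alg (Unit → Set (Fin n → V)) where
  toFun Z _ := Z
  map_sup' _ _ := rfl
  map_inf' _ _ := rfl
  map_top' := rfl
  map_bot' := rfl

theorem isHom_inclusion : B.ops.IsHom (Ops.pi fun _ => fullSetAlg .PEA n V) B.inclusion where
  map_cyl _ _ := rfl
  map_sub _ _ _ := rfl
  map_diag _ _ _ := rfl

theorem representable_tm (hn : 0 < n) : Representable B.ops.At.tm B.ops.At.Tm := by
  have := B.isAtomic hn
  have h : PEAAxioms B.ops.cyl (fun τ => B.ops.sub τ (mem_subs_pea τ)) (B.ops.diag hasDiag_pea) :=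
    B.isModel_ops
  obtain ⟨f, hf, hom⟩ := exists_tm_hom
    (isHom_atomsBelow (B.atomAdditive_ops hn) h.cyl_mono fun τ => (h.sub_endo τ).mono)
  refine ⟨Unit, fun _ => V, B.inclusion.comp f, fun Y Z hYZ => hf (Subtype.ext (congrFun hYZ ())),
    fun i Y => ?_, fun τ hτ Y => ?_, fun hd i j => ?_⟩
  · rw [BoundedLatticeHom.comp_apply, hom.map_cyl, B.isHom_inclusion.map_cyl]; rfl
  · rw [BoundedLatticeHom.comp_apply, hom.map_sub, B.isHom_inclusion.map_sub]; rfl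
  · rw [BoundedLatticeHom.comp_apply, hom.map_diag, B.isHom_inclusion.map_diag]

end Blur

/-! ### The algebra of the coloured graph -/

theorem lab_comp {R S : Type} {srt : ℕ → Srt} {c : ℕ → ℕ → Col Red} {f : Red → R} (g : R → S)
    {p q p' q' : ℕ} (h : lab srt c f p q = lab srt c f p' q') :
    lab srt c (g ∘ f) p q = lab srt c (g ∘ f) p' q' := by
  have key : ∀ c : Col Red, c.map (g ∘ f) = (c.map f).map g := fun c => by cases c <;> rfl
  simp only [lab, Prod.mk.injEq] at h ⊢
  rw [key, key, h.2.2.2]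
  exact ⟨h.1, h.2.1, h.2.2.1, rfl⟩

theorem Eqv.map {R S : Type} {n m : ℕ} {srt : ℕ → Srt} {c : ℕ → ℕ → Col Red}
    {P : ℕ → (Fin m → ℕ) → ℕ} {f : Red → R} (g : R → S) {s s' : Fin n → ℕ}
    (h : Eqv srt c P f s s') : Eqv srt c P (g ∘ f) s s' :=
  ⟨h.eq_iff, fun κ i j hi hj => lab_comp g (h.lab_eq κ i j hi hj)⟩

theorem Red.trunc_comp {N N' : ℕ} (h : N ≤ N') : Red.trunc N ∘ Red.trunc N' = Red.trunc N := by
  funext r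
  match r with
  | none => rfl
  | some (l, x) =>
    by_cases h₁ : l < N'
    · simp [Red.trunc, h₁]
    · have : ¬ l < N := fun h₂ => h₁ (h₂.trans_le h)
      simp [Red.trunc, h₁, this]

/-- The index of a red colour. -/
def Col.index : Col Red → ℕ
  | .red (some (l, _)) => l
  | _ => 0

theorem Col.eq_of_map_trunc {N : ℕ} {c c' : Col Red} (hc : c.All (· ≠ none)) (hN : c.index < N)
    (h : c.map (Red.trunc N) = c'.map (Red.trunc N)) : c = c' := by
  match c, c', h with
  | .nil, .nil, _ => rfl
  | .gr, .gr, _ => rfl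
  | .wh _, .wh _, h => simpa [Col.map] using h
  | .st _, .st _, h => simpa [Col.map] using h
  | .red none, _, _ => exact absurd rfl (hc none rfl)
  | .red (some (l, x)), .red none, h =>
    have hl : l < N := hN
    simp [Col.map, Red.trunc, hl] at h
  | .red (some (l, x)), .red (some (l', x')), h =>
    have hl : l < N := hN
    by_cases hl' : l' < N
    · simpa [Col.map, Red.trunc, hl, hl'] using h
    · simp [Col.map, Red.trunc, hl, hl'] at h

section

variable {n m : ℕ} {srt : ℕ → Srt} {c : ℕ → ℕ → Col Red} {P : ℕ → (Fin m → ℕ) → ℕ}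

/-- A tuple shows finitely many red colours. Truncation above all their levels determines every
visible colour exactly. -/
theorem VisAll.exists_isolated {s : Fin n → ℕ} (hs : VisAll c P (· ≠ none) s) :
    ∃ N, ∀ s', Eqv srt c P (Red.trunc N) s s' → VisAll c P (· ≠ none) s' ∧
      ∀ {R : Type} (f : Red → R), Eqv srt c P f s s' := by
  set N := Finset.univ.sup (fun t : (Fin m → Fin n) × Fin n × Fin n =>
    (c (node P s t.1 t.2.1) (node P s t.1 t.2.2)).index) with hN
  refine ⟨N + 1, fun s' e => ?_⟩
  have key : ∀ κ i j, Vis s κ i → Vis s κ j →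
      c (node P s κ i) (node P s κ j) = c (node P s' κ i) (node P s' κ j) := by
    intro κ i j hi hj
    have h := e.lab_eq κ i j hi hj
    simp only [lab, Prod.mk.injEq] at h
    refine Col.eq_of_map_trunc (hs κ i j hi hj) (Nat.lt_succ_of_le ?_) h.2.2.2
    exact Finset.le_sup (f := fun t : (Fin m → Fin n) × Fin n × Fin n =>
      (c (node P s t.1 t.2.1) (node P s t.1 t.2.2)).index) (Finset.mem_univ (κ, i, j))
  refine ⟨fun κ i j hi hj => ?_, fun f => ⟨e.eq_iff, fun κ i j hi hj => ?_⟩⟩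
  · have e' := fun i j => (e.eq_iff i j).symm
    rw [← key κ i j (hi.congr e') (hj.congr e')]
    exact hs κ i j (hi.congr e') (hj.congr e')
  · have h := e.lab_eq κ i j hi hj
    simp only [lab, Prod.mk.injEq] at h ⊢
    rw [key κ i j hi hj]
    exact ⟨h.1, h.2.1, h.2.2.1, rfl⟩

theorem Col.all_true (c : Col Red) : c.All fun _ => True := fun _ _ => trivial

open Classical in
theorem exists_finite_class : ∃ (Θ : Type) (_ : Finite Θ) (t : (Fin n → ℕ) → Θ),
    ∀ s s', t s = t s' → Eqv srt c P (Option.map Prod.snd) s s' := by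
  refine ⟨(Fin n → Fin n → Prop) × ((Fin m → Fin n) → Fin n → Fin n →
    Option (Srt × Srt × Prop × Col (Option Bool))), inferInstance, fun s =>
    (fun i j => s i = s j, fun κ i j => if Vis s κ i ∧ Vis s κ j then
      some (lab srt c (Option.map Prod.snd) (node P s κ i) (node P s κ j)) else none),
    fun s s' h => ?_⟩
  rw [Prod.mk.injEq] at h
  have e : ∀ i j, s i = s j ↔ s' i = s' j := fun i j => (congrFun (congrFun h.1 i) j).to_iff
  refine ⟨e, fun κ i j hi hj => ?_⟩
  have := congrFun (congrFun (congrFun h.2 κ) i) j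
  rw [if_pos ⟨hi, hj⟩, if_pos ⟨hi.congr e, hj.congr e⟩, Option.some.injEq] at this
  exact this

/-- The equivalences of tuples given by a coloured graph with parameters. -/
def Rich.blur (h : Rich srt c) (hP : Generic P) (hm : m + 3 = n) : Blur n ℕ where
  E N := Eqv srt c P (Red.trunc N)
  W := {s | VisAll c P (· ≠ none) s}
  C := Eqv srt c P (Option.map Prod.snd)
  refl N s := Eqv.refl s
  symm := Eqv.symm
  trans := Eqv.trans
  mono hN e := by
    rw [← Red.trunc_comp hN]
    exact e.map _
  eq_iff := Eqv.eq_iff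
  comp := Eqv.comp
  update {N s s'} e i u := by
    obtain ⟨u', hu', -⟩ := e.exists_update h (lifts_trunc N (fun _ => True) (G' := fun _ => True)
      fun _ => trivial) hP hm i u (fun _ _ _ _ _ => Col.all_true _)
      (fun _ _ _ _ _ => Col.all_true _)
    exact ⟨u', hu'⟩
  -- Lifting into the indices other than `none` trades limit colours for colours of level at least
  -- `N`.
  update_mem {N s s'} e hs' i u := e.exists_update h (lifts_trunc N (fun _ => True)
    (fun x => Option.some_ne_none x)) hP hm i u (fun _ _ _ _ _ => Col.all_true _) hs'
  const_mem u κ i j hi hj r hr := by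
    have : node P (fun _ => u) κ i = node P (fun _ => u) κ j := rfl
    rw [this, h.self] at hr
    cases hr
  comp_mem := VisAll.comp
  isolated hs := by
    obtain ⟨N, hN⟩ := VisAll.exists_isolated hs
    exact ⟨N, fun s' e => ⟨(hN s' e).1, (hN s' e).2 _, fun _ => (hN s' e).2 _⟩⟩
  class_symm := Eqv.symm
  class_eq_iff := Eqv.eq_iff
  class_comp := Eqv.comp
  class_update e hs' i u hu := e.exists_update h lifts_class hP hm i u hu hs'
  finite_class := exists_finite_class

end

/-! ### An inconsistency in substitution algebras -/

namespace ScAxioms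

variable {m : ℕ} {A : Type*} [BooleanAlgebra A] {c : Fin m → A → A} {s : Fin m → Fin m → A → A}

theorem sub_eq_self (h : ScAxioms c s) {i : Fin m} {x : A} (hx : c i x = x) (j : Fin m) :
    s i j x = x := by
  rw [← hx, h.sub_cyl_same]

theorem cyl_sub_eq (h : ScAxioms c s) {i j k : Fin m} {x : A} (hki : k ≠ i) (hkj : k ≠ j)
    (hx : c k x = x) : c k (s i j x) = s i j x := by
  rw [← h.sub_cyl i j k x hki hkj, hx]

/-- Renaming a variable in two steps or in one. -/
theorem sub_sub_eq (h : ScAxioms c s) {l i j : Fin m} {x : A} (hlj : l ≠ j) (hli : l ≠ i)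
    (hx : c l x = x) : s l i (s j l x) = s j i x := by
  rw [h.sub_sub, h.sub_eq_self (h.cyl_sub_eq hlj hli hx)]

end ScAxioms

/-- A system of elements `e x y q` that express that the entries `x` and `y` are joined by an edge
with the label `q`. -/
structure EdgeSystem {m : ℕ} {A ι : Type*} [BooleanAlgebra A] (c : Fin m → A → A)
    (s : Fin m → Fin m → A → A) (p : Fin 3 → Fin m) (t : Fin 4 → Fin m)
    (e : Fin 3 → Fin 3 → ι → A) : Prop extends ScAxioms c s where
  p_inj : Function.Injective p
  t_inj : Function.Injective t
  p_ne_t : ∀ x i, p x ≠ t i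
  cyl_e : ∀ x y z q, z ≠ x → z ≠ y → c (p z) (e x y q) = e x y q
  sub_e_left : ∀ x y z q, z ≠ x → z ≠ y → x ≠ y → s (p x) (p z) (e x y q) = e z y q
  sub_e_right : ∀ x y z q, z ≠ x → z ≠ y → x ≠ y → s (p y) (p z) (e x y q) = e x z q

namespace EdgeSystem

variable {m : ℕ} {A ι : Type*} [BooleanAlgebra A] {c : Fin m → A → A} {s : Fin m → Fin m → A → A}
  {p : Fin 3 → Fin m} {t : Fin 4 → Fin m} {e : Fin 3 → Fin 3 → ι → A}

theorem p_ne (h : EdgeSystem c s p t e) {x y : Fin 3} (hxy : x ≠ y) : p x ≠ p y :=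
  fun hp => hxy (h.p_inj hp)

/-- The edge between the `i`-th and the `j`-th apex has the label `q`. -/
def edge (s : Fin m → Fin m → A → A) (p : Fin 3 → Fin m) (t : Fin 4 → Fin m)
    (e : Fin 3 → Fin 3 → ι → A) (i j : Fin 4) (q : ι) : A :=
  s (p 1) (t i) (s (p 2) (t j) (e 1 2 q))

/-- Which two of the three coordinates carry the edge before it is moved to the apexes is
irrelevant: renaming `p 1` to `p 0` and then to `t i` is renaming `p 1` to `t i`. -/
theorem edge_eq₀₂ (h : EdgeSystem c s p t e) {i j : Fin 4} (q : ι) :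
    s (p 0) (t i) (s (p 2) (t j) (e 0 2 q)) = edge s p t e i j q := by
  have h₁ : [p 2, t j, p 1, p 0].Nodup := by
    simp [h.p_ne, h.p_ne_t, (h.p_ne_t _ _).symm]
  rw [← h.sub_e_left 1 2 0 q (by decide) (by decide) (by decide), h.sub_comm _ _ _ _ _ h₁,
    h.sub_sub_eq (h.p_ne (by decide)) (h.p_ne_t _ _), edge]
  exact h.cyl_sub_eq (h.p_ne (by decide)) (h.p_ne_t _ _) (h.cyl_e _ _ _ _ (by decide) (by decide))

theorem edge_eq₀₁ (h : EdgeSystem c s p t e) {i j : Fin 4} (q : ι) :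
    s (p 0) (t i) (s (p 1) (t j) (e 0 1 q)) = edge s p t e i j q := by
  rw [← h.edge_eq₀₂, ← h.sub_e_right 0 1 2 q (by decide) (by decide) (by decide),
    h.sub_sub_eq (h.p_ne (by decide)) (h.p_ne_t _ _) (h.cyl_e _ _ _ _ (by decide) (by decide))]

/-- The substitution that moves the entries to three apexes. -/
theorem triangle_eq_bot (h : EdgeSystem c s p t e) {i j k : Fin 4} {q₁ q₂ q₃ : ι}
    (hq : e 0 1 q₁ ⊓ e 0 2 q₂ ⊓ e 1 2 q₃ = ⊥) :
    edge s p t e i j q₁ ⊓ edge s p t e i k q₂ ⊓ edge s p t e j k q₃ = ⊥ := by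
  -- All three edges are written with the same three substitutions, the one at the coordinate an
  -- edge does not involve being trivial. These are Boolean endomorphisms, so they carry `hq` to the
  -- apexes.
  have h₁ : edge s p t e i j q₁ = s (p 0) (t i) (s (p 1) (t j) (s (p 2) (t k) (e 0 1 q₁))) := by
    rw [h.sub_eq_self (h.cyl_e _ _ _ _ (by decide) (by decide)), h.edge_eq₀₁]
  have h₂ : edge s p t e i k q₂ = s (p 0) (t i) (s (p 1) (t j) (s (p 2) (t k) (e 0 2 q₂))) := by
    rw [h.sub_eq_self (i := p 1) (h.cyl_sub_eq (h.p_ne (by decide)) (h.p_ne_t _ _)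
      (h.cyl_e _ _ _ _ (by decide) (by decide))), h.edge_eq₀₂]
  have h₃ : edge s p t e j k q₃ = s (p 0) (t i) (s (p 1) (t j) (s (p 2) (t k) (e 1 2 q₃))) := by
    rw [h.sub_eq_self (i := p 0), edge]
    exact h.cyl_sub_eq (h.p_ne (by decide)) (h.p_ne_t _ _) (h.cyl_sub_eq (h.p_ne (by decide))
      (h.p_ne_t _ _) (h.cyl_e _ _ _ _ (by decide) (by decide)))
  rw [h₁, h₂, h₃, ← (h.sub_endo _ _).map_inf, ← (h.sub_endo _ _).map_inf,
    ← (h.sub_endo _ _).map_inf, ← (h.sub_endo _ _).map_inf, ← (h.sub_endo _ _).map_inf,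
    ← (h.sub_endo _ _).map_inf, hq, (h.sub_endo _ _).map_bot, (h.sub_endo _ _).map_bot,
    (h.sub_endo _ _).map_bot]

/-- Two apexes with a common neighbour. -/
theorem inf_le_of_apex (h : EdgeSystem c s p t e) {a b : Fin 3} (hab : a ≠ b) (ha : a ≠ 2)
    (hb : b ≠ 2) {i j : Fin 4} {q₁ q₂ q₃ : ι} {k₁ k₂ : A}
    (h₁ : k₁ ≤ e a 2 q₁) (h₂ : k₂ ≤ e a 2 q₂) (hq : e a b q₁ ⊓ e a 2 q₂ ≤ e b 2 q₃) :
    s (p 2) (t i) k₁ ⊓ s (p 2) (t j) k₂ ≤ s (p b) (t i) (s (p 2) (t j) (e b 2 q₃)) := by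
  have e₁ : s (p 2) (t i) (e a 2 q₁) = s (p b) (t i) (s (p 2) (t j) (e a b q₁)) := by
    have hc : c (p 2) (e a b q₁) = e a b q₁ := h.cyl_e _ _ _ _ ha.symm hb.symm
    rw [h.sub_eq_self hc, ← h.sub_e_right a b 2 q₁ ha.symm hb.symm hab,
      h.sub_sub_eq (h.p_ne hb.symm) (h.p_ne_t _ _) hc]
  have e₂ : s (p 2) (t j) (e a 2 q₂) = s (p b) (t i) (s (p 2) (t j) (e a 2 q₂)) := by
    rw [h.sub_eq_self (i := p b)]
    exact h.cyl_sub_eq (h.p_ne hb) (h.p_ne_t _ _) (h.cyl_e _ _ _ _ hab.symm hb)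
  refine (inf_le_inf ((h.sub_endo _ _).mono h₁) ((h.sub_endo _ _).mono h₂)).trans ?_
  rw [e₁, e₂, ← (h.sub_endo _ _).map_inf, ← (h.sub_endo _ _).map_inf]
  exact (h.sub_endo _ _).mono ((h.sub_endo _ _).mono hq)

/-- Adds one more cone. Neither `x` nor `b` depends on `t i`, and quantifying the moved cone over `t
i` gives `c (p 2) k`, which is above `b`. -/
theorem inf_ne_bot_of_cyl (h : EdgeSystem c s p t e) {b k x : A} {i : Fin 4}
    (hb : c (t i) b = b) (hk : c (t i) k = k) (hx : b ≤ c (p 2) k) (hxi : c (t i) x = x)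
    (hne : x ⊓ b ≠ ⊥) : x ⊓ s (p 2) (t i) k ⊓ b ≠ ⊥ := by
  intro hbot
  have h₁ : c (t i) (s (p 2) (t i) k) = c (p 2) k := by
    rw [h.cyl_sub_swap, h.sub_eq_self hk]
  have h₂ := congrArg (c (t i)) hbot
  rw [h.cyl_bot, h.cyl_inf_of_eq hb, inf_comm x, h.cyl_inf_of_eq hxi, h₁, inf_assoc,
    inf_eq_right.2 (inf_le_right.trans hx)] at h₂
  exact hne h₂

/-- The apexes of four cones over a common base exist at the same time. -/
theorem cones_ne_bot (h : EdgeSystem c s p t e) {b : A} {k : Fin 4 → A} (hb : ∀ i, c (t i) b = b)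
    (hk : ∀ i j, c (t j) (k i) = k i) (hx : ∀ i, b ≤ c (p 2) (k i)) (hne : b ≠ ⊥) :
    s (p 2) (t 0) (k 0) ⊓ s (p 2) (t 1) (k 1) ⊓ s (p 2) (t 2) (k 2) ⊓ s (p 2) (t 3) (k 3) ≠ ⊥ := by
  have hc : ∀ i j, i ≠ j → c (t j) (s (p 2) (t i) (k i)) = s (p 2) (t i) (k i) := fun i j hij =>
    h.cyl_sub_eq (h.p_ne_t _ _).symm (fun e => hij (h.t_inj e).symm) (hk _ _)
  have hi : ∀ i x y, c (t i) x = x → c (t i) y = y → c (t i) (x ⊓ y) = x ⊓ y :=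
    fun i x y h₁ h₂ => by
      rw [h.cyl_inf_of_eq h₂, h₁]
  have h₀ : s (p 2) (t 0) (k 0) ⊓ b ≠ ⊥ := by
    have := h.inf_ne_bot_of_cyl (x := ⊤) (hb 0) (hk 0 0) (hx 0) (h.cyl_top _) (by simpa using hne)
    simpa using this
  have h₁ := h.inf_ne_bot_of_cyl (hb 1) (hk 1 1) (hx 1) (hc 0 1 (by decide)) h₀
  have h₂ := h.inf_ne_bot_of_cyl (hb 2) (hk 2 2) (hx 2) (hi _ _ _ (hc 0 2 (by decide))
    (hc 1 2 (by decide))) h₁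
  have h₃ := h.inf_ne_bot_of_cyl (hb 3) (hk 3 3) (hx 3) (hi _ _ _ (hi _ _ _ (hc 0 3 (by decide))
    (hc 1 3 (by decide))) (hc 2 3 (by decide))) h₂
  exact fun hbot => h₃ (by rw [hbot, bot_inf_eq])

theorem exists_inf_ne_bot {x : A} (hx : x ≠ ⊥) {f : Bool → A} (h : x ≤ f true ⊔ f false) :
    ∃ b, x ⊓ f b ≠ ⊥ := by
  by_contra! hbot
  apply hx
  rw [← inf_eq_left.2 h, inf_sup_left, hbot, hbot, bot_sup_eq]

/-- Four apexes over a common base are joined by red edges, which violate the parity condition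
on some triangle. -/
theorem false_of_cones (h : EdgeSystem c s p t e) {g : Bool → Fin 4 → ι}
    {w : Bool → Fin 4 → Fin 4 → ι} {r : Fin 4 → Fin 4 → Bool → ι} {b : A} {k : Fin 4 → A}
    (hb : ∀ i, c (t i) b = b) (hk : ∀ i j, c (t j) (k i) = k i) (hx : ∀ i, b ≤ c (p 2) (k i))
    (hne : b ≠ ⊥) (hk₀ : ∀ i, k i ≤ e 0 2 (g false i)) (hk₁ : ∀ i, k i ≤ e 1 2 (g true i))
    (h₀ : ∀ i j, i ≠ j → e 0 1 (g false i) ⊓ e 0 2 (g false j) ≤ e 1 2 (w false i j))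
    (h₁ : ∀ i j, i ≠ j → e 1 0 (g true i) ⊓ e 1 2 (g true j) ≤ e 0 2 (w true i j))
    (hw : ∀ i j, e 1 2 (w false i j) ⊓ e 1 2 (w true i j) ≤
      e 1 2 (r i j true) ⊔ e 1 2 (r i j false))
    (hr : ∀ i j l x y z, i ≠ j → i ≠ l → j ≠ l →
      xor x (xor y z) ≠ Srt.parity (.a i) (.a j) (.a l) →
      e 0 1 (r i j x) ⊓ e 0 2 (r i l y) ⊓ e 1 2 (r j l z) = ⊥) : False := by
  -- The base node at `p 0` bounds the edge by the label `w false i j`, the one at `p 1` by `w true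
  -- i j`. Written in the same coordinates, the two bounds leave only the red labels.
  have hred : ∀ i j, i ≠ j → s (p 2) (t i) (k i) ⊓ s (p 2) (t j) (k j) ≤
      edge s p t e i j (r i j true) ⊔ edge s p t e i j (r i j false) := by
    intro i j hij
    have l₀ := h.inf_le_of_apex (i := i) (j := j) (a := 0) (b := 1) (by decide) (by decide)
      (by decide) (hk₀ i) (hk₀ j) (h₀ i j hij)
    have l₁ := h.inf_le_of_apex (i := i) (j := j) (a := 1) (b := 0) (by decide) (by decide)
      (by decide) (hk₁ i) (hk₁ j) (h₁ i j hij)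
    rw [h.edge_eq₀₂] at l₁
    refine (le_inf l₀ l₁).trans ?_
    simp only [edge]
    rw [← (h.sub_endo _ _).map_inf, ← (h.sub_endo _ _).map_inf, ← (h.sub_endo _ _).map_sup,
      ← (h.sub_endo _ _).map_sup]
    exact (h.sub_endo _ _).mono ((h.sub_endo _ _).mono (hw i j))
  have htri : ∀ i j l x y z X, i ≠ j → i ≠ l → j ≠ l → X ≠ ⊥ → X ≤ edge s p t e i j (r i j x) →
      X ≤ edge s p t e i l (r i l y) → X ≤ edge s p t e j l (r j l z) →
      xor x (xor y z) = Srt.parity (.a i) (.a j) (.a l) := by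
    intro i j l x y z X hij hil hjl hX h₁ h₂ h₃
    by_contra hne
    exact hX (le_bot_iff.1 ((le_inf (le_inf h₁ h₂) h₃).trans
      (h.triangle_eq_bot (hr i j l x y z hij hil hjl hne)).le))
  have hP := h.cones_ne_bot hb hk hx hne
  set K : Fin 4 → A := fun i => s (p 2) (t i) (k i) with hK
  set X := K 0 ⊓ K 1 ⊓ K 2 ⊓ K 3 with hX
  have hXK : ∀ i, X ≤ K i := by
    intro i
    fin_cases i
    exacts [inf_le_left.trans (inf_le_left.trans inf_le_left),
      inf_le_left.trans (inf_le_left.trans inf_le_right), inf_le_left.trans inf_le_right,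
      inf_le_right]
  have hle : ∀ i j Y, i ≠ j → Y ≤ X → Y ≤ edge s p t e i j (r i j true) ⊔
      edge s p t e i j (r i j false) := fun i j Y hij hY =>
    hY.trans ((le_inf (hXK i) (hXK j)).trans (hred i j hij))
  -- A bit is chosen for each of the six edges, keeping the meet nonzero.
  obtain ⟨x₁, n₁⟩ := exists_inf_ne_bot (f := fun x => edge s p t e 0 1 (r 0 1 x)) hP
    (hle 0 1 X (by decide) le_rfl)
  obtain ⟨x₂, n₂⟩ := exists_inf_ne_bot (f := fun x => edge s p t e 0 2 (r 0 2 x)) n₁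
    (hle 0 2 _ (by decide) inf_le_left)
  obtain ⟨x₃, n₃⟩ := exists_inf_ne_bot (f := fun x => edge s p t e 0 3 (r 0 3 x)) n₂
    (hle 0 3 _ (by decide) (inf_le_left.trans inf_le_left))
  obtain ⟨x₄, n₄⟩ := exists_inf_ne_bot (f := fun x => edge s p t e 1 2 (r 1 2 x)) n₃
    (hle 1 2 _ (by decide) (inf_le_left.trans (inf_le_left.trans inf_le_left)))
  obtain ⟨x₅, n₅⟩ := exists_inf_ne_bot (f := fun x => edge s p t e 1 3 (r 1 3 x)) n₄
    (hle 1 3 _ (by decide) (inf_le_left.trans (inf_le_left.trans (inf_le_left.trans inf_le_left))))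
  obtain ⟨x₆, n₆⟩ := exists_inf_ne_bot (f := fun x => edge s p t e 2 3 (r 2 3 x)) n₅
    (hle 2 3 _ (by decide) (inf_le_left.trans (inf_le_left.trans (inf_le_left.trans
      (inf_le_left.trans inf_le_left)))))
  set Y := X ⊓ edge s p t e 0 1 (r 0 1 x₁) ⊓ edge s p t e 0 2 (r 0 2 x₂) ⊓
    edge s p t e 0 3 (r 0 3 x₃) ⊓ edge s p t e 1 2 (r 1 2 x₄) ⊓ edge s p t e 1 3 (r 1 3 x₅) ⊓
    edge s p t e 2 3 (r 2 3 x₆) with hY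
  have hYs := hY.le
  simp only [le_inf_iff] at hYs
  obtain ⟨⟨⟨⟨⟨⟨-, u₆⟩, u₅⟩, u₄⟩, u₃⟩, u₂⟩, u₁⟩ := hYs
  have v₁ := htri 0 1 2 x₁ x₂ x₄ _ (by decide) (by decide) (by decide) n₆ u₆ u₅ u₃
  have v₂ := htri 0 1 3 x₁ x₃ x₅ _ (by decide) (by decide) (by decide) n₆ u₆ u₄ u₂
  have v₃ := htri 0 2 3 x₂ x₃ x₆ _ (by decide) (by decide) (by decide) n₆ u₅ u₄ u₁
  have v₄ := htri 1 2 3 x₄ x₅ x₆ _ (by decide) (by decide) (by decide) n₆ u₃ u₂ u₁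
  -- Each bit occurs in two of the four equations, but exactly one right-hand side is `true`.
  clear * - v₁ v₂ v₃ v₄
  revert x₁ x₂ x₃ x₄ x₅ x₆
  decide

end EdgeSystem

/-! ### The finite subalgebra -/

/-- The labels of edges without the indices of red colours. -/
abbrev Lab := Srt × Srt × Prop × Col (Option Bool)

/-- The label of an edge from a base node of sort `t` to an apex of sort `i`. -/
def Lab.green (t : Bool) (i : Fin 4) : Set Lab :=
  {L | L.1 = .b t ∧ L.2.1 = .a i ∧ L.2.2.2 = .gr}

/-- The labels of edges between apexes with a common green neighbour of sort `t`. -/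
def Lab.cone (t : Bool) (i j : Fin 4) : Set Lab :=
  {L | L.1 = .a i ∧ L.2.1 = .a j ∧ (L.2.2.2 = .wh (!t) ∨ ∃ x, L.2.2.2 = .red (some x))}

/-- The labels of red edges. -/
def Lab.red (i j : Fin 4) (x : Bool) : Set Lab :=
  {L | L.1 = .a i ∧ L.2.1 = .a j ∧ L.2.2.2 = .red (some x)}

/-- The label of an edge that may be the base of cones of all sorts. -/
def Lab.base : Set Lab :=
  {L | L.1 = .b false ∧ L.2.1 = .b true ∧ L.2.2.2 = .st Set.univ}

theorem Col.map_eq_gr {R S : Type} {f : R → S} {c : Col R} : c.map f = .gr ↔ c = .gr := by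
  cases c <;> simp [Col.map]

theorem Col.map_eq_st {R S : Type} {f : R → S} {c : Col R} {Z : Set (Fin 4)} :
    c.map f = .st Z ↔ c = .st Z := by
  cases c <;> simp [Col.map]

theorem Col.map_eq_red {R S : Type} {f : R → S} {c : Col R} {y : S} :
    c.map f = .red y ↔ ∃ r, c = .red r ∧ f r = y := by
  cases c <;> simp [Col.map]

theorem Col.Sim.map {R S : Type} (f : R → S) {c c' : Col R} (h : c.Sim c') :
    (c.map f).Sim (c'.map f) := by
  have key : ∀ c : Col R, (c.map f).map (fun _ => ()) = c.map fun _ => () := fun c => by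
    cases c <;> rfl
  rw [Col.Sim, key, key]
  exact h

theorem Col.map_snd_eq_red {c : Col Red} {x : Bool} :
    c.map (Option.map Prod.snd) = .red (some x) ↔ ∃ l, c = .red (some (l, x)) := by
  simp [Col.map_eq_red]

section

variable {srt : ℕ → Srt} {c : ℕ → ℕ → Col Red}

/-- The hypothesis `hr` is where atoms differ from arbitrary tuples: in the graph itself the edge
could have the limit colour. -/
theorem Rich.cone (h : Rich srt c) {p q r : ℕ} {t : Bool} {i j : Fin 4} (hij : i ≠ j)
    (hr : (c q r).All (· ≠ none))
    (h₁ : lab srt c (Option.map Prod.snd) p q ∈ Lab.green t i)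
    (h₂ : lab srt c (Option.map Prod.snd) p r ∈ Lab.green t j) :
    lab srt c (Option.map Prod.snd) q r ∈ Lab.cone t i j := by
  obtain ⟨hp, hq, hpq⟩ := h₁
  obtain ⟨-, hr', hpr⟩ := h₂
  simp only [lab, Col.map_eq_gr] at hp hq hpq hr' hpr
  refine ⟨hq, hr', ?_⟩
  have n₁ : p ≠ q := fun e => by rw [e, hq] at hp; cases hp
  have n₂ : p ≠ r := fun e => by rw [e, hr'] at hp; cases hp
  have n₃ : q ≠ r := fun e => by rw [e, hr'] at hq; cases hq; exact hij rfl
  have hw := ((h.triOk p q r n₁ n₂ n₃).apex₁ hpq hpr).1 t hp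
  have hv := h.valid q r
  rw [hq, hr'] at hv
  rcases hv.2 hij with ⟨t', e⟩ | ⟨r', e⟩
  · left
    simp only [lab, e, Col.map]
    rw [e] at hw
    congr 1
    cases t <;> cases t' <;> simp_all
  · right
    match r', hr r' e with
    | some (l, x), _ => exact ⟨x, by simp [lab, e, Col.map]⟩

theorem Rich.parity_eq (h : Rich srt c) {p q r : ℕ} {i j k : Fin 4} {x y z : Bool} (hij : i ≠ j)
    (hik : i ≠ k) (hjk : j ≠ k) (h₁ : lab srt c (Option.map Prod.snd) p q ∈ Lab.red i j x)
    (h₂ : lab srt c (Option.map Prod.snd) p r ∈ Lab.red i k y)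
    (h₃ : lab srt c (Option.map Prod.snd) q r ∈ Lab.red j k z) :
    xor x (xor y z) = Srt.parity (.a i) (.a j) (.a k) := by
  obtain ⟨hp, hq, hpq⟩ := h₁
  obtain ⟨-, hr, hpr⟩ := h₂
  obtain ⟨-, -, hqr⟩ := h₃
  simp only [lab, Col.map_snd_eq_red] at hp hq hpq hr hpr hqr
  obtain ⟨l, hpq⟩ := hpq
  obtain ⟨l', hpr⟩ := hpr
  obtain ⟨l'', hqr⟩ := hqr
  have n₁ : p ≠ q := fun e => by rw [e, hq] at hp; cases hp; exact hij rfl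
  have n₂ : p ≠ r := fun e => by rw [e, hr] at hp; cases hp; exact hik rfl
  have n₃ : q ≠ r := fun e => by rw [e, hr] at hq; cases hq; exact hjk rfl
  have := (h.triOk p q r n₁ n₂ n₃).red _ _ _ hpq hpr hqr
  rw [hp, hq, hr] at this
  exact this.2.2

theorem Lab.cone_inter_subset (i j : Fin 4) :
    Lab.cone false i j ∩ Lab.cone true i j ⊆ Lab.red i j true ∪ Lab.red i j false := by
  rintro L ⟨⟨h₁, h₂, h₃⟩, -, -, h₄⟩
  have key : ∃ x, L.2.2.2 = .red (some x) := by
    rcases h₃ with h₃ | h₃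
    · rcases h₄ with h₄ | h₄
      · rw [h₃] at h₄; cases h₄
      · exact h₄
    · exact h₃
  obtain ⟨x, hx⟩ := key
  cases x
  · exact .inr ⟨h₁, h₂, hx⟩
  · exact .inl ⟨h₁, h₂, hx⟩

theorem exists_valid (σ τ : Srt) : ∃ a : Col Red, Col.Valid σ τ a :=
  ⟨_, valid_defaultCol (fun _ => σ) (fun _ => none) (fun _ => .nil) σ τ⟩

theorem Rich.exists_base (h : Rich srt c) :
    ∃ p q, lab srt c (Option.map Prod.snd) p q ∈ Lab.base := by
  obtain ⟨a, ha⟩ := exists_valid (.b false) (srt 0)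
  obtain ⟨p, -, -, hp, -, -⟩ := h.ext 0 0 (.b false) a a ha ha (fun _ => rfl)
    fun h => absurd rfl h
  have hv : Col.Valid (.b true) (srt p) (.st Set.univ : Col Red) := by
    rw [hp]
    exact ⟨fun h => (nomatch h), fun _ => ⟨_, rfl⟩⟩
  obtain ⟨q, -, -, hq, hqp, -⟩ := h.ext p p (.b true) _ _ hv hv (fun _ => rfl)
    fun h => absurd rfl h
  refine ⟨p, q, hp, hq, ?_⟩
  rw [lab, h.symm, hqp]
  rfl

/-- The colour `st Set.univ` admits cones of every sort, so the triangle is consistent. -/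
theorem Rich.exists_apex (h : Rich srt c) {p q : ℕ}
    (hb : lab srt c (Option.map Prod.snd) p q ∈ Lab.base) (i : Fin 4) :
    ∃ z, lab srt c (Option.map Prod.snd) p z ∈ Lab.green false i ∧
      lab srt c (Option.map Prod.snd) q z ∈ Lab.green true i := by
  obtain ⟨hp, hq, hpq⟩ := hb
  simp only [lab, Col.map_eq_st] at hp hq hpq
  have hne : p ≠ q := fun e => by rw [e, hq] at hp; cases hp
  obtain ⟨z, -, -, hz, hzp, hzq⟩ := h.ext p q (.a i) .gr .gr (by rw [hp]; exact .inr rfl)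
    (by rw [hq]; exact .inr rfl) (fun _ => rfl) fun _ => by
      rw [hpq]
      exact ⟨fun _ _ => ⟨fun t ht => (nomatch ht), fun j _ S hS => (by cases hS; trivial)⟩,
        fun _ h => (nomatch h), fun _ h => (nomatch h), fun _ _ _ h => (nomatch h)⟩
  simp only [Lab.green, Set.mem_ofPred_eq, lab, Col.map_eq_gr]
  exact ⟨z, ⟨hp, hz, by rw [h.symm, hzp]⟩, hq, hz, by rw [h.symm, hzq]⟩

/-- Truncation at 0 merges all red colours and preserves everything else. Properties that do not
look at red indices therefore survive the passage to an equivalent tuple in `W`. -/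
theorem lab_mem_of_trunc_eq {p q p' q' : ℕ} {Z : Set Lab}
    (h : lab srt c (Red.trunc 0) p q = lab srt c (Red.trunc 0) p' q')
    (hZ : ∀ L ∈ Z, ∀ L' : Lab, L.1 = L'.1 → L.2.1 = L'.2.1 → L.2.2.2.Sim L'.2.2.2 → L' ∈ Z)
    (hpq : lab srt c (Option.map Prod.snd) p q ∈ Z) :
    lab srt c (Option.map Prod.snd) p' q' ∈ Z := by
  simp only [lab, Prod.mk.injEq] at h
  refine hZ _ hpq _ h.1 h.2.1 ?_
  exact (Col.Sim.of_map_eq h.2.2.2).map _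

theorem Lab.green_sim {t : Bool} {i : Fin 4} : ∀ L ∈ Lab.green t i, ∀ L' : Lab, L.1 = L'.1 →
    L.2.1 = L'.2.1 → L.2.2.2.Sim L'.2.2.2 → L' ∈ Lab.green t i :=
  fun _ hL _ h₁ h₂ h₃ => ⟨h₁ ▸ hL.1, h₂ ▸ hL.2.1, h₃.eq_gr_iff.1 hL.2.2⟩

theorem Lab.base_sim : ∀ L ∈ Lab.base, ∀ L' : Lab, L.1 = L'.1 →
    L.2.1 = L'.2.1 → L.2.2.2.Sim L'.2.2.2 → L' ∈ Lab.base :=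
  fun _ hL _ h₁ h₂ h₃ => ⟨h₁ ▸ hL.1, h₂ ▸ hL.2.1, (h₃.eq_st_iff _).1 hL.2.2⟩

end

/-! ### Elements of the finite subalgebra given by visible edges -/

/-- The first three indices. -/
def pos (m : ℕ) (x : Fin 3) : Fin (m + 3) := x.castLE (Nat.le_add_left 3 m)

/-- The indices of the parameters. -/
def prm (m : ℕ) (l : Fin m) : Fin (m + 3) := l.addNat 3

theorem pos_injective (m : ℕ) : Function.Injective (pos m) :=
  Fin.castLE_injective (Nat.le_add_left 3 m)

theorem prm_injective (m : ℕ) : Function.Injective (prm m) := fun _ _ h => by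
  simpa [prm] using h

theorem prm_ne_pos {m : ℕ} (l : Fin m) (x : Fin 3) : prm m l ≠ pos m x := fun h => by
  have := congrArg Fin.val h
  simp only [prm, pos, Fin.val_addNat, Fin.val_castLE] at this
  omega

namespace Rich

variable {m : ℕ} {srt : ℕ → Srt} {c : ℕ → ℕ → Col Red} {P : ℕ → (Fin m → ℕ) → ℕ}
  (h : Rich srt c) (hP : Generic P)

/-- The algebra of the coloured graph. -/
abbrev graphBlur : Blur (m + 3) ℕ := h.blur hP rfl

/-- The entries `x` and `y` of the tuple are visible, and the label of their edge is in `Z`. -/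
def HasEdge (_ : Rich srt c) (_ : Generic P) (x y : Fin 3) (Z : Set Lab)
    (s : Fin (m + 3) → ℕ) : Prop :=
  Vis s (prm m) (pos m x) ∧ Vis s (prm m) (pos m y) ∧
    lab srt c (Option.map Prod.snd) (node P s (prm m) (pos m x)) (node P s (prm m) (pos m y)) ∈ Z

theorem HasEdge.of_class {x y : Fin 3} {Z : Set Lab} {s s' : Fin (m + 3) → ℕ}
    (e : (h.graphBlur hP).C s s') (hs : h.HasEdge hP x y Z s) : h.HasEdge hP x y Z s' :=
  ⟨hs.1.congr e.eq_iff, hs.2.1.congr e.eq_iff, by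
    rw [← e.lab_eq _ _ _ hs.1 hs.2.1]
    exact hs.2.2⟩

theorem HasEdge.of_equiv {x y : Fin 3} {Z : Set Lab} {s s' : Fin (m + 3) → ℕ}
    (hZ : ∀ L ∈ Z, ∀ L' : Lab, L.1 = L'.1 → L.2.1 = L'.2.1 → L.2.2.2.Sim L'.2.2.2 → L' ∈ Z)
    (e : (h.graphBlur hP).E 0 s s') (hs : h.HasEdge hP x y Z s) : h.HasEdge hP x y Z s' :=
  ⟨hs.1.congr e.eq_iff, hs.2.1.congr e.eq_iff,
    lab_mem_of_trunc_eq (e.lab_eq _ _ _ hs.1 hs.2.1) hZ hs.2.2⟩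

theorem hasEdge_update {x y z : Fin 3} (hx : z ≠ x) (hy : z ≠ y) {Z : Set Lab}
    {s : Fin (m + 3) → ℕ} {u : ℕ} :
    h.HasEdge hP x y Z (Function.update s (pos m z) u) ↔ h.HasEdge hP x y Z s := by
  have e₁ : Function.update s (pos m z) u ∘ prm m = s ∘ prm m := by
    funext l
    exact Function.update_of_ne (prm_ne_pos l z) _ _
  have e₂ : ∀ x, z ≠ x → Function.update s (pos m z) u (pos m x) = s (pos m x) := fun x hx =>
    Function.update_of_ne (fun e => hx (pos_injective m e).symm) _ _
  have e₃ := congrFun e₁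
  simp only [Function.comp_apply] at e₃
  simp only [HasEdge, Vis, node, e₁, e₂ x hx, e₂ y hy, e₃]

theorem hasEdge_comp {x y z w : Fin 3} {τ : Fin (m + 3) → Fin (m + 3)}
    (hτ : ∀ l, τ (prm m l) = prm m l) (hx : τ (pos m x) = pos m z) (hy : τ (pos m y) = pos m w)
    {Z : Set Lab} {s : Fin (m + 3) → ℕ} :
    h.HasEdge hP x y Z (s ∘ τ) ↔ h.HasEdge hP z w Z s := by
  have e₁ : (s ∘ τ) ∘ prm m = s ∘ prm m := by
    funext l
    exact congrArg s (hτ l)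
  simp only [HasEdge, Vis, node, e₁, Function.comp_apply, hx, hy, hτ]

/-- The set of the atoms of tuples with a given edge. -/
def edgeSet (x y : Fin 3) (Z : Set Lab) : (h.graphBlur hP).classAlg :=
  ⟨{a | ∃ s, (h.graphBlur hP).atom s = a ∧ h.HasEdge hP x y Z s}, by
    rintro s s' e ⟨s₁, h₁, hs₁⟩
    exact ⟨s', rfl, .of_class h hP e (.of_class h hP ((h.graphBlur hP).class_of_atom_eq h₁) hs₁)⟩⟩

theorem atom_mem_edgeSet {x y : Fin 3} {Z : Set Lab} {s : (h.graphBlur hP).W} :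
    (h.graphBlur hP).atom s ∈ (h.edgeSet hP x y Z : Set _) ↔ h.HasEdge hP x y Z s := by
  constructor
  · rintro ⟨s₁, h₁, hs₁⟩
    exact .of_class h hP ((h.graphBlur hP).class_of_atom_eq h₁) hs₁
  · intro hs
    exact ⟨s, rfl, hs⟩

/-- The operations on the finite algebra. -/
def classOps : Ops .PEA (m + 3) (h.graphBlur hP).classAlg :=
  (h.graphBlur hP).ops.At.Cm.restrict ((h.graphBlur hP).isSubalgebra_classAlg (Nat.succ_pos _))

theorem classAlg_le {Y Y' : (h.graphBlur hP).classAlg}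
    (hY : ∀ s, (h.graphBlur hP).atom s ∈ (Y : Set _) → (h.graphBlur hP).atom s ∈ (Y' : Set _)) :
    Y ≤ Y' := by
  intro a ha
  obtain ⟨s, rfl⟩ := (h.graphBlur hP).exists_eq_atom (Nat.succ_pos _) a
  exact hY s ha

theorem cyl_edgeSet {x y z : Fin 3} (hx : z ≠ x) (hy : z ≠ y) (Z : Set Lab) :
    (h.classOps hP).cyl (pos m z) (h.edgeSet hP x y Z) = h.edgeSet hP x y Z := by
  refine le_antisymm (h.classAlg_le hP fun s hs => ?_) (h.classAlg_le hP fun s hs => ?_)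
  · obtain ⟨u, hu, hs⟩ := ((h.graphBlur hP).atom_mem_cyl (Nat.succ_pos _)).1 hs
    rw [atom_mem_edgeSet, hasEdge_update h hP hx hy] at hs
    rwa [atom_mem_edgeSet]
  · refine ((h.graphBlur hP).atom_mem_cyl (Nat.succ_pos _)).2 ⟨(s : Fin (m + 3) → ℕ) (pos m z), ?_⟩
    simp only [Function.update_eq_self]
    exact ⟨s.2, hs⟩

theorem sub_edgeSet {x y z w : Fin 3} {τ : Fin (m + 3) → Fin (m + 3)}
    (hτ : ∀ l, τ (prm m l) = prm m l) (hx : τ (pos m x) = pos m z) (hy : τ (pos m y) = pos m w)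
    (Z : Set Lab) :
    (h.classOps hP).sub τ trivial (h.edgeSet hP x y Z) = h.edgeSet hP z w Z := by
  have key : ∀ s, (h.graphBlur hP).atom s ∈
      ((h.classOps hP).sub τ trivial (h.edgeSet hP x y Z) : Set _) ↔
      (h.graphBlur hP).atom s ∈ (h.edgeSet hP z w Z : Set _) := fun s => by
    refine ((h.graphBlur hP).atom_mem_sub (Nat.succ_pos _) trivial).trans ?_
    rw [atom_mem_edgeSet, atom_mem_edgeSet]
    exact hasEdge_comp h hP hτ hx hy
  exact le_antisymm (h.classAlg_le hP fun s => (key s).1) (h.classAlg_le hP fun s => (key s).2)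

theorem sub_edgeSet_left {x y z : Fin 3} (hxy : x ≠ y) (Z : Set Lab) :
    (h.classOps hP).sub (repl (pos m x) (pos m z)) trivial (h.edgeSet hP x y Z) =
      h.edgeSet hP z y Z :=
  h.sub_edgeSet hP (fun l => repl_of_ne (prm_ne_pos l x)) (repl_self _ _)
    (repl_of_ne fun e => hxy (pos_injective m e).symm) Z

theorem sub_edgeSet_right {x y z : Fin 3} (hxy : x ≠ y) (Z : Set Lab) :
    (h.classOps hP).sub (repl (pos m y) (pos m z)) trivial (h.edgeSet hP x y Z) =
      h.edgeSet hP x z Z :=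
  h.sub_edgeSet hP (fun l => repl_of_ne (prm_ne_pos l y))
    (repl_of_ne fun e => hxy (pos_injective m e)) (repl_self _ _) Z

theorem edgeSet_inf_le_cone {x y z : Fin 3} {t : Bool} {i j : Fin 4} (hij : i ≠ j) :
    h.edgeSet hP x y (Lab.green t i) ⊓ h.edgeSet hP x z (Lab.green t j) ≤
      h.edgeSet hP y z (Lab.cone t i j) :=
  h.classAlg_le hP fun s => by
    rintro ⟨h₁, h₂⟩
    rw [atom_mem_edgeSet] at h₁ h₂ ⊢
    exact ⟨h₁.2.1, h₂.2.1, h.cone hij (s.2 _ _ _ h₁.2.1 h₂.2.1) h₁.2.2 h₂.2.2⟩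

theorem edgeSet_cone_inf_le {x y : Fin 3} {i j : Fin 4} :
    h.edgeSet hP x y (Lab.cone false i j) ⊓ h.edgeSet hP x y (Lab.cone true i j) ≤
      h.edgeSet hP x y (Lab.red i j true) ⊔ h.edgeSet hP x y (Lab.red i j false) :=
  h.classAlg_le hP fun s => by
    rintro ⟨h₁, h₂⟩
    rw [atom_mem_edgeSet] at h₁ h₂
    refine (Lab.cone_inter_subset i j ⟨h₁.2.2, h₂.2.2⟩).imp (fun h₃ => ?_) fun h₃ => ?_
    · exact (h.atom_mem_edgeSet hP).2 ⟨h₁.1, h₁.2.1, h₃⟩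
    · exact (h.atom_mem_edgeSet hP).2 ⟨h₁.1, h₁.2.1, h₃⟩

theorem edgeSet_red_inf_eq_bot {x y z : Fin 3} {i j k : Fin 4} {t u v : Bool} (hij : i ≠ j)
    (hik : i ≠ k) (hjk : j ≠ k) (he : xor t (xor u v) ≠ Srt.parity (.a i) (.a j) (.a k)) :
    h.edgeSet hP x y (Lab.red i j t) ⊓ h.edgeSet hP x z (Lab.red i k u) ⊓
      h.edgeSet hP y z (Lab.red j k v) = ⊥ :=
  le_bot_iff.1 <| h.classAlg_le hP fun s => by
    rintro ⟨⟨h₁, h₂⟩, h₃⟩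
    rw [atom_mem_edgeSet] at h₁ h₂ h₃
    exact absurd (h.parity_eq hij hik hjk h₁.2.2 h₂.2.2 h₃.2.2) he

/-- The tuples with a base that is joined by green edges to an apex of sort `i`. -/
def coneSet (i : Fin 4) : (h.graphBlur hP).classAlg :=
  h.edgeSet hP 0 2 (Lab.green false i) ⊓ h.edgeSet hP 1 2 (Lab.green true i)

/-- The graph has the required apex `z`, and a generic entry `v` is sent to it. -/
theorem base_le_cyl_coneSet (i : Fin 4) :
    h.edgeSet hP 0 1 Lab.base ≤ (h.classOps hP).cyl (pos m 2) (h.coneSet hP i) :=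
  h.classAlg_le hP fun s hs => by
    rw [atom_mem_edgeSet] at hs
    obtain ⟨z, hz₀, hz₁⟩ := h.exists_apex hs.2.2 i
    obtain ⟨v, hv, hPv⟩ := hP (Finset.univ.image (s : Fin (m + 3) → ℕ)) fun _ _ => z
    have hsv : ∀ j, (s : Fin (m + 3) → ℕ) j < v := fun j =>
      hv _ (Finset.mem_image_of_mem _ (Finset.mem_univ j))
    -- Other choices of parameters may reveal limit colours at `v`, so `v` is replaced by `u` to
    -- return to `W`; green labels are kept by the equivalence at level 0.
    obtain ⟨u, hu, hW⟩ := (h.graphBlur hP).update_mem ((h.graphBlur hP).refl 0 s) s.2 (pos m 2) v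
    refine ((h.graphBlur hP).atom_mem_cyl (Nat.succ_pos _)).2 ⟨u, hW, ?_⟩
    set s' := Function.update (s : Fin (m + 3) → ℕ) (pos m 2) v with hs'
    have e₁ : s' ∘ prm m = (s : Fin (m + 3) → ℕ) ∘ prm m := by
      funext l
      exact Function.update_of_ne (prm_ne_pos l 2) _ _
    have e₂ : s' (pos m 2) = v := Function.update_self _ _ _
    have e₃ : node P s' (prm m) (pos m 2) = z := by
      rw [node, e₁, e₂]
      exact hPv _ _ (.inr rfl) (fun l => .inl (Finset.mem_image_of_mem _ (Finset.mem_univ _)))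
        (.inl rfl)
    have v₂ : Vis s' (prm m) (pos m 2) := by
      refine ⟨by rw [e₁]; exact hs.1.1, fun l => ?_⟩
      rw [e₂]
      exact (congrFun e₁ l).trans_ne (hsv _).ne
    have b := (h.hasEdge_update hP (z := 2) (u := v) (by decide) (by decide)).2 hs
    have n₀ : node P s' (prm m) (pos m 0) = node P s (prm m) (pos m 0) := by
      rw [node, e₁, hs', Function.update_of_ne (fun e => by cases pos_injective m e)]; rfl
    have n₁ : node P s' (prm m) (pos m 1) = node P s (prm m) (pos m 1) := by
      rw [node, e₁, hs', Function.update_of_ne (fun e => by cases pos_injective m e)]; rfl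
    refine ⟨(h.atom_mem_edgeSet hP).2 (.of_equiv h hP Lab.green_sim hu ⟨b.1, v₂, ?_⟩),
      (h.atom_mem_edgeSet hP).2 (.of_equiv h hP Lab.green_sim hu ⟨b.2.1, v₂, ?_⟩)⟩
    · rw [e₃, n₀]; exact hz₀
    · rw [e₃, n₁]; exact hz₁

/-- Generic entries at the first two positions are sent to the ends of a base edge of the graph; the
tuple is then moved into `W`. -/
theorem base_ne_bot : h.edgeSet hP 0 1 Lab.base ≠ ⊥ := by
  obtain ⟨p, q, hpq⟩ := h.exists_base
  obtain ⟨v, hv, hPv⟩ := hP (Finset.univ.image fun l => (prm m l : ℕ)) fun _ _ => p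
  obtain ⟨w, hw, hPw⟩ := hP (Finset.univ.image fun l => (prm m l : ℕ)) fun _ _ => q
  have hl : ∀ l, (prm m l : ℕ) ∈ Finset.univ.image fun l => (prm m l : ℕ) := fun l =>
    Finset.mem_image_of_mem _ (Finset.mem_univ l)
  set s : Fin (m + 3) → ℕ :=
    Function.update (Function.update (fun i => (i : ℕ)) (pos m 0) v) (pos m 1) w with hs
  have e₀ : s (pos m 0) = v := by
    rw [hs, Function.update_of_ne (fun e => by cases pos_injective m e), Function.update_self]
  have e₁ : s (pos m 1) = w := Function.update_self _ _ _
  have e : ∀ l, s (prm m l) = prm m l := fun l => by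
    rw [hs, Function.update_of_ne (prm_ne_pos l 1), Function.update_of_ne (prm_ne_pos l 0)]
  have e' : s ∘ prm m = fun l => (prm m l : ℕ) := funext e
  have inj : Function.Injective (s ∘ prm m) := by
    rw [e']
    exact Fin.val_injective.comp (prm_injective m)
  have n₀ : node P s (prm m) (pos m 0) = p := by
    rw [node, e', e₀]
    exact hPv _ _ (.inr rfl) (fun l => .inl (hl l)) (.inl rfl)
  have n₁ : node P s (prm m) (pos m 1) = q := by
    rw [node, e', e₁]
    exact hPw _ _ (.inr rfl) (fun l => .inl (hl l)) (.inl rfl)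
  have hE : h.HasEdge hP 0 1 Lab.base s := by
    refine ⟨⟨inj, fun l => ?_⟩, ⟨inj, fun l => ?_⟩, by rwa [n₀, n₁]⟩
    · rw [e, e₀]; exact (hv _ (hl l)).ne
    · rw [e, e₁]; exact (hw _ (hl l)).ne
  obtain ⟨s', hs', he⟩ := (h.graphBlur hP).exists_mem_equiv (Nat.succ_pos _) 0 s
  intro hbot
  have hmem := (h.atom_mem_edgeSet hP (s := ⟨s', hs'⟩)).2 (.of_equiv h hP Lab.base_sim he hE)
  rw [hbot] at hmem
  exact hmem

end Rich

/-! ### Neat embeddings of the finite subalgebra -/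

/-- Images of the edge sets form an edge system to which `EdgeSystem.false_of_cones` applies. Only
cylindrifiers and proper replacements need be preserved, so one argument serves all types. -/
theorem Rich.false_of_neat_embedding {m M : ℕ} {srt : ℕ → Srt} {c : ℕ → ℕ → Col Red}
    {P : ℕ → (Fin m → ℕ) → ℕ} (h : Rich srt c) (hP : Generic P) (hle : m + 3 ≤ M)
    (hM : m + 3 + 4 ≤ M) {A : Type*} [BooleanAlgebra A] {cy : Fin M → A → A}
    {su : Fin M → Fin M → A → A} (hA : ScAxioms cy su)
    (f : BoundedLatticeHom (h.graphBlur hP).classAlg A) (hf : Function.Injective f)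
    (map_cyl : ∀ i Y, f ((h.classOps hP).cyl i Y) = cy (Fin.castLE hle i) (f Y))
    (map_sub : ∀ i j, i ≠ j → ∀ Y, f ((h.classOps hP).sub (repl i j) trivial Y) =
      su (Fin.castLE hle i) (Fin.castLE hle j) (f Y))
    (cyl_map : ∀ Y (i : Fin M), m + 3 ≤ (i : ℕ) → cy i (f Y) = f Y) : False := by
  -- The four dimensions after the first `m + 3` receive the four apexes; this is where four spare
  -- dimensions are needed.
  have ht : ∀ i : Fin 4, m + 3 + (i : ℕ) < M := fun i => by omega
  have cyl_t : ∀ (i : Fin 4) Y, cy ⟨m + 3 + i, ht i⟩ (f Y) = f Y := fun i Y =>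
    cyl_map Y _ (Nat.le_add_right _ _)
  have hp : ∀ {x y : Fin 3}, x ≠ y → pos m x ≠ pos m y := fun hxy e => hxy (pos_injective m e)
  have E : EdgeSystem cy su (fun x => Fin.castLE hle (pos m x)) (fun i : Fin 4 => ⟨m + 3 + i, ht i⟩)
      fun x y Z => f (h.edgeSet hP x y Z) :=
    { hA with
      p_inj := (Fin.castLE_injective hle).comp (pos_injective m)
      t_inj := fun i j e => Fin.ext (Nat.add_left_cancel (congrArg Fin.val e))
      p_ne_t := fun x i e => by
        have h₁ := (pos m x).2
        have h₂ : (pos m x : ℕ) = m + 3 + i := congrArg Fin.val e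
        omega
      cyl_e := fun x y z Z hx hy => by
        rw [← map_cyl, h.cyl_edgeSet hP hx hy]
      sub_e_left := fun x y z Z hx _ hxy => by
        rw [← map_sub _ _ (hp hx.symm), h.sub_edgeSet_left hP hxy]
      sub_e_right := fun x y z Z _ hy hxy => by
        rw [← map_sub _ _ (hp hy.symm), h.sub_edgeSet_right hP hxy] }
  refine E.false_of_cones (g := Lab.green) (w := Lab.cone) (r := Lab.red)
    (b := f (h.edgeSet hP 0 1 Lab.base)) (k := fun i => f (h.coneSet hP i))
    (fun i => cyl_t i _) (fun i j => cyl_t j _) (fun i => ?_) (fun hbot => ?_)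
    (fun i => OrderHomClass.mono f inf_le_left) (fun i => OrderHomClass.mono f inf_le_right)
    (fun i j hij => ?_) (fun i j hij => ?_) (fun i j => ?_) fun i j l x y z hij hil hjl he => ?_
  · rw [← map_cyl]
    exact OrderHomClass.mono f (h.base_le_cyl_coneSet hP i)
  · exact h.base_ne_bot hP (hf (hbot.trans (map_bot f).symm))
  · rw [← map_inf]
    exact OrderHomClass.mono f (h.edgeSet_inf_le_cone hP hij)
  · rw [← map_inf]
    exact OrderHomClass.mono f (h.edgeSet_inf_le_cone hP hij)
  · rw [← map_inf, ← map_sup]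
    exact OrderHomClass.mono f (h.edgeSet_cone_inf_le hP)
  · rw [← map_inf, ← map_inf, h.edgeSet_red_inf_eq_bot hP hij hil hjl he, map_bot]

theorem Ops.sub_congr {K : Kind} {n : ℕ} {A : Type*} (o : Ops K n A) {σ τ : Fin n → Fin n}
    (e : σ = τ) (hσ : σ ∈ K.subs n) (hτ : τ ∈ K.subs n) (x : A) : o.sub σ hσ x = o.sub τ hτ x := by
  subst e
  rfl

namespace Blur

variable {n : ℕ} {V : Type} (B : Blur n V)

/-- Needed for cylindric algebras, which have no substitution operators: a homomorphism then
respects replacements because they are definable. -/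
theorem sub_repl_eq (hn : 0 < n) {i j : Fin n} (hij : i ≠ j) (Y : Set {a : B.alg // IsAtom a}) :
    B.ops.At.Cm.sub (repl i j) (mem_subs_pea _) Y =
      B.ops.At.Cm.cyl i (B.ops.At.Cm.diag hasDiag_pea i j ⊓ Y) := by
  ext a
  obtain ⟨s, rfl⟩ := B.exists_eq_atom hn a
  rw [B.atom_mem_sub hn, B.atom_mem_cyl hn]
  have e := update_eq_comp_repl (s : Fin n → V) i j
  constructor
  · intro hs
    have hW : Function.update (s : Fin n → V) i ((s : Fin n → V) j) ∈ B.W := by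
      rw [e]
      exact B.comp_mem s.2 _
    refine ⟨_, hW, (B.atom_mem_diag _).2 ?_, ?_⟩
    · simp [Function.update_of_ne hij.symm]
    · convert hs
  · rintro ⟨u, hu, hd, hY⟩
    have hu' := (B.atom_mem_diag _).1 hd
    simp only [Function.update_self, Function.update_of_ne hij.symm] at hu'
    subst hu'
    convert hY using 2
    exact Subtype.ext e.symm

/-- A homomorphism into a reduct respects substitutions, in all four types of algebras. -/
theorem exists_scAxioms (hn : 0 < n) {K : Kind} {M : ℕ} (hle : n ≤ M) {A : Type*}
    [BooleanAlgebra A] {p : Ops K M A} (hp : p.IsModel)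
    {f : BoundedLatticeHom (Set {a : B.alg // IsAtom a}) A}
    (hom : (B.ops.rd K).At.Cm.IsHom (p.reduct hle) f) :
    ∃ su, ScAxioms p.cyl su ∧ ∀ i j, i ≠ j → ∀ Y, f (B.ops.At.Cm.sub (repl i j) trivial Y) =
      su (Fin.castLE hle i) (Fin.castLE hle j) (f Y) := by
  match K, p, hp, hom with
  | .Sc, p, hp, hom =>
    exact ⟨_, hp, fun i j _ Y => (hom.map_sub (repl i j) ⟨i, j, rfl⟩ Y).trans
      (p.sub_congr (liftMap_repl hle i j) _ _ _)⟩
  | .CA, p, hp, hom =>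
    refine ⟨_, CAAxioms.scAxioms hp, fun i j hij Y => ?_⟩
    rw [caSub_of_ne _ fun e => hij (Fin.castLE_injective hle e)]
    refine (congrArg f (B.sub_repl_eq hn hij Y)).trans ?_
    refine (hom.map_cyl i _).trans (congrArg (p.cyl _) ?_)
    rw [map_inf]
    exact congrArg (· ⊓ f Y) (hom.map_diag trivial i j)
  | .PA, p, hp, hom =>
    exact ⟨_, PAAxioms.scAxioms hp, fun i j _ Y => (hom.map_sub (repl i j) trivial Y).trans
      (p.sub_congr (liftMap_repl hle i j) _ _ _)⟩
  | .PEA, p, hp, hom =>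
    exact ⟨_, (show PEAAxioms _ _ _ from hp).toPAAxioms.scAxioms, fun i j _ Y =>
      (hom.map_sub (repl i j) trivial Y).trans (p.sub_congr (liftMap_repl hle i j) _ _ _)⟩

/-- The inclusion of the finite subalgebra. -/
def classInclusion : BoundedLatticeHom B.classAlg (Set {a : B.alg // IsAtom a}) where
  toFun Y := Y
  map_sup' _ _ := rfl
  map_inf' _ _ := rfl
  map_top' := rfl
  map_bot' := rfl

end Blur

theorem Rich.not_sNr_cm {m : ℕ} {srt : ℕ → Srt} {c : ℕ → ℕ → Col Red}
    {P : ℕ → (Fin m → ℕ) → ℕ} (h : Rich srt c) (hP : Generic P) (K : Kind) {k : ℕ} (hk : 4 ≤ k) :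
    ¬ SNr K (Nat.le_add_right (m + 3) k) _ ((h.graphBlur hP).ops.rd K).At.Cm := by
  rintro ⟨A, _, p, hp, f, hf, hom, hnr⟩
  obtain ⟨su, hsu, map_sub⟩ := (h.graphBlur hP).exists_scAxioms (Nat.succ_pos _) _ hp hom
  exact h.false_of_neat_embedding hP (Nat.le_add_right _ _) (Nat.add_le_add_left hk _) hsu
    (f.comp (h.graphBlur hP).classInclusion) (fun Y Y' e => Subtype.ext (hf e))
    (fun i Y => hom.map_cyl i Y) (fun i j hij Y => map_sub i j hij Y) fun Y i hi => hnr _ i hi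

theorem Rich.not_sNr_classAlg {m : ℕ} {srt : ℕ → Srt} {c : ℕ → ℕ → Col Red}
    {P : ℕ → (Fin m → ℕ) → ℕ} (h : Rich srt c) (hP : Generic P) :
    ¬ SNr .Sc (Nat.le_add_right (m + 3) 4) _ (h.classOps hP).rdSc := by
  rintro ⟨A, _, p, hp, f, hf, hom, hnr⟩
  exact h.false_of_neat_embedding hP (Nat.le_add_right _ _) le_rfl hp f hf hom.map_cyl
    (fun i j _ Y => (hom.map_sub (repl i j) ⟨i, j, rfl⟩ Y).trans
      (p.sub_congr (liftMap_repl _ i j) _ _ _)) hnr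

end CylAlg

/-! ### The main theorem -/

theorem mainTheorem7 (n : ℕ) (hn : 2 < n) :
    (∀ (K : CylAlg.Kind) (k : ℕ), 4 ≤ k →
      ¬ CylAlg.AtomCanonical (CylAlg.SNr K (Nat.le_add_right n k))) ∧
    ∃ (X : Type) (F : CylAlg.AtomStr .PEA n X),
      F.Cm.IsModel ∧ CylAlg.Representable F.tm F.Tm ∧
      ∃ (D : BooleanSubalgebra (Set X)) (hD : F.Cm.IsSubalgebra D), Finite D ∧
        ¬ CylAlg.SNr .Sc (Nat.le_add_right n 4) D (F.Cm.restrict hD).rdSc := by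
  obtain ⟨m, rfl⟩ := Nat.exists_eq_add_of_le' (Nat.succ_le_of_lt hn)
  obtain ⟨srt, c, h⟩ := CylAlg.exists_rich
  obtain ⟨P, hP⟩ := CylAlg.exists_generic m
  have h₀ : 0 < m + 3 := Nat.succ_pos _
  let B := h.graphBlur hP
  refine ⟨fun K k hk hc => h.not_sNr_cm hP K hk ?_, _, B.ops.At,
    CylAlg.isModel_cm_at B.isModel_ops (B.atomAdditive_ops h₀), B.representable_tm h₀,
    B.classAlg, B.isSubalgebra_classAlg h₀, B.finite_classAlg h₀, h.not_sNr_classAlg hP⟩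
  exact hc B.alg (B.ops.rd K) (B.sNr_alg h₀ K _) (B.isAtomic h₀)
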